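/- Let $L/K$ be a finite Galois extension of number fields with group $G=\mathrm{Gal}(L/K)$, and assume that the square root of the inverse different of $L/K$ exists, i.e. there is a (necessarily unique and $G$-stable) fractional ideal $\mathcal{A}_{L/K}$ of $L$ with $\mathcal{A}_{L/K}^2=\mathcal{D}_{L/K}^{-1}$, where $\mathcal{D}_{L/K}$ is the different of $L/K$. For a finite place $v$ of $K$ and a place $w$ of $L$ above $v$, let $G_w$ be the decomposition group of $w$ in $G$, identified with $\mathrm{Gal}(L_w/K_v)$, and let $\mathcal{A}_{L_w/K_v}$ be the (existing and unique) fractional $\mathcal{O}_{L_w}$-ideal whose square is the inverse different of $L_w/K_v$. Then the following conditions are equivalent. (i) $\mathcal{A}_{L/K}$ is a projective $\mathcal{O}_K[G]$-module. (ii) For every finite place $v$ of $K$ and every place $w$ of $L$ above $v$, the $\mathcal{O}_{K_v}[G_w]$-module $\mathcal{A}_{L_w/K_v}$ is free. (ii') For every finite place $v$ of $K$ there is a place $w$ of $L$ above $v$ for which the $\mathcal{O}_{K_v}[G_w]$-module $\mathcal{A}_{L_w/K_v}$ is free. (iii) $L/K$ is weakly ramified, i.e. for every finite place $w$ of $L$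 the second ramification subgroup of $w$ in $G$ (in the lower numbering), $\{\sigma\in G : \sigma(x)\equiv x \bmod \mathfrak{p}_w^{3} \text{ for all } x\in\mathcal{O}_L\}$, is trivial, where $\mathfrak{p}_w$ is the prime ideal of $\mathcal{O}_L$ corresponding to $w$. -/

import Mathlib

open NumberField IsDedekindDomain IsDedekindDomain.HeightOneSpectrum
open scoped nonZeroDivisors MonoidAlgebra

noncomputable section

namespace SqrtInverseDifferent

/-! ### Completions at finite places

For number fields `L / K` and finite places `w ∣ v`, the inclusion `K ⊆ L` extends by continuity to
`K_v → L_w`, and this restricts to `O_{K_v} → O_{L_w}`. -/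

section Completion

variable {K L : Type*} [Field K] [NumberField K] [Field L] [NumberField L] [Algebra K L]
variable (v : HeightOneSpectrum (𝓞 K)) (w : HeightOneSpectrum (𝓞 L))
variable [w.asIdeal.LiesOver v.asIdeal]

/-- The continuous extension `K_v → L_w` of `algebraMap K L`. -/
def completionMap : v.adicCompletion K →+* w.adicCompletion L :=
  ((adicCompletion.equiv L w).symm.toRingHom.comp
    (UniformSpace.Completion.mapRingHom
      (algebraMap (WithVal (v.valuation K)) (WithVal (w.valuation L)))
      (uniformContinuous_algebraMap_liesOver K L v w).continuous)).comp
    (adicCompletion.equiv K v).toRingHom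

theorem continuous_completionMap : Continuous (completionMap v w) :=
  (adicCompletion.continuous_ofCompletion L w).comp <|
    UniformSpace.Completion.continuous_map.comp (adicCompletion.continuous_toCompletion K v)

theorem completionMap_algebraMap (x : K) :
    completionMap v w (algebraMap K (v.adicCompletion K) x) =
      algebraMap L (w.adicCompletion L) (algebraMap K L x) := by
  apply adicCompletion.ext
  exact UniformSpace.Completion.mapRingHom_coe
    (uniformContinuous_algebraMap_liesOver K L v w).continuous _

theorem completionMap_mem_integers {x : v.adicCompletion K} (hx : x ∈ v.adicCompletionIntegers K) :
    completionMap v w x ∈ w.adicCompletionIntegers L := by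
  have hcl : IsClosed {y : v.adicCompletion K |
      y ∉ v.adicCompletionIntegers K ∨ completionMap v w y ∈ w.adicCompletionIntegers L} := by
    refine IsClosed.union (IsOpen.isClosed_compl (Valued.isOpen_valuationSubring _)) ?_
    exact (Valued.isClosed_valuationSubring (w.adicCompletion L)).preimage
      (continuous_completionMap v w)
  have hall : ∀ y : v.adicCompletion K,
      y ∉ v.adicCompletionIntegers K ∨ completionMap v w y ∈ w.adicCompletionIntegers L := by
    intro y
    refine (denseRange_algebraMap K v).induction_on
      (p := fun y => y ∉ v.adicCompletionIntegers K ∨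
        completionMap v w y ∈ w.adicCompletionIntegers L) y hcl ?_
    intro a
    refine or_iff_not_imp_left.2 fun ha => ?_
    rw [not_not, mem_adicCompletionIntegers] at ha
    rw [completionMap_algebraMap, mem_adicCompletionIntegers]
    change Valued.v ((a : K) : v.adicCompletion K) ≤ 1 at ha
    change Valued.v ((algebraMap K L a : L) : w.adicCompletion L) ≤ 1
    rw [valuedAdicCompletion_eq_valuation'] at ha ⊢
    rw [← valuation_liesOver L v w]
    exact pow_le_one₀ zero_le ha
  exact (hall x).resolve_left (not_not.2 hx)

instance algebraCompletion : Algebra (v.adicCompletion K) (w.adicCompletion L) :=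
  (completionMap v w).toAlgebra

instance algebraCompletionIntegers :
    Algebra (v.adicCompletionIntegers K) (w.adicCompletionIntegers L) :=
  (((completionMap v w).comp (v.adicCompletionIntegers K).subtype).codRestrict
    (w.adicCompletionIntegers L).toSubring
    fun x => completionMap_mem_integers v w x.2).toAlgebra

instance isTorsionFree_completionIntegers :
    Module.IsTorsionFree (v.adicCompletionIntegers K) (w.adicCompletionIntegers L) := by
  refine Module.isTorsionFree_iff_algebraMap_injective.2 fun x y h => ?_
  exact Subtype.ext ((completionMap v w).injective (congrArg Subtype.val h))

end Completion

/-! ### The square root of the inverse different -/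

/-- `I` is a square root of the inverse different of `B / A`, as a fractional ideal of the fraction
field `L` of `B`: `I ^ 2 = 𝔇_{B/A}⁻¹`. There is at most one such `I`. -/
def IsSqrtInverseDifferent (A : Type*) {B L : Type*} [CommRing A] [IsDomain A] [CommRing B]
    [IsDedekindDomain B] [Algebra A B] [Module.IsTorsionFree A B] [Field L] [Algebra B L]
    [IsFractionRing B L] (I : FractionalIdeal B⁰ L) : Prop :=
  I ^ 2 = (differentIdeal A B : FractionalIdeal B⁰ L)⁻¹

/-! ### Galois modules -/

section GaloisModule

variable (A K : Type*) {B L : Type*} [CommRing A] [Field K] [Field L] [Algebra K L] [Algebra A K]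
variable [Algebra A L] [IsScalarTower A K L] [CommRing B] [Algebra B L]

variable (L) in
/-- The natural action of `Gal(L/K)` on `L`, as an `A`-linear representation. The associated
`A[Gal(L/K)]`-module is `(galoisRep A K L).asModule`. -/
abbrev galoisRep : Representation A (L ≃ₐ[K] L) L :=
  Representation.ofDistribMulAction A (L ≃ₐ[K] L) L

/-- `I` is stable under `Gal(L/K)`, and is projective as a module over `A[Gal(L/K)]`. -/
def IsProjectiveGaloisModule (I : FractionalIdeal B⁰ L) : Prop :=
  ∃ M : Submodule A[L ≃ₐ[K] L] (galoisRep A K L).asModule,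
    (∀ x : L, (galoisRep A K L).asModuleEquiv.symm x ∈ M ↔ x ∈ I) ∧
      Module.Projective A[L ≃ₐ[K] L] M

/-- `I` is stable under `Gal(L/K)`, and is free as a module over `A[Gal(L/K)]`. -/
def IsFreeGaloisModule (I : FractionalIdeal B⁰ L) : Prop :=
  ∃ M : Submodule A[L ≃ₐ[K] L] (galoisRep A K L).asModule,
    (∀ x : L, (galoisRep A K L).asModuleEquiv.symm x ∈ M ↔ x ∈ I) ∧
      Module.Free A[L ≃ₐ[K] L] M

end GaloisModule

section Local

variable {K L : Type*} [Field K] [NumberField K] [Field L] [NumberField L] [Algebra K L]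

/-- The square root `𝒜_{L_w/K_v}` of the inverse different of `L_w / K_v` exists and is a free
`O_{K_v}[Gal(L_w/K_v)]`-module. -/
def IsLocallyFreeAt (v : HeightOneSpectrum (𝓞 K)) (w : HeightOneSpectrum (𝓞 L))
    [w.asIdeal.LiesOver v.asIdeal] : Prop :=
  ∃ I : FractionalIdeal (w.adicCompletionIntegers L)⁰ (w.adicCompletion L),
    IsSqrtInverseDifferent (v.adicCompletionIntegers K) I ∧
      IsFreeGaloisModule (v.adicCompletionIntegers K) (v.adicCompletion K) I

end Local

/-! ### Weak ramification -/

section Ramification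

variable (K L : Type*) [Field K] [Field L] [NumberField L] [Algebra K L]

variable {L} in
/-- The `i`-th ramification group (lower numbering) in `Gal(L/K)` of a finite place `w` of `L`:
the `σ` that act trivially on `𝓞 L / w ^ (i + 1)`. For `i = 0` this is the inertia group. -/
def lowerRamificationGroup (w : HeightOneSpectrum (𝓞 L)) (i : ℕ) : Subgroup (L ≃ₐ[K] L) :=
  (w.asIdeal ^ (i + 1)).toAddSubgroup.inertia (L ≃ₐ[K] L)

/-- `L/K` is weakly ramified: the second ramification group of every finite place is trivial. -/
def IsWeaklyRamified : Prop :=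
  ∀ w : HeightOneSpectrum (𝓞 L), lowerRamificationGroup K w 2 = ⊥

end Ramification

end SqrtInverseDifferent

end

/-!
Fix a prime `w` of `L` above the prime `v` of `K`, and let `D ≥ G₀ ≥ G₁ ≥ G₂` be its decomposition
and ramification groups, `e = |G₀|` and `q = |G₁|`. All four conditions are compared with the
triviality of the groups `G₂`, for `L / K` as well as for the completions `L_w / K_v`. The ideals of
both are treated through valuations: `P ^ n` denotes the elements of valuation at least `n` at `w`.

*A projective square root forces `G₂ = 1`.* In a projective module over a group ring, an element
fixed by `σ` is a trace from the group generated by `σ` (`exists_sum_pow_smul_eq`). But if `σ` has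
prime order `n` and lies in `G₂`, then this trace raises valuations by at least `2 (n - 1)`, since
`n` itself has valuation at least `2 (n - 1)` (`map_prime_le`), whereas `P ^ b` contains fixed
elements of valuation at most `b + n - 1` (`not_exists_trace_eq`). Nothing is used here about the
fractional ideal but that its exponent at `w` is some `b`.

*If `G₂ = 1`, the exponent of the square root is `1` modulo `q`.* Let `π` be a uniformizer and
`T(λ)` a lift of a generator of the multiplicative group of the residue field. An element close to
`π + T(λ)` is moved with valuation `0` by the elements of `D` outside of `G₀`, with valuation `1` by
those of `G₀` outside of `G₁`, and with valuation `2` by the nontrivial ones of `G₁`, which bounds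
the exponent of the different by `(e - q) + 2 (q - 1)`; and the trace of `P ^ (2 - e - q)` is
integral. Hence the exponent of the different is `e + q - 2` (`count_differentIdeal_le`,
`le_count_differentIdeal`). As `e / q` is the order of a root of unity in the residue field and `q`
is a power of the residue characteristic, the two are coprime, and the exponent
`b = -(e + q - 2) / 2` is congruent to `1` modulo `q` (`IsSqrtInverseDifferent.exists_count_eq`).

*If `G₂ = 1` and `b ≡ 1` modulo `q`, then `P ^ b` modulo `P ^ (b + e)` is cyclic over the group ring
`k[D]` of the residue field `k` of `v`* (`ResidueLift.exists_generator_mod`). Residue classes are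
lifted to Teichmüller representatives, which makes this quotient a vector space over the residue
field of `w` with a semilinear action of `D`. Cyclicity can be tested after killing the augmentation
ideal of `G₁`, as `G₁` is a `p`-group. Euler's formula for the trace of `π ^ (q - 1) / f'(π)`, with
`f` the polynomial whose roots are the conjugates of `π` under `G₁`, gives an element of `P ^ b`
whose `G₁`-orbit is a basis of `P ^ b` modulo `P ^ (b + q)`; hence the augmentation ideal carries
`P ^ b` onto `P ^ (b + 1)` modulo `P ^ (b + q)`. The same holds for the shifts `b + q j` of `b`, so
that modulo the augmentation ideal the quotient is spanned by the `e / q` classes of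
`π ^ (b + q j)`, on which a generator of `G₀ / G₁` is triangular with distinct eigenvalues, and has
a cyclic vector (`exists_cyclic_vector_of_flag`). What remains is the descent from the residue field
of `w` to `k` along the semilinear action, which comes down to a count of homomorphisms into simple
modules (`exists_generator_of_semilinear`).

*From one prime to the module.* An element of the fractional ideal which approximates such a
generator at `w`, and is small at the other primes above `v`, generates it modulo `v` over the full
group ring, because the semilocal module is induced from `D` (`exists_generator_mod_smul`). By
Nakayama's lemma it generates up to multiplication by an element prime to `v`, and by a count of
dimensions its conjugates are linearly independent. So the module is projective if this holds at
every `v`, and free if the base is local (`isProjectiveGaloisModule_of_generator_mod`,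
`isFreeGaloisModule_of_generator_mod`).

These arguments are carried out for Dedekind domains with finite residue fields, so that they apply
to the rings of integers of `L / K` and of `L_w / K_v`. The group `D` acts on `L_w` by continuity;
an element of `L_w` fixed by `D` is a limit of traces from `L` to `K`, hence lies in `K_v`
(`mem_range_algebraMap_completion`). This identifies `D` with the Galois group of `L_w / K_v`,
compatibly with ramification groups (`decompositionEquiv_mem_inertia_iff`). That one place above
each `v` is enough follows as the ramification groups of conjugate primes are conjugate.
-/

noncomputable section

namespace SqrtInverseDifferent

/-! ### Cyclicity of finite modules -/

section Cyclic

universe u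

variable {Λ : Type*} {M : Type u} [Ring Λ] [AddCommGroup M] [Module Λ M]

/-- A generator of maximal order generates everything: a simple summand `S` outside of `Λ y` could
be adjoined by passing to some `y + s`, unless every `s ∈ S` is the image of `y` under a
homomorphism `Λ y → S`, and then there are at least `2 |S|` homomorphisms `M → S`. -/
theorem exists_span_singleton_eq_top_of_isSemisimpleModule [Finite M] [IsSemisimpleModule Λ M]
    (h : ∀ (S : Type u) [AddCommGroup S] [Module Λ S] [IsSimpleModule Λ S] (f : M →ₗ[Λ] S),
      Function.Surjective f → Nat.card (M →ₗ[Λ] S) ≤ Nat.card S) :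
    ∃ y : M, Submodule.span Λ {y} = ⊤ := by
  obtain ⟨y, hy⟩ := Finite.exists_max fun y : M => Nat.card (Submodule.span Λ {y})
  refine ⟨y, ?_⟩
  by_contra hne
  set N := Submodule.span Λ {y} with hN
  obtain ⟨W, hW⟩ := exists_isCompl N
  have hW0 : W ≠ ⊥ := by
    rintro rfl
    exact hne (by simpa using hW.sup_eq_top)
  obtain ⟨S, hSW, hS⟩ := (IsSemisimpleModule.eq_bot_or_exists_simple_le W).resolve_left hW0
  have hNS : Disjoint N S := hW.disjoint.mono_right hSW
  have hS0 : S ≠ ⊥ := (isSimpleModule_iff_isAtom.1 hS).1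
  obtain ⟨C, hC⟩ := exists_isCompl S
  have hcard := h S (S.projectionOnto C hC) (S.projectionOnto_surjective hC)
  by_cases hex : ∃ s ∈ S, ∃ a : Λ, a • y = 0 ∧ a • s ≠ 0
  · obtain ⟨s, hs, a, hay, has⟩ := hex
    have hmem : a • s ∈ Submodule.span Λ {y + s} := by
      have : a • (y + s) = a • s := by rw [smul_add, hay, zero_add]
      rw [← this]
      exact Submodule.smul_mem _ _ (Submodule.mem_span_singleton_self _)
    have hSle : S ≤ Submodule.span Λ {y + s} := by
      have hatom := isSimpleModule_iff_isAtom.1 hS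
      rcases hatom.le_iff.1 (inf_le_left : S ⊓ Submodule.span Λ {y + s} ≤ S) with h0 | h1
      · have : a • s ∈ S ⊓ Submodule.span Λ {y + s} := ⟨S.smul_mem a hs, hmem⟩
        rw [h0, Submodule.mem_bot] at this
        exact absurd this has
      · exact inf_eq_left.1 h1
    have hNle : N ≤ Submodule.span Λ {y + s} := by
      rw [hN, Submodule.span_singleton_le_iff_mem]
      simpa using Submodule.sub_mem _ (Submodule.mem_span_singleton_self (y + s)) (hSle hs)
    have hlt : N < Submodule.span Λ {y + s} := by
      refine lt_of_le_of_ne hNle fun heq => hS0 ?_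
      rw [← heq] at hSle
      exact (hNS.symm.eq_bot_of_le hSle)
    have := Set.ncard_lt_ncard (SetLike.coe_ssubset_coe.2 hlt)
    exact absurd (hy (y + s)) (not_le.2 this)
  · push Not at hex
    -- Homomorphisms can be prescribed on `y`, on which any value in `S` is possible, and on `S`,
    -- where the zero map and the identity already make two choices.
    have key : ∀ p : S × Bool, ∃ f : M →ₗ[Λ] S, f y = p.1 ∧ ∀ x : S, f x = cond p.2 x 0 := by
      rintro ⟨s, b⟩
      have hker : LinearMap.ker (LinearMap.toSpanSingleton Λ M y) ≤
          LinearMap.ker (LinearMap.toSpanSingleton Λ S s) := fun a ha => by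
        rw [LinearMap.mem_ker, LinearMap.toSpanSingleton_apply] at ha ⊢
        exact Subtype.ext (hex s s.2 a ha)
      let e := (LinearMap.toSpanSingleton Λ M y).quotKerEquivRange
      let g : LinearMap.range (LinearMap.toSpanSingleton Λ M y) →ₗ[Λ] S :=
        (Submodule.liftQ _ (LinearMap.toSpanSingleton Λ S s) hker) ∘ₗ e.symm.toLinearMap
      have hr : LinearMap.range (LinearMap.toSpanSingleton Λ M y) = N := by
        rw [hN, LinearMap.span_singleton_eq_range]
      have hinj : Function.Injective ((LinearMap.range
          (LinearMap.toSpanSingleton Λ M y)).subtype.coprod S.subtype) := by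
        rw [← LinearMap.ker_eq_bot, LinearMap.ker_coprod_of_disjoint_range]
        · simp
        · simpa [hr] using hNS
      obtain ⟨f, hf⟩ := IsSemisimpleModule.extension_property _ hinj
        (g.coprod (cond b (LinearMap.id : S →ₗ[Λ] S) 0))
      refine ⟨f, ?_, fun x => ?_⟩
      · have := LinearMap.congr_fun hf (⟨y, 1, by simp⟩, 0)
        simp only [LinearMap.coe_comp, Function.comp_apply, LinearMap.coprod_apply,
          Submodule.subtype_apply, map_zero, add_zero] at this
        rw [this]
        have he : e.symm ⟨y, 1, by simp⟩ = Submodule.Quotient.mk 1 := by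
          rw [LinearEquiv.symm_apply_eq]
          exact Subtype.ext (by simp [e])
        simp [g, he]
      · have := LinearMap.congr_fun hf (0, x)
        simp only [LinearMap.coe_comp, Function.comp_apply, LinearMap.coprod_apply,
          Submodule.subtype_apply, map_zero, zero_add] at this
        rw [this]
        cases b <;> simp
    choose F hF1 hF2 using key
    have hFinj : Function.Injective F := by
      rintro ⟨s, b⟩ ⟨s', b'⟩ heq
      have h1 : s = s' := (hF1 (s, b)).symm.trans ((LinearMap.congr_fun heq y).trans (hF1 (s', b')))
      obtain ⟨x, hx, hx0⟩ := (Submodule.ne_bot_iff S).1 hS0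
      have h2 : cond b (⟨x, hx⟩ : S) 0 = cond b' ⟨x, hx⟩ 0 :=
        (hF2 (s, b) ⟨x, hx⟩).symm.trans ((LinearMap.congr_fun heq x).trans (hF2 (s', b') ⟨x, hx⟩))
      have h3 : (⟨x, hx⟩ : S) ≠ 0 := fun h => hx0 (congrArg Subtype.val h)
      cases b <;> cases b' <;>
        first | exact Prod.ext h1 rfl | exact absurd h2 h3 | exact absurd h2.symm h3
    have hfin : Finite (M →ₗ[Λ] S) := DFunLike.finite _
    have hle := Nat.card_le_card_of_injective F hFinj
    rw [Nat.card_prod, Nat.card_eq_two_iff.2 ⟨true, false, by simp, by ext b; cases b <;> simp⟩]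
      at hle
    have hpos : 0 < Nat.card S := Nat.card_pos
    omega

/-- A finite module is cyclic as soon as no simple quotient `S` admits more than `|S|` homomorphisms
from it: the radical is superfluous, so a generator of the semisimple quotient lifts. -/
theorem exists_span_singleton_eq_top [Finite M]
    (h : ∀ (S : Type u) [AddCommGroup S] [Module Λ S] [IsSimpleModule Λ S] (f : M →ₗ[Λ] S),
      Function.Surjective f → Nat.card (M →ₗ[Λ] S) ≤ Nat.card S) :
    ∃ y : M, Submodule.span Λ {y} = ⊤ := by
  set J := Module.jacobson Λ M with hJ
  have hfin : Finite (M ⧸ J) := Finite.of_surjective _ J.mkQ_surjective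
  have hss : IsSemisimpleModule Λ (M ⧸ J) := by
    rw [IsArtinian.isSemisimpleModule_iff_jacobson]
    exact Module.jacobson_quotient_jacobson Λ M
  obtain ⟨z, hz⟩ := exists_span_singleton_eq_top_of_isSemisimpleModule (Λ := Λ) (M := M ⧸ J)
    fun S _ _ _ f hf => by
      have hS : Finite S := Finite.of_surjective _ hf
      have : Finite (M →ₗ[Λ] S) := DFunLike.finite _
      refine (Nat.card_le_card_of_injective (fun g : (M ⧸ J) →ₗ[Λ] S => g ∘ₗ J.mkQ)
        fun g₁ g₂ hg => ?_).trans (h S (f ∘ₗ J.mkQ) (hf.comp J.mkQ_surjective))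
      exact LinearMap.cancel_right J.mkQ_surjective |>.1 hg
  obtain ⟨y, rfl⟩ := J.mkQ_surjective z
  refine ⟨y, ?_⟩
  by_contra hne
  obtain ⟨m, hm, hym⟩ := (eq_top_or_exists_le_coatom (Submodule.span Λ {y})).resolve_left hne
  have hJm : J ≤ m := sInf_le hm
  refine hm.1 (eq_top_iff.2 fun x _ => ?_)
  have hx : J.mkQ x ∈ Submodule.span Λ {J.mkQ y} := hz ▸ Submodule.mem_top
  obtain ⟨a, ha⟩ := Submodule.mem_span_singleton.1 hx
  rw [← map_smul, ← sub_eq_zero, ← map_sub, Submodule.mkQ_apply,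
    Submodule.Quotient.mk_eq_zero] at ha
  have h1 := hym (Submodule.smul_mem _ a (Submodule.mem_span_singleton_self y))
  simpa using m.sub_mem h1 (hJm ha)

end Cyclic

/-! ### Semilinear actions on finite vector spaces -/

section Semilinear

universe u

variable {k l : Type*} {V : Type u} {G : Type*} [Field k] [Field l] [Algebra k l] [Finite l]
  [Group G] [MulSemiringAction G l]
  [AddCommGroup V] [Finite V] [Module l V] [DistribMulAction G V]

/-- A normal `p`-subgroup acts trivially on a finite simple module in characteristic `p`. -/
theorem single_smul_eq_of_isSimpleModule {p : ℕ} [Fact p.Prime] [CharP k p] {S : Type*}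
    [AddCommGroup S] [Module k[G] S] [IsSimpleModule k[G] S] [Finite S]
    (N : Subgroup G) [N.Normal] (hN : IsPGroup p N) (h : N) (s : S) :
    (MonoidAlgebra.single (h : G) (1 : k)) • s = s := by
  let T : Submodule k[G] S :=
    { carrier := {s | ∀ h : N, (MonoidAlgebra.single (h : G) (1 : k)) • s = s}
      add_mem' := fun ha hb h => by rw [smul_add, ha h, hb h]
      zero_mem' := fun h => smul_zero _
      smul_mem' := fun c x hx h => by
        induction c using MonoidAlgebra.induction_linear with
        | zero => rw [zero_smul, smul_zero]
        | add a b ha hb => rw [add_smul, smul_add, ha, hb]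
        | single g r =>
          have h1 := hx ⟨g⁻¹ * h * g, by simpa using ‹N.Normal›.conj_mem h h.2 g⁻¹⟩
          conv_rhs => rw [← h1]
          rw [smul_smul, smul_smul, MonoidAlgebra.single_mul_single,
            MonoidAlgebra.single_mul_single]
          simp [mul_assoc] }
  have hT : T ≠ ⊥ := by
    let : MulAction N S :=
      { smul h s := (MonoidAlgebra.single (h : G) (1 : k)) • s
        one_smul s := by
          change (MonoidAlgebra.single ((1 : N) : G) (1 : k)) • s = s
          rw [Subgroup.coe_one, ← MonoidAlgebra.one_def, one_smul]
        mul_smul a b s := by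
          change (MonoidAlgebra.single ((a * b : N) : G) (1 : k)) • s =
            (MonoidAlgebra.single (a : G) (1 : k)) • (MonoidAlgebra.single (b : G) (1 : k)) • s
          rw [smul_smul, MonoidAlgebra.single_mul_single, mul_one, Subgroup.coe_mul] }
    have := IsSimpleModule.nontrivial k[G] S
    obtain ⟨x, hx⟩ := exists_ne (0 : S)
    have hp : p ∣ Nat.card S := by
      have h0 : p • x = 0 := by
        rw [← Nat.cast_smul_eq_nsmul k[G], ← map_natCast (algebraMap k k[G]),
          CharP.cast_eq_zero, map_zero, zero_smul]
      rw [← addOrderOf_eq_prime h0 hx]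
      exact addOrderOf_dvd_natCard x
    obtain ⟨b, hb, hb0⟩ := hN.exists_fixed_point_of_prime_dvd_card_of_fixed_point S hp
      (a := 0) fun h => smul_zero (MonoidAlgebra.single (h : G) (1 : k))
    exact (Submodule.ne_bot_iff _).2 ⟨b, fun h => hb h, hb0.symm⟩
  have : s ∈ T := by
    rw [(eq_bot_or_eq_top T).resolve_left hT]
    trivial
  exact this h

/-- A finite `l`-space `V` with a semilinear action of `G` is cyclic over `k[G]` as soon as it is
cyclic over the group ring over `l` of the group `G₀` of elements acting linearly, modulo the
augmentation ideal of a normal `p`-subgroup `N`.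

For a simple quotient `S` of `V`, on which `N` acts trivially, and a `k`-basis `b` of `l`, a family
`(φ a)` of `k[G]`-linear maps `V → S` is determined by the values `∑ a, φ a (b a * b c • y)`: if
these vanish, so does the map `∑ a, φ a (b a • ·)`, and summing over the conjugates of the `b a`
kills every `φ a`. Hence `|Hom(V, S)| ≤ |S|`. -/
theorem exists_generator_of_semilinear [Fintype G] {p : ℕ} [Fact p.Prime] [CharP k p]
    (hcomm : ∀ (g : G) (a : k), g • algebraMap k l a = algebraMap k l a)
    (haut : ∀ τ : l ≃ₐ[k] l, ∃ g : G, ∀ x, τ x = g • x)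
    (hsemi : ∀ (g : G) (c : l) (x : V), g • (c • x) = (g • c) • (g • x))
    (N : Subgroup G) [N.Normal] (hN : IsPGroup p N) (G₀ : Set G) (hNG₀ : ∀ h ∈ N, h ∈ G₀)
    (hG₀ : ∀ g ∈ G₀, ∀ c : l, g • c = c) (y : V)
    (hy : Submodule.span l
      ({x | ∃ g ∈ G₀, x = g • y} ∪ {x | ∃ h ∈ N, ∃ u : V, x = h • u - u}) = ⊤) :
    ∃ z : V, ∀ x : V, ∃ a : G → k, x = ∑ g, algebraMap k l (a g) • g • z := by
  let : Module k V := Module.compHom V (algebraMap k l)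
  have hk : ∀ (a : k) (x : V), a • x = algebraMap k l a • x := fun a x => rfl
  let ρ : Representation k G V :=
    { toFun g :=
        { toFun x := g • x
          map_add' := smul_add g
          map_smul' a x := by rw [hk, hsemi, hcomm]; rfl }
      map_one' := by ext x; exact one_smul G x
      map_mul' g h := by ext x; exact mul_smul g h x }
  let : Module k[G] V := Module.compHom V ρ.asAlgebraHom.toRingHom
  have hsingle : ∀ (g : G) (a : k) (x : V),
      (MonoidAlgebra.single g a : k[G]) • x = algebraMap k l a • g • x := fun g a x => by
    change ρ.asAlgebraHom (MonoidAlgebra.single g a) x = _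
    rw [Representation.asAlgebraHom_single]
    rfl
  obtain ⟨z, hz⟩ := exists_span_singleton_eq_top (Λ := k[G]) (M := V) fun S _ _ _ f hf => by
    have hfin : Finite S := Finite.of_surjective _ hf
    have hfin' : Finite (V →ₗ[k[G]] S) := DFunLike.finite _
    have hfink : Finite k := Finite.of_injective _ (algebraMap k l).injective
    have hfd : Module.Finite k l := inferInstance
    have hmap : ∀ (φ : V →ₗ[k[G]] S) (g : G) (x : V),
        φ (g • x) = (MonoidAlgebra.single g (1 : k)) • φ x := fun φ g x => by
      rw [← map_smul, hsingle, map_one, one_smul]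
    have hmapk : ∀ (φ : V →ₗ[k[G]] S) (a : k) (x : V),
        φ (algebraMap k l a • x) = (MonoidAlgebra.single (1 : G) a) • φ x := fun φ a x => by
      rw [← map_smul, hsingle, one_smul]
    have htriv : ∀ (φ : V →ₗ[k[G]] S) (h : G), h ∈ N → ∀ x, φ (h • x) = φ x := fun φ h hh x => by
      rw [hmap]
      exact single_smul_eq_of_isSimpleModule N hN ⟨h, hh⟩ _
    let b := Module.finBasis k l
    -- A family `ψ` of homomorphisms is determined by the values `∑ a, ψ a ((b a * b c) • y)`.
    have hdet : ∀ ψ : Fin (Module.finrank k l) → (V →ₗ[k[G]] S),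
        (∀ c, ∑ a, ψ a ((b a * b c) • y) = 0) → ∀ a, ψ a = 0 := by
      intro ψ hψ
      have h1 : ∀ c : l, ∑ a, ψ a ((b a * c) • y) = 0 := by
        intro c
        have hc : ∀ a, ψ a ((b a * c) • y) =
            ∑ i, (MonoidAlgebra.single (1 : G) (b.repr c i)) • ψ a ((b a * b i) • y) := by
          intro a
          conv_lhs => rw [← b.sum_repr c]
          rw [Finset.mul_sum, Finset.sum_smul, map_sum]
          refine Finset.sum_congr rfl fun i _ => ?_
          rw [← hmapk, Algebra.smul_def, smul_smul]
          congr 2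
          ring
        rw [Finset.sum_congr rfl fun a _ => hc a, Finset.sum_comm]
        refine Finset.sum_eq_zero fun i _ => ?_
        rw [← Finset.smul_sum, hψ, smul_zero]
      -- This extends from `y` to `V`: elements of `G₀` act linearly, and homomorphisms into `S`
      -- kill the augmentation ideal of `N`.
      have h2 : ∀ (v : V) (c : l), ∑ a, ψ a ((b a * c) • v) = 0 := by
        intro v
        have hv : v ∈ (⊤ : Submodule l V) := trivial
        rw [← hy] at hv
        induction hv using Submodule.span_induction with
        | mem x hx =>
          intro c
          rcases hx with ⟨g, hg, rfl⟩ | ⟨h, hh, u, rfl⟩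
          · have : ∀ a, ψ a ((b a * c) • g • y) =
                (MonoidAlgebra.single g (1 : k)) • ψ a ((b a * c) • y) := fun a => by
              rw [← hmap, hsemi, hG₀ g hg]
            rw [Finset.sum_congr rfl fun a _ => this a, ← Finset.smul_sum, h1, smul_zero]
          · refine Finset.sum_eq_zero fun a _ => ?_
            rw [smul_sub, map_sub, ← hG₀ h (hNG₀ h hh) (b a * c), ← hsemi, htriv _ h hh,
              hG₀ h (hNG₀ h hh), sub_self]
        | zero => intro c; simp
        | add x y _ _ hx hy => intro c; simp [smul_add, Finset.sum_add_distrib, hx c, hy c]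
        | smul d x _ hx =>
          intro c
          rw [← hx (c * d)]
          refine Finset.sum_congr rfl fun a _ => ?_
          rw [smul_smul, mul_assoc]
      -- Elements of `G` inducing `τ` on `l` allow to twist the coefficients. Summing over `τ` turns
      -- them into traces, among which the dual basis singles out each `ψ i`.
      have h3 : ∀ (τ : l ≃ₐ[k] l) (v : V) (c : l), ∑ a, ψ a (τ (b a * c) • v) = 0 := by
        intro τ v c
        obtain ⟨g, hg⟩ := haut τ
        have : ∀ a, ψ a (τ (b a * c) • v) =
            (MonoidAlgebra.single g (1 : k)) • ψ a ((b a * c) • g⁻¹ • v) := fun a => by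
          rw [← hmap, hsemi, smul_inv_smul, hg]
        rw [Finset.sum_congr rfl fun a _ => this a, ← Finset.smul_sum, h2, smul_zero]
      intro i
      ext v
      have h4 : ∑ a, ψ a (algebraMap k l (Algebra.trace k l (b a * b.traceDual i)) • v) = 0 := by
        simp_rw [trace_eq_sum_automorphisms, Finset.sum_smul, map_sum]
        rw [Finset.sum_comm]
        exact Finset.sum_eq_zero fun τ _ => h3 τ v _
      rw [Finset.sum_eq_single i] at h4
      · simpa [mul_comm (b i), Module.Basis.trace_traceDual_mul] using h4
      · intro a _ ha
        rw [mul_comm, Module.Basis.trace_traceDual_mul]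
        simp [ha]
      · simp
    have hcard : Nat.card (Fin (Module.finrank k l) → (V →ₗ[k[G]] S)) ≤
        Nat.card (Fin (Module.finrank k l) → S) := by
      refine Nat.card_le_card_of_injective (fun ψ c => ∑ a, ψ a ((b a * b c) • y))
        fun ψ₁ ψ₂ h => ?_
      funext a
      rw [← sub_eq_zero]
      refine hdet (fun a => ψ₁ a - ψ₂ a) (fun c => ?_) a
      simpa [Finset.sum_sub_distrib, sub_eq_zero] using congrFun h c
    rw [Nat.card_fun, Nat.card_fun, Nat.card_fin] at hcard
    exact (Nat.pow_le_pow_iff_left Module.finrank_pos.ne').1 hcard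
  refine ⟨z, fun x => ?_⟩
  obtain ⟨a, ha⟩ := Submodule.mem_span_singleton.1
    (hz ▸ Submodule.mem_top : x ∈ Submodule.span k[G] {z})
  refine ⟨fun g => a.coeff g, ?_⟩
  rw [← ha]
  change ρ.asAlgebraHom a z = _
  rw [Representation.asAlgebraHom_def, MonoidAlgebra.lift_apply,
    Finsupp.sum_fintype _ _ (by simp), LinearMap.sum_apply]
  rfl

end Semilinear

/-! ### Cyclic vectors and independent orbits -/

section LinearAlgebra

variable {l V : Type*} [Field l] [AddCommGroup V] [Module l V]

/-- Every nonzero left ideal of the group ring of a `p`-group over a field of characteristic `p`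
contains the norm element, so an orbit whose sum is nonzero is linearly independent. -/
theorem linearIndependent_orbit_of_isPGroup [Finite l] {p : ℕ} [Fact p.Prime] [CharP l p]
    {H : Type*} [Group H] [Fintype H] (hH : IsPGroup p H) [DistribMulAction H V]
    [SMulCommClass H l V] (y : V) (hy : ∑ h : H, h • y ≠ 0) :
    LinearIndependent l fun h : H => h • y := by
  let T : AddSubgroup (H → l) :=
    { carrier := {c | ∑ h, c h • h • y = 0}
      add_mem' := fun {a b} ha hb => by
        simp only [Set.mem_ofPred_eq, Pi.add_apply, add_smul, Finset.sum_add_distrib] at *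
        rw [ha, hb, add_zero]
      zero_mem' := by simp
      neg_mem' := fun {a} ha => by
        simp only [Set.mem_ofPred_eq, Pi.neg_apply, neg_smul, Finset.sum_neg_distrib] at *
        rw [ha, neg_zero] }
  have hT : ∀ (g : H) (c : H → l), c ∈ T → (fun h => c (g⁻¹ * h)) ∈ T := fun g c hc => by
    change ∑ h, c (g⁻¹ * h) • h • y = 0
    rw [← Equiv.sum_comp (Equiv.mulLeft g)]
    have := congrArg (g • ·) (show ∑ h, c h • h • y = 0 from hc)
    simpa [Finset.smul_sum, smul_comm g, mul_smul] using this
  let : MulAction H T :=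
    { smul g c := ⟨fun h => c.1 (g⁻¹ * h), hT g c.1 c.2⟩
      one_smul c := Subtype.ext (funext fun h => show c.1 (1⁻¹ * h) = c.1 h by simp)
      mul_smul a b c := Subtype.ext (funext fun h =>
        show c.1 ((a * b)⁻¹ * h) = c.1 (b⁻¹ * (a⁻¹ * h)) by simp [mul_assoc]) }
  rw [Fintype.linearIndependent_iff]
  intro c hc
  by_contra! hne
  have hp : p ∣ Nat.card T := by
    have h0 : p • (⟨c, hc⟩ : T) = 0 := by
      ext h
      simp
    have hx : (⟨c, hc⟩ : T) ≠ 0 := fun h => by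
      obtain ⟨i, hi⟩ := hne
      exact hi (congrFun (congrArg Subtype.val h) i)
    rw [← addOrderOf_eq_prime h0 hx]
    exact addOrderOf_dvd_natCard _
  obtain ⟨d, hd, hd0⟩ := hH.exists_fixed_point_of_prime_dvd_card_of_fixed_point T hp
    (a := 0) fun h => rfl
  have hconst : ∀ h, d.1 h = d.1 1 := fun h => by
    have := congrFun (congrArg Subtype.val (hd h)) h
    change d.1 (h⁻¹ * h) = d.1 h at this
    rw [← this, inv_mul_cancel]
  have hsum : ∑ h, d.1 h • h • y = 0 := d.2
  simp_rw [hconst, ← Finset.smul_sum] at hsum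
  have h1 := (smul_eq_zero.1 hsum).resolve_right hy
  exact hd0 (Subtype.ext (funext fun h => by rw [hconst, h1]; rfl))

open Polynomial in
/-- An endomorphism which is triangular with distinct eigenvalues, relative to a flag
`F 0 ≥ F 1 ≥ … ≥ F t`, has a cyclic vector modulo `F t`. -/
theorem exists_cyclic_vector_of_flag (f : V →ₗ[l] V) (F : ℕ → Submodule l V) (x : ℕ → V)
    (μ : ℕ → l) (t : ℕ) (hF : ∀ j < t, F j = Submodule.span l {x j} ⊔ F (j + 1))
    (hfF : ∀ j ≤ t, ∀ v ∈ F j, f v ∈ F j)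
    (hx : ∀ j < t, f (x j) - μ j • x j ∈ F (j + 1))
    (hμ : ∀ i < t, ∀ j < t, μ i = μ j → i = j) :
    ∃ y ∈ F 0, F 0 ≤ Submodule.span l {v | ∃ i : ℕ, v = (f ^ i) y} ⊔ F t := by
  have haev : ∀ (q : l[X]) (j : ℕ), j ≤ t → ∀ v ∈ F j, aeval f q v ∈ F j := by
    intro q j hj v hv
    induction q using Polynomial.induction_on' with
    | add p q hp hq => rw [map_add]; exact (F j).add_mem hp hq
    | monomial n a =>
      rw [aeval_monomial, Module.End.mul_apply, Module.algebraMap_end_apply]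
      refine (F j).smul_mem _ ?_
      induction n with
      | zero => simpa
      | succ n ih => rw [pow_succ', Module.End.mul_apply]; exact hfF j hj _ ih
  have hspan : ∀ (q : l[X]) (y : V),
      aeval f q y ∈ Submodule.span l {v | ∃ i : ℕ, v = (f ^ i) y} := by
    intro q y
    induction q using Polynomial.induction_on' with
    | add p q hp hq => rw [map_add]; exact Submodule.add_mem _ hp hq
    | monomial n a =>
      rw [aeval_monomial, Module.End.mul_apply, Module.algebraMap_end_apply]
      exact Submodule.smul_mem _ _ (Submodule.subset_span ⟨n, rfl⟩)
  -- Descending induction on `j`, together with a polynomial in `f` which kills `F j` modulo `F t`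
  -- and does not vanish at the earlier eigenvalues.
  have main : ∀ j ≤ t, (∃ y ∈ F j, ∀ v ∈ F j, ∃ q : l[X], v - aeval f q y ∈ F t) ∧
      ∃ q : l[X], (∀ v ∈ F j, aeval f q v ∈ F t) ∧ ∀ i < j, q.eval (μ i) ≠ 0 := by
    intro j hj
    induction hj using Nat.decreasingInduction with
    | self =>
      exact ⟨⟨0, (F t).zero_mem, fun v hv => ⟨0, by simpa using hv⟩⟩, 1,
        fun v hv => by simpa using hv, fun i hi => by simp⟩
    | of_succ j hj ih =>
      obtain ⟨⟨y, hyF, hy⟩, q, hq, hq0⟩ := ih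
      have hle : F (j + 1) ≤ F j := by rw [hF j hj]; exact le_sup_right
      have hxj : x j ∈ F j := by
        rw [hF j hj]
        exact Submodule.mem_sup_left (Submodule.mem_span_singleton_self _)
      have hqj := hq0 j (Nat.lt_succ_self j)
      have hmulx : ∀ r : l[X], aeval f r (x j) - r.eval (μ j) • x j ∈ F (j + 1) := by
        intro r
        obtain ⟨s, hs⟩ := Polynomial.X_sub_C_dvd_sub_C_eval (a := μ j) (p := r)
        have h1 : aeval f r (x j) - r.eval (μ j) • x j = aeval f s (f (x j) - μ j • x j) := by
          have h2 := congrArg (fun r => aeval f r (x j)) hs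
          simp only [map_sub, aeval_C, LinearMap.sub_apply, Module.algebraMap_end_apply] at h2
          rw [h2, mul_comm, map_mul, Module.End.mul_apply]
          simp
        rw [h1]
        exact haev s (j + 1) hj _ (hx j hj)
      -- the component of `x j` in the eigenspace of `μ j`, up to a scalar
      have hx' : ∀ r : l[X],
          aeval f r (aeval f q (x j)) - r.eval (μ j) • aeval f q (x j) ∈ F t := by
        intro r
        have := hq _ (hmulx r)
        rw [map_sub, map_smul] at this
        rwa [← Module.End.mul_apply, ← map_mul, mul_comm r q, map_mul, Module.End.mul_apply]
      refine ⟨⟨aeval f q (x j) + y, (F j).add_mem (haev q j hj.le _ hxj) (hle hyF), ?_⟩, ?_⟩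
      · -- `q` recovers the eigenvector, which in turn recovers `y` and the class of `x j`
        have he : ∃ r : l[X], aeval f q (x j) - aeval f r (aeval f q (x j) + y) ∈ F t := by
          refine ⟨C (q.eval (μ j))⁻¹ * q, ?_⟩
          have h1 := hx' (C (q.eval (μ j))⁻¹ * q)
          rw [eval_mul, eval_C, inv_mul_cancel₀ hqj, one_smul] at h1
          have h2 := (F t).smul_mem (q.eval (μ j))⁻¹ (hq y hyF)
          rw [map_add]
          have h3 : aeval f (C (q.eval (μ j))⁻¹ * q) y = (q.eval (μ j))⁻¹ • aeval f q y := by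
            rw [map_mul, aeval_C, Module.End.mul_apply, Module.algebraMap_end_apply]
          rw [h3]
          have := (F t).neg_mem ((F t).add_mem h1 h2)
          convert this using 1
          abel
        obtain ⟨r, hr⟩ := he
        have hvy : ∀ v ∈ F (j + 1), ∃ s : l[X], v - aeval f s (aeval f q (x j) + y) ∈ F t := by
          intro v hv
          obtain ⟨s, hs⟩ := hy v hv
          refine ⟨s - s * r, ?_⟩
          have h1 := haev s t le_rfl _ hr
          have := (F t).sub_mem hs h1
          convert this using 1
          simp only [map_sub, map_mul, map_add, LinearMap.sub_apply, Module.End.mul_apply]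
          abel
        intro v hv
        rw [hF j hj, Submodule.mem_sup] at hv
        obtain ⟨a, ha, v', hv', rfl⟩ := hv
        obtain ⟨c, rfl⟩ := Submodule.mem_span_singleton.1 ha
        have h1 := hmulx q
        have h2 := (F (j + 1)).smul_mem (c * (q.eval (μ j))⁻¹) h1
        obtain ⟨s, hs⟩ := hvy _ ((F (j + 1)).sub_mem hv' h2)
        refine ⟨s + C (c * (q.eval (μ j))⁻¹) * r, ?_⟩
        have h3 := (F t).smul_mem (c * (q.eval (μ j))⁻¹) hr
        have := (F t).add_mem hs h3
        convert this using 1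
        simp only [smul_sub, smul_add, map_add, map_mul, LinearMap.add_apply,
          Module.End.mul_apply, aeval_C, Module.algebraMap_end_apply, smul_smul, mul_assoc,
          inv_mul_cancel₀ hqj, mul_one]
        abel
      · refine ⟨q * (X - C (μ j)), fun v hv => ?_, fun i hi => ?_⟩
        · rw [map_mul, Module.End.mul_apply]
          refine hq _ ?_
          rw [hF j hj, Submodule.mem_sup] at hv
          obtain ⟨a, ha, v', hv', rfl⟩ := hv
          obtain ⟨c, rfl⟩ := Submodule.mem_span_singleton.1 ha
          rw [map_add, map_smul]
          refine (F (j + 1)).add_mem ((F (j + 1)).smul_mem _ ?_) (haev _ _ hj _ hv')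
          simpa using hx j hj
        · rw [eval_mul, eval_sub, eval_X, eval_C]
          exact mul_ne_zero (hq0 i (hi.trans (Nat.lt_succ_self j)))
            (sub_ne_zero.2 fun h => hi.ne (hμ i (hi.trans hj) j hj h))
  obtain ⟨⟨y, hyF, hy⟩, -⟩ := main 0 (Nat.zero_le t)
  refine ⟨y, hyF, fun v hv => ?_⟩
  obtain ⟨q, hq⟩ := hy v hv
  rw [← add_sub_cancel (aeval f q y) v]
  exact Submodule.add_mem_sup (hspan q y) hq

end LinearAlgebra

/-! ### Discretely valued fields with a group action -/

section Valuation

open WithZero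

variable {L : Type*} [Field L] {v : Valuation L (WithZero (Multiplicative ℤ))}

theorem map_mul_le_exp {x y : L} {a b : ℤ} (hx : v x ≤ exp a) (hy : v y ≤ exp b) :
    v (x * y) ≤ exp (a + b) := by
  rw [map_mul, exp_add]
  exact mul_le_mul' hx hy

theorem lt_exp_iff_le_exp_sub_one {γ : WithZero (Multiplicative ℤ)} {a : ℤ} :
    γ < exp a ↔ γ ≤ exp (a - 1) := by
  induction γ using WithZero.expRecOn with
  | zero => simp only [zero_le, exp_pos]
  | exp m => rw [exp_lt_exp, exp_le_exp]; omega

theorem le_exp_of_le {γ : WithZero (Multiplicative ℤ)} {a b : ℤ} (h : γ ≤ exp a) (hab : a ≤ b) :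
    γ ≤ exp b :=
  h.trans (exp_le_exp.2 hab)

theorem exists_eq_exp {x : L} (hx : x ≠ 0) : ∃ m : ℤ, v x = exp m :=
  ⟨log (v x), (exp_log ((Valuation.ne_zero_iff v).2 hx)).symm⟩

theorem map_sub_le_of_sub_le {x y z : L} {γ : WithZero (Multiplicative ℤ)} (h₁ : v (x - y) ≤ γ)
    (h₂ : v (y - z) ≤ γ) : v (x - z) ≤ γ := by
  rw [← sub_add_sub_cancel x y z]
  exact v.map_add_le h₁ h₂

theorem map_sub_comm_le {x y : L} {γ : WithZero (Multiplicative ℤ)} (h : v (x - y) ≤ γ) :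
    v (y - x) ≤ γ := by
  rwa [Valuation.map_sub_swap]

theorem map_eq_of_sub_lt {x y : L} (h : v (x - y) < v y) : v x = v y := by
  rw [← sub_add_cancel x y, v.map_add_eq_of_lt_right h]

variable {D : Type*} [Group D] [MulSemiringAction D L]

open Polynomial in
/-- With `δ = σ - 1`, the trace `1 + σ + ⋯ + σ ^ (n - 1)` is `∑ (n choose (k + 1)) δ ^ k`. -/
theorem sum_pow_smul_eq (σ : D) (n : ℕ) (x : L) :
    ∑ i ∈ Finset.range n, σ ^ i • x = ∑ k ∈ Finset.range n,
      (n.choose (k + 1) : L) * (fun y => σ • y - y)^[k] x := by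
  let s : AddMonoid.End L := DistribMulAction.toAddMonoidEnd D L σ
  have hs : ∀ i y, (s ^ i) y = σ ^ i • y := fun i y => by
    simp only [s, ← map_pow]
    rfl
  have hd : ∀ k, ((s - 1) ^ k) x = (fun y => σ • y - y)^[k] x := fun k => by
    induction k with
    | zero => rfl
    | succ k ih =>
      rw [pow_succ', Function.iterate_succ_apply', ← ih]
      rfl
  have h := congrArg (fun p => aeval (s - 1) p x) (geom_sum_X_comp_X_add_one_eq_sum (R := ℤ) n)
  simp only [aeval_comp, map_sum, map_pow, aeval_X, map_mul, map_natCast, map_add, map_one,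
    sub_add_cancel] at h
  simp only [← hs, ← hd]
  have e1 : ∀ f : ℕ → AddMonoid.End L, (∑ i ∈ Finset.range n, f i) x =
      ∑ i ∈ Finset.range n, f i x := fun f => AddMonoidHom.finsetSum_apply _ _ _
  rw [e1, e1] at h
  rw [h]
  refine Finset.sum_congr rfl fun k _ => ?_
  change (n.choose (k + 1) : AddMonoid.End L) (((s - 1) ^ k) x) = _
  rw [AddMonoid.End.natCast_apply, nsmul_eq_mul]

section Jump

variable {σ : D} {i : ℕ} (hσ : ∀ x, v (σ • x - x) ≤ exp (-(i : ℤ)) * v x)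

include hσ

theorem map_iterate_sub_le (k : ℕ) (x : L) :
    v ((fun y => σ • y - y)^[k] x) ≤ exp (-((i * k : ℕ) : ℤ)) * v x := by
  induction k with
  | zero => simp
  | succ k ih =>
    rw [Function.iterate_succ_apply']
    refine (hσ _).trans ((mul_le_mul_right ih _).trans ?_)
    rw [← mul_assoc, ← exp_add]
    refine le_of_eq ?_
    congr 2
    push_cast
    ring

variable {n : ℕ} [Fact n.Prime]

omit hσ [Fact n.Prime] in
theorem map_natCast_le_one (m : ℕ) : v (m : L) ≤ 1 := by
  induction m with
  | zero => simp
  | succ m ih =>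
    rw [Nat.cast_succ]
    exact v.map_add_le ih v.map_one.le

omit hσ in
theorem map_choose_le {k : ℕ} (hk0 : k ≠ 0) (hk : k < n) : v (n.choose k : L) ≤ v (n : L) := by
  obtain ⟨m, hm⟩ := (Fact.out (p := n.Prime)).dvd_choose_self hk0 hk
  rw [hm, Nat.cast_mul, map_mul]
  exact mul_le_of_le_one_right' (map_natCast_le_one m)

/-- An automorphism of prime order `n` that moves valuations by at least `i ≥ 1` forces `n` to have
valuation at least `i (n - 1)`: for `u = σ x - x ≠ 0` the trace of `u` vanishes, and in its
expansion in powers of `σ - 1` the first term `n u` can only be cancelled by the last one,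
`(σ - 1) ^ (n - 1) u`. -/
theorem map_prime_le (hi : 1 ≤ i) (hn : σ ^ n = 1) {x : L} (hx : σ • x ≠ x) :
    v (n : L) ≤ exp (-((i * (n - 1) : ℕ) : ℤ)) := by
  have hp : n.Prime := Fact.out
  by_contra! hlt
  set u := σ • x - x with hu
  have hu0 : v u ≠ 0 := (Valuation.ne_zero_iff v).2 (sub_ne_zero.2 hx)
  have htr : ∑ j ∈ Finset.range n, σ ^ j • u = 0 := by
    have : ∀ j ∈ Finset.range n, σ ^ j • u = σ ^ (j + 1) • x - σ ^ j • x := fun j _ => by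
      rw [hu, smul_sub, smul_smul, pow_succ]
    rw [Finset.sum_congr rfl this, Finset.sum_range_sub (fun j => σ ^ j • x)]
    simp [hn]
  rw [sum_pow_smul_eq, ← Finset.sum_erase_add _ _ (Finset.mem_range.2 hp.pos)] at htr
  simp only [zero_add, Nat.choose_one_right, Function.iterate_zero, id_eq] at htr
  have hnu : v (n : L) * v u ≠ 0 := mul_ne_zero ((zero_lt_iff.1 (zero_le.trans_lt hlt))) hu0
  have hsmall : v (∑ k ∈ (Finset.range n).erase 0,
      (n.choose (k + 1) : L) * (fun y => σ • y - y)^[k] u) < v (n : L) * v u := by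
    refine v.map_sum_lt hnu fun k hk => ?_
    rw [Finset.mem_erase, Finset.mem_range] at hk
    have hit := map_iterate_sub_le hσ k u
    rw [map_mul]
    rcases Nat.lt_or_ge (k + 1) n with hkn | hkn
    · refine (mul_le_mul' (map_choose_le (Nat.succ_ne_zero k) hkn) hit).trans_lt ?_
      rw [← mul_assoc, mul_right_comm]
      refine mul_lt_of_lt_one_right (zero_lt_iff.2 hnu) ?_
      rw [← exp_zero, exp_lt_exp, neg_lt_zero, Nat.cast_pos]
      exact Nat.mul_pos hi (Nat.pos_of_ne_zero hk.1)
    · obtain rfl : k = n - 1 := by omega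
      refine (mul_le_mul' (map_natCast_le_one _) hit).trans_lt ?_
      rw [one_mul]
      exact mul_lt_mul_of_pos_right hlt (zero_lt_iff.2 hu0)
  rw [eq_neg_of_add_eq_zero_left htr, Valuation.map_neg, map_mul] at hsmall
  exact lt_irrefl _ hsmall

/-- The trace from the group generated by `σ` raises valuations by at least `i (n - 1)`: so do
multiplication by `n` and `(σ - 1) ^ (n - 1)`. -/
theorem map_sum_pow_smul_le (hi : 1 ≤ i) (hn : σ ^ n = 1) {y : L} (hy : σ • y ≠ y) (x : L) :
    v (∑ j ∈ Finset.range n, σ ^ j • x) ≤ exp (-((i * (n - 1) : ℕ) : ℤ)) * v x := by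
  rw [sum_pow_smul_eq]
  refine v.map_sum_le fun k hk => ?_
  rw [Finset.mem_range] at hk
  have hit := map_iterate_sub_le hσ k x
  rw [map_mul]
  rcases Nat.lt_or_ge (k + 1) n with hkn | hkn
  · refine mul_le_mul' ((map_choose_le (Nat.succ_ne_zero k) hkn).trans
      (map_prime_le hσ hi hn hy)) (hit.trans ?_)
    refine mul_le_of_le_one_left' ?_
    rw [← exp_zero, exp_le_exp]
    omega
  · obtain rfl : k = n - 1 := by omega
    refine (mul_le_mul' (map_natCast_le_one _) hit).trans ?_
    rw [one_mul]

end Jump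

section Ramification

variable (hv : ∀ (g : D) (x : L), v (g • x) = v x)

/-- The `i`-th ramification group, in the lower numbering, of a group `D` of automorphisms of a
discretely valued field. -/
def ramificationGroup (i : ℕ) : Subgroup D where
  carrier := {g | ∀ x, v x ≤ 1 → v (g • x - x) ≤ exp (-(i + 1 : ℤ))}
  one_mem' x _ := by simp
  mul_mem' {g h} hg hh x hx := by
    rw [mul_smul]
    refine map_sub_le_of_sub_le (y := g • x) ?_ (hg x hx)
    rw [← smul_sub, hv]
    exact hh x hx
  inv_mem' {g} hg x hx := by
    have : g⁻¹ • x - x = -(g⁻¹ • (g • x - x)) := by rw [smul_sub, inv_smul_smul]; ring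
    rw [this, Valuation.map_neg, hv]
    exact hg x hx

instance ramificationGroup_normal (i : ℕ) : (ramificationGroup hv i).Normal where
  conj_mem g hg h x hx := by
    have := hg (h⁻¹ • x) (by rwa [hv])
    rw [← hv h, smul_sub, smul_inv_smul, smul_smul, smul_smul] at this
    simpa [mul_assoc] using this

theorem ramificationGroup_antitone {i j : ℕ} (hij : i ≤ j) :
    ramificationGroup hv j ≤ ramificationGroup hv i := fun _ hg x hx =>
  le_exp_of_le (hg x hx) (by omega)

include hv in
/-- The elements `x` with `σ x / x ≡ 1` modulo the `i`-th power of the maximal ideal form a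
group. -/
theorem map_smul_sub_le_mul {σ : D} {i : ℤ} {x y : L}
    (hx : v (σ • x - x) ≤ exp (-i) * v x) (hy : v (σ • y - y) ≤ exp (-i) * v y) :
    v (σ • (x * y) - x * y) ≤ exp (-i) * v (x * y) := by
  have : σ • (x * y) - x * y = (σ • x) * (σ • y - y) + (σ • x - x) * y := by
    rw [smul_mul']; ring
  rw [this, map_mul v x y]
  refine v.map_add_le ?_ ?_
  · rw [map_mul, hv, mul_left_comm]
    exact mul_le_mul_right hy _
  · rw [map_mul, ← mul_assoc]
    exact mul_le_mul_left hx _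

include hv in
theorem map_smul_sub_le_inv {σ : D} {i : ℤ} {x : L}
    (hx : v (σ • x - x) ≤ exp (-i) * v x) : v (σ • x⁻¹ - x⁻¹) ≤ exp (-i) * v x⁻¹ := by
  rcases eq_or_ne x 0 with rfl | h0
  · simp
  have hσ0 : σ • x ≠ 0 := by rwa [smul_ne_zero_iff_ne]
  have : σ • x⁻¹ - x⁻¹ = -((σ • x - x) * ((σ • x)⁻¹ * x⁻¹)) := by
    rw [smul_inv'']
    field_simp
    ring
  have hvx : v x ≠ 0 := (Valuation.ne_zero_iff v).2 h0
  rw [this, Valuation.map_neg, map_mul, map_mul, map_inv₀, map_inv₀, hv]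
  refine (mul_le_mul_left hx _).trans (le_of_eq ?_)
  rw [mul_assoc, mul_inv_cancel_left₀ hvx]

theorem map_smul_sub_le_of_mem_ramificationGroup {π : L} (hπ : v π = exp (-1)) {i : ℕ} {σ : D}
    (hσ : σ ∈ ramificationGroup hv i) (x : L) : v (σ • x - x) ≤ exp (-(i : ℤ)) * v x := by
  rcases eq_or_ne x 0 with rfl | h0
  · simp
  have hunit : ∀ u, v u = 1 → v (σ • u - u) ≤ exp (-(i : ℤ)) * v u := fun u hu => by
    rw [hu, mul_one]
    exact le_exp_of_le (hσ u hu.le) (by omega)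
  have hπ1 : v (σ • π - π) ≤ exp (-(i : ℤ)) * v π := by
    rw [hπ, ← exp_add]
    refine le_exp_of_le (hσ π ?_) (by omega)
    rw [hπ, ← exp_zero, exp_le_exp]
    omega
  have hπn : ∀ n : ℕ, v (σ • π ^ n - π ^ n) ≤ exp (-(i : ℤ)) * v (π ^ n) := fun n => by
    induction n with
    | zero => simp
    | succ n ih => rw [pow_succ]; exact map_smul_sub_le_mul hv ih hπ1
  have hπz : ∀ n : ℤ, v (σ • π ^ n - π ^ n) ≤ exp (-(i : ℤ)) * v (π ^ n) := fun n => by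
    cases n with
    | ofNat n => simpa using hπn n
    | negSucc n => rw [zpow_negSucc]; exact map_smul_sub_le_inv hv (hπn _)
  obtain ⟨m, hm⟩ := exists_eq_exp (v := v) h0
  have hπ0 : π ≠ 0 := (Valuation.ne_zero_iff v).1 (by rw [hπ]; exact exp_ne_zero)
  have hx : x = (x * π ^ m) * π ^ (-m) := by
    rw [mul_assoc, ← zpow_add₀ hπ0, add_neg_cancel, zpow_zero, mul_one]
  rw [hx]
  refine map_smul_sub_le_mul hv (hunit _ ?_) (hπz _)
  rw [map_mul, map_zpow₀, hπ, hm, ← exp_zsmul, ← exp_add, smul_eq_mul, ← exp_zero]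
  congr 1
  omega

/-- The obstruction to projectivity. An automorphism `σ` of prime order in the second ramification
group increases the valuation of traces by `2 (n - 1)`, whereas the norm of a uniformizer is
`σ`-fixed of valuation `n`, so that fixed elements have valuations in steps of at most `n`. -/
theorem not_exists_trace_eq {π : L} (hπ : v π = exp (-1)) {n : ℕ} [Fact n.Prime] {σ : D}
    (hσ : σ ∈ ramificationGroup hv 2) (hn : σ ^ n = 1) {y : L} (hy : σ • y ≠ y) {b c : ℤ}
    (hbc : n * c ≤ b + n - 1) {x z : L} (hz : v z = exp (-(n * c))) (hx : v x ≤ exp (-b)) :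
    ∑ j ∈ Finset.range n, σ ^ j • x ≠ z := by
  intro h
  have h1 := map_sum_pow_smul_le (map_smul_sub_le_of_mem_ramificationGroup hv hπ hσ)
    one_le_two hn hy x
  rw [h, hz] at h1
  have h2 := h1.trans (mul_le_mul_right hx _)
  rw [← exp_add, exp_le_exp] at h2
  have := (Fact.out (p := n.Prime)).two_le
  push_cast [show 1 ≤ n by omega] at h2
  have : (2 : ℤ) ≤ n := by exact_mod_cast this
  linarith

end Ramification

end Valuation

/-! ### Euler's trace formula -/

section Euler

/-- Euler's formula for the trace of `π ^ (n - 1) / f'(π)`, where `f = ∏ (X - h π)`: the leading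
coefficient of the Lagrange interpolation polynomial of `X ^ (n - 1)` at the conjugates of `π`. -/
theorem sum_smul_pow_div_prod_sub {L H : Type*} [Field L] [Group H] [Fintype H] [DecidableEq H]
    [MulSemiringAction H L] {π : L} (hπ : Function.Injective fun h : H => h • π) :
    ∑ h : H, h • (π ^ (Fintype.card H - 1) / ∏ j ∈ Finset.univ.erase (1 : H), (π - j • π)) = 1 := by
  have h1 := Lagrange.coeff_eq_sum (s := Finset.univ) (v := fun h : H => h • π) hπ.injOn
    (P := Polynomial.X ^ (Fintype.card H - 1)) (by
      rw [Polynomial.degree_X_pow, Finset.card_univ, Nat.cast_lt]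
      exact Nat.sub_lt Fintype.card_pos one_pos)
  rw [Finset.card_univ, Polynomial.coeff_X_pow_self] at h1
  rw [h1]
  refine Finset.sum_congr rfl fun h _ => ?_
  rw [div_eq_mul_inv, smul_mul', smul_inv'', smul_pow', Polynomial.eval_pow, Polynomial.eval_X,
    div_eq_mul_inv, Finset.smul_prod']
  congr 2
  refine Finset.prod_bij (fun j _ => h * j) (fun j hj => ?_) (fun _ _ _ _ h => mul_left_cancel h)
    (fun j hj => ⟨h⁻¹ * j, ?_, by simp⟩) (fun j _ => by rw [smul_sub, mul_smul])
  · simpa using hj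
  · simpa [inv_mul_eq_one, eq_comm] using hj

end Euler

/-! ### Residue lifts and the tame character -/

section ResidueLift

open WithZero

variable {L : Type*} [Field L] (v : Valuation L (WithZero (Multiplicative ℤ)))
  (D : Type*) [Group D] [MulSemiringAction D L] (l : Type*) [Field l] [MulSemiringAction D l]

/-- A lift of the residue field `l` to representatives that are additive, multiplicative and
`D`-equivariant modulo the `e`-th power of the maximal ideal, hence an equivariant copy of `l` in
the valuation ring modulo that power. Equivariance is also required modulo the third power, which
decides membership in the second ramification group. -/
structure ResidueLift (e : ℕ) where
  /-- The representative of a residue class. -/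
  toFun : l → L
  map_le_one : ∀ a, v (toFun a) ≤ 1
  map_add_sub : ∀ a b, v (toFun (a + b) - (toFun a + toFun b)) ≤ exp (-(e : ℤ))
  map_mul_sub : ∀ a b, v (toFun (a * b) - toFun a * toFun b) ≤ exp (-(e : ℤ))
  map_one_sub : v (toFun 1 - 1) ≤ exp (-(e : ℤ))
  map_smul_sub : ∀ (g : D) a, v (g • toFun a - toFun (g • a)) ≤ exp (-(e : ℤ))
  map_smul_sub_three : ∀ (g : D) a, v (g • toFun a - toFun (g • a)) ≤ exp (-3)
  exists_sub_le : ∀ x, v x ≤ 1 → ∃ a, v (x - toFun a) ≤ exp (-1)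

namespace ResidueLift

variable {v D l} {e : ℕ} (T : ResidueLift v D l e)

theorem map_zero_le : v (T.toFun 0) ≤ exp (-(e : ℤ)) := by
  have := T.map_add_sub 0 0
  rw [add_zero] at this
  rwa [← Valuation.map_neg, show -T.toFun 0 = T.toFun 0 - (T.toFun 0 + T.toFun 0) by ring]

theorem map_natCast_sub_le (n : ℕ) : v (T.toFun (n : l) - n) ≤ exp (-(e : ℤ)) := by
  induction n with
  | zero => simpa using T.map_zero_le
  | succ n ih =>
    rw [Nat.cast_succ, Nat.cast_succ]
    refine map_sub_le_of_sub_le (T.map_add_sub _ _) ?_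
    rw [add_sub_add_comm]
    exact v.map_add_le ih T.map_one_sub

include T in
theorem map_char_le (p : ℕ) [CharP l p] : v (p : L) ≤ exp (-(e : ℤ)) := by
  have h := T.map_natCast_sub_le p
  rw [CharP.cast_eq_zero] at h
  rw [← sub_sub_cancel (T.toFun 0) (p : L)]
  exact v.map_sub_le T.map_zero_le h

variable (he : 1 ≤ e)

include T he

theorem map_eq_one {a : l} (ha : a ≠ 0) : v (T.toFun a) = 1 := by
  have h1 := T.map_mul_sub a a⁻¹
  rw [mul_inv_cancel₀ ha] at h1
  have h2 := map_sub_le_of_sub_le (map_sub_comm_le h1) T.map_one_sub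
  have h3 : v (T.toFun a * T.toFun a⁻¹) = 1 := by
    rw [← v.map_one]
    refine map_eq_of_sub_lt (h2.trans_lt ?_)
    rw [v.map_one, ← exp_zero, exp_lt_exp]
    omega
  rw [map_mul] at h3
  refine le_antisymm (T.map_le_one a) ?_
  rw [← h3]
  exact mul_le_of_le_one_right' (T.map_le_one _)

theorem eq_zero_of_map_le {a : l} (ha : v (T.toFun a) ≤ exp (-1)) : a = 0 := by
  by_contra h
  rw [T.map_eq_one he h, ← exp_zero, exp_le_exp] at ha
  omega

theorem eq_of_map_sub_le {a b : l} (h : v (T.toFun a - T.toFun b) ≤ exp (-1)) : a = b := by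
  refine sub_eq_zero.1 (T.eq_zero_of_map_le he ?_)
  have h1 := T.map_add_sub (a - b) b
  rw [sub_add_cancel] at h1
  have : T.toFun (a - b) = (T.toFun a - T.toFun b) -
      (T.toFun a - (T.toFun (a - b) + T.toFun b)) := by ring
  rw [this]
  exact v.map_sub_le h (le_exp_of_le h1 (by omega))

variable (hv : ∀ (g : D) (x : L), v (g • x) = v x)

theorem mem_ramificationGroup_zero_iff {g : D} :
    g ∈ ramificationGroup hv 0 ↔ ∀ a : l, g • a = a := by
  constructor
  · intro hg a
    have h1 := hg _ (T.map_le_one a)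
    refine T.eq_of_map_sub_le he (map_sub_le_of_sub_le (map_sub_comm_le
      (le_exp_of_le (T.map_smul_sub_three g a) (by omega))) (le_exp_of_le h1 (by omega)))
  · intro hg x hx
    obtain ⟨a, ha⟩ := T.exists_sub_le x hx
    have h1 := T.map_smul_sub_three g a
    rw [hg] at h1
    have h2 : v (g • x - g • T.toFun a) ≤ exp (-1) := by
      rw [← smul_sub, hv]
      exact ha
    exact le_exp_of_le (map_sub_le_of_sub_le h2 (map_sub_le_of_sub_le
      (le_exp_of_le h1 (by omega)) (map_sub_comm_le ha))) (by omega)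

/-- Up to the second ramification group, an inertial automorphism is tested on a uniformizer. -/
theorem mem_ramificationGroup_of_uniformizer {π : L} (hπ : v π = exp (-1)) {g : D}
    (hg : g ∈ ramificationGroup hv 0) {i : ℕ} (hi : i ≤ 2)
    (hgπ : v (g • π - π) ≤ exp (-(i + 1 : ℤ))) : g ∈ ramificationGroup hv i := by
  have hπ0 : π ≠ 0 := (Valuation.ne_zero_iff v).1 (by rw [hπ]; exact exp_ne_zero)
  have key : ∀ j ≤ i, g ∈ ramificationGroup hv j := by
    intro j hj
    induction j with
    | zero => exact hg
    | succ j ih =>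
      intro x hx
      obtain ⟨a, ha⟩ := T.exists_sub_le x hx
      have h1 := T.map_smul_sub_three g a
      rw [(T.mem_ramificationGroup_zero_iff he hv).1 hg a] at h1
      set z := π⁻¹ * (x - T.toFun a) with hz
      have hz1 : v z ≤ 1 := by
        rw [← exp_zero]
        refine (map_mul_le_exp (a := 1) (b := -1) ?_ ha).trans (by simp)
        rw [map_inv₀, hπ, ← exp_neg]
        simp
      have hxz : x = T.toFun a + π * z := by
        rw [hz, mul_inv_cancel_left₀ hπ0]
        ring
      have h2 := ih (by omega) z hz1
      have : g • x - x = (g • T.toFun a - T.toFun a) +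
          ((g • π - π) * (g • z) + π * (g • z - z)) := by
        conv_lhs => rw [hxz]
        rw [smul_add, smul_mul']
        ring
      rw [this]
      refine v.map_add_le (le_exp_of_le h1 (by push_cast; omega)) (v.map_add_le ?_ ?_)
      · refine (map_mul_le_exp (b := 0) hgπ ?_).trans (exp_le_exp.2 (by push_cast; omega))
        rw [hv, exp_zero]
        exact hz1
      · refine (map_mul_le_exp hπ.le h2).trans (exp_le_exp.2 (by push_cast; omega))
  exact key i le_rfl

omit he in
theorem exists_sub_mul_zpow_le {π : L} (hπ : v π = exp (-1)) {x : L} {m : ℤ}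
    (hx : v x ≤ exp (-m)) : ∃ a, v (x - T.toFun a * π ^ m) ≤ exp (-(m + 1)) := by
  have hπ0 : π ≠ 0 := (Valuation.ne_zero_iff v).1 (by rw [hπ]; exact exp_ne_zero)
  have hπm : ∀ m : ℤ, v (π ^ m) = exp (-m) := fun m => by
    rw [map_zpow₀, hπ, ← exp_zsmul]
    simp
  obtain ⟨a, ha⟩ := T.exists_sub_le (x * π ^ (-m)) (by
    rw [← exp_zero]
    exact (map_mul_le_exp hx (hπm _).le).trans (exp_le_exp.2 (by omega)))
  refine ⟨a, ?_⟩
  have : x - T.toFun a * π ^ m = (x * π ^ (-m) - T.toFun a) * π ^ m := by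
    rw [sub_mul, mul_assoc, ← zpow_add₀ hπ0]
    simp
  rw [this]
  exact (map_mul_le_exp ha (hπm m).le).trans (exp_le_exp.2 (by omega))

section Eigen

variable {π : L} (hπ : v π = exp (-1))

omit he in
include hv in
theorem eigen_mul {g : D} {x y : L} {a b : l} (hx : v (g • x - T.toFun a * x) ≤ exp (-1) * v x)
    (hy : v (g • y - T.toFun b * y) ≤ exp (-1) * v y) (he : 1 ≤ e) :
    v (g • (x * y) - T.toFun (a * b) * (x * y)) ≤ exp (-1) * v (x * y) := by
  have : g • (x * y) - T.toFun (a * b) * (x * y) =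
      (g • x) * (g • y - T.toFun b * y) + (g • x - T.toFun a * x) * (T.toFun b * y) -
        (T.toFun (a * b) - T.toFun a * T.toFun b) * (x * y) := by
    rw [smul_mul']
    ring
  rw [this]
  refine v.map_sub_le (v.map_add_le ?_ ?_) ?_
  · rw [map_mul, map_mul, hv, mul_left_comm]
    exact mul_le_mul_right hy _
  · rw [map_mul, map_mul v (T.toFun b), map_mul v x, ← mul_assoc (exp (-1))]
    exact mul_le_mul' hx (mul_le_of_le_one_left' (T.map_le_one b))
  · rw [map_mul]
    exact mul_le_mul_left (le_exp_of_le (T.map_mul_sub a b) (by omega)) _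

include hv in
theorem eigen_inv {g : D} {x : L} {a : l} (ha : a ≠ 0)
    (hx : v (g • x - T.toFun a * x) ≤ exp (-1) * v x) :
    v (g • x⁻¹ - T.toFun a⁻¹ * x⁻¹) ≤ exp (-1) * v x⁻¹ := by
  rcases eq_or_ne x 0 with rfl | h0
  · simp
  have hg0 : g • x ≠ 0 := by rwa [smul_ne_zero_iff_ne]
  have hvx : v x ≠ 0 := (Valuation.ne_zero_iff v).2 h0
  have : g • x⁻¹ - T.toFun a⁻¹ * x⁻¹ =
      (-(T.toFun a⁻¹ * (g • x - T.toFun a * x)) -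
        ((T.toFun (a * a⁻¹) - 1) - (T.toFun (a * a⁻¹) - T.toFun a * T.toFun a⁻¹)) * x) *
          ((g • x)⁻¹ * x⁻¹) := by
    rw [smul_inv'']
    field_simp
    ring
  rw [this, map_mul, map_mul, map_inv₀, map_inv₀, hv]
  have h1 : exp (-1) * (v x)⁻¹ = exp (-1) * v x * ((v x)⁻¹ * (v x)⁻¹) := by
    rw [mul_assoc, mul_inv_cancel_left₀ hvx]
  rw [h1]
  refine mul_le_mul_left (v.map_sub_le ?_ ?_) _
  · rw [Valuation.map_neg, map_mul]
    exact mul_le_of_le_one_of_le (T.map_le_one _) hx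
  · rw [map_mul]
    refine mul_le_mul_left (v.map_sub_le ?_ ?_) _
    · rw [mul_inv_cancel₀ ha]
      exact le_exp_of_le T.map_one_sub (by omega)
    · exact le_exp_of_le (T.map_mul_sub a a⁻¹) (by omega)

include hv in
theorem eigen_zpow {g : D} {x : L} {a : l} (ha : a ≠ 0)
    (hx : v (g • x - T.toFun a * x) ≤ exp (-1) * v x) (m : ℤ) :
    v (g • x ^ m - T.toFun (a ^ m) * x ^ m) ≤ exp (-1) * v (x ^ m) := by
  have hn : ∀ n : ℕ, v (g • x ^ n - T.toFun (a ^ n) * x ^ n) ≤ exp (-1) * v (x ^ n) := fun n => by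
    induction n with
    | zero =>
      simp only [pow_zero, smul_one, mul_one, map_one]
      exact map_sub_comm_le (le_exp_of_le T.map_one_sub (by omega))
    | succ n ih => rw [pow_succ, pow_succ]; exact T.eigen_mul hv ih hx he
  cases m with
  | ofNat n => simpa using hn n
  | negSucc n =>
    rw [zpow_negSucc, zpow_negSucc]
    exact T.eigen_inv he hv (pow_ne_zero _ ha) (hn _)

omit he in
include hπ hv in
/-- Modulo terms of higher order, every element of the group multiplies the uniformizer by a residue
class. -/
theorem exists_eigenvalue (g : D) : ∃ a : l, v (g • π - T.toFun a * π) ≤ exp (-2) := by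
  have hg : v (g • π) ≤ exp (-1) := by rw [hv, hπ]
  simpa using T.exists_sub_mul_zpow_le hπ hg

include hπ in
theorem eigenvalue_unique {x : L} {a b : l} (ha : v (x - T.toFun a * π) ≤ exp (-2))
    (hb : v (x - T.toFun b * π) ≤ exp (-2)) : a = b := by
  have hπ0 : π ≠ 0 := (Valuation.ne_zero_iff v).1 (by rw [hπ]; exact exp_ne_zero)
  have hπi : v π⁻¹ ≤ exp 1 := by
    rw [map_inv₀, hπ, ← exp_neg]
    simp
  refine T.eq_of_map_sub_le he ?_
  have h := map_mul_le_exp (map_sub_le_of_sub_le (map_sub_comm_le ha) hb) hπi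
  rwa [← sub_mul, mul_inv_cancel_right₀ hπ0] at h

/-- The tame character of the inertia group: the action on the cotangent line of the maximal
ideal. -/
def tameCharacter : ramificationGroup hv 0 →* lˣ where
  toFun g := Units.mk0 (T.exists_eigenvalue hv hπ (g : D)).choose fun h0 => by
    have h := (T.exists_eigenvalue hv hπ (g : D)).choose_spec
    rw [h0] at h
    have h1 : v (T.toFun 0 * π) ≤ exp (-2) :=
      (map_mul_le_exp T.map_zero_le hπ.le).trans (exp_le_exp.2 (by omega))
    have h2 := v.map_add_le h h1
    rw [sub_add_cancel, hv, hπ, exp_le_exp] at h2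
    omega
  map_one' := by
    ext
    have h := (T.exists_eigenvalue hv hπ ((1 : ramificationGroup hv 0) : D)).choose_spec
    refine T.eigenvalue_unique he hπ h ?_
    rw [Subgroup.coe_one, one_smul, Units.val_one, ← one_sub_mul]
    exact (map_mul_le_exp (map_sub_comm_le T.map_one_sub) hπ.le).trans (exp_le_exp.2 (by omega))
  map_mul' g h := by
    ext
    have hgh := (T.exists_eigenvalue hv hπ ((g * h : ramificationGroup hv 0) : D)).choose_spec
    have hg := (T.exists_eigenvalue hv hπ (g : D)).choose_spec
    have hh := (T.exists_eigenvalue hv hπ (h : D)).choose_spec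
    refine T.eigenvalue_unique he hπ hgh ?_
    rw [Units.val_mul, Units.val_mk0, Units.val_mk0]
    set a := (T.exists_eigenvalue hv hπ (g : D)).choose
    set b := (T.exists_eigenvalue hv hπ (h : D)).choose
    have : ((g * h : ramificationGroup hv 0) : D) • π - T.toFun (a * b) * π =
        (g : D) • ((h : D) • π - T.toFun b * π) +
          ((g : D) • T.toFun b - T.toFun b) * ((g : D) • π) +
          T.toFun b * ((g : D) • π - T.toFun a * π) -
          (T.toFun (a * b) - T.toFun a * T.toFun b) * π := by
      rw [Subgroup.coe_mul, mul_smul, smul_sub, smul_mul']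
      ring
    rw [this]
    refine v.map_sub_le (v.map_add_le (v.map_add_le ?_ ?_) ?_) ?_
    · rwa [hv]
    · refine (map_mul_le_exp (g.2 _ (T.map_le_one b)) (b := -1) ?_).trans (exp_le_exp.2 ?_)
      · rw [hv, hπ]
      · simp
    · rw [map_mul]
      exact mul_le_of_le_one_of_le (T.map_le_one b) hg
    · exact (map_mul_le_exp (T.map_mul_sub a b) hπ.le).trans (exp_le_exp.2 (by omega))

theorem map_smul_sub_tameCharacter_mul_le (g : ramificationGroup hv 0) :
    v ((g : D) • π - T.toFun (T.tameCharacter he hv hπ g : lˣ) * π) ≤ exp (-2) :=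
  (T.exists_eigenvalue hv hπ (g : D)).choose_spec

theorem map_smul_zpow_sub_le (g : ramificationGroup hv 0) (m : ℤ) :
    v ((g : D) • π ^ m - T.toFun ((T.tameCharacter he hv hπ g : l) ^ m) * π ^ m) ≤
      exp (-(m + 1)) := by
  have h := T.eigen_zpow he hv (Units.ne_zero _) (x := π) (m := m)
    (a := T.tameCharacter he hv hπ g) (g := (g : D)) (by
      rw [hπ, ← exp_add]
      exact T.map_smul_sub_tameCharacter_mul_le he hv hπ g)
  rw [map_zpow₀, hπ, ← exp_zsmul, ← exp_add] at h
  refine h.trans (exp_le_exp.2 ?_)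
  simp only [smul_eq_mul]
  omega

/-- The kernel of the tame character is the wild inertia group. -/
theorem ker_tameCharacter : (T.tameCharacter he hv hπ).ker =
    (ramificationGroup hv 1).subgroupOf (ramificationGroup hv 0) := by
  ext g
  rw [MonoidHom.mem_ker, Subgroup.mem_subgroupOf]
  have h1 : v (T.toFun 1 * π - π) ≤ exp (-2) := by
    rw [← sub_one_mul]
    exact (map_mul_le_exp T.map_one_sub hπ.le).trans (exp_le_exp.2 (by omega))
  have h := T.map_smul_sub_tameCharacter_mul_le he hv hπ g
  constructor
  · intro hg
    rw [hg, Units.val_one] at h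
    exact T.mem_ramificationGroup_of_uniformizer he hv hπ g.2 one_le_two
      (map_sub_le_of_sub_le h h1)
  · intro hg
    have h2 := hg π (by rw [hπ, ← exp_zero, exp_le_exp]; omega)
    ext
    exact T.eigenvalue_unique he hπ h (map_sub_le_of_sub_le h2 (map_sub_comm_le h1))

include hπ in
/-- The wild inertia group is a `p`-group: in residue characteristic `p` no other prime has
positive valuation, see `map_prime_le`. -/
theorem isPGroup_ramificationGroup_one [Finite D] [FaithfulSMul D L] (p : ℕ) [Fact p.Prime]
    [CharP l p] : IsPGroup p (ramificationGroup hv 1) := by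
  have hprime : ∀ {n : ℕ}, n.Prime → n ∣ Nat.card (ramificationGroup hv 1) → n = p := by
    intro n hn hdvd
    have : Fact n.Prime := ⟨hn⟩
    obtain ⟨σ, hσ⟩ := exists_prime_orderOf_dvd_card' n hdvd
    have hσ1 : (σ : D) ≠ 1 := by
      intro h
      rw [orderOf_eq_prime_iff] at hσ
      exact hσ.2 (Subtype.ext h)
    obtain ⟨y, hy⟩ : ∃ y : L, (σ : D) • y ≠ y := by
      by_contra! hall
      exact hσ1 (eq_of_smul_eq_smul fun y : L => by rw [hall, one_smul])
    have hσn : (σ : D) ^ n = 1 := by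
      rw [← Subgroup.coe_pow, ← hσ, pow_orderOf_eq_one, Subgroup.coe_one]
    have h1 := map_prime_le (map_smul_sub_le_of_mem_ramificationGroup hv hπ σ.2) le_rfl hσn hy
    have h2 : v (n : L) ≤ exp (-1) := le_exp_of_le h1 (by have := hn.two_le; omega)
    have h3 : v (p : L) ≤ exp (-1) := le_exp_of_le (T.map_char_le p) (by omega)
    by_contra hne
    have hcop : IsCoprime (n : ℤ) (p : ℤ) :=
      Nat.isCoprime_iff_coprime.2 ((Nat.coprime_primes hn Fact.out).2 hne)
    obtain ⟨a, b, hab⟩ := hcop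
    have hint : ∀ m : ℤ, v (m : L) ≤ 1 := fun m => by
      cases m with
      | ofNat m => simpa using map_natCast_le_one m
      | negSucc m =>
        rw [Int.cast_negSucc, Valuation.map_neg]
        exact map_natCast_le_one _
    have h4 : v (((a * n + b * p : ℤ)) : L) ≤ exp (-1) := by
      push_cast
      refine v.map_add_le ?_ ?_
      · rw [map_mul]; exact mul_le_of_le_one_of_le (hint a) h2
      · rw [map_mul]; exact mul_le_of_le_one_of_le (hint b) h3
    rw [hab, Int.cast_one, v.map_one, ← exp_zero, exp_le_exp] at h4
    omega
  exact IsPGroup.of_card (Nat.eq_prime_pow_of_unique_prime_dvd Nat.card_pos.ne' hprime)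

include hπ in
/-- In the weakly ramified case, a nontrivial wild automorphism moves a uniformizer exactly by a
square. -/
theorem map_smul_sub_uniformizer_eq (hw : ramificationGroup hv 2 = ⊥) {g : D}
    (hg : g ∈ ramificationGroup hv 1) (hg1 : g ≠ 1) : v (g • π - π) = exp (-2) := by
  refine le_antisymm (hg π (by rw [hπ, ← exp_zero, exp_le_exp]; omega)) ?_
  by_contra! hlt
  refine hg1 ?_
  rw [← Subgroup.mem_bot, ← hw]
  refine T.mem_ramificationGroup_of_uniformizer he hv hπ
    (ramificationGroup_antitone hv zero_le_one hg) le_rfl ?_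
  rw [lt_exp_iff_le_exp_sub_one] at hlt
  exact le_exp_of_le hlt (by norm_num)

include hπ in
/-- An inertial automorphism which is not wild moves a uniformizer to one that is incongruent. -/
theorem map_smul_sub_uniformizer_eq_of_notMem {g : D} (hg : g ∈ ramificationGroup hv 0)
    (hg1 : g ∉ ramificationGroup hv 1) : v (g • π - π) = exp (-1) := by
  refine le_antisymm (hg π (by rw [hπ, ← exp_zero, exp_le_exp]; omega)) ?_
  by_contra! hlt
  refine hg1 (T.mem_ramificationGroup_of_uniformizer he hv hπ hg one_le_two ?_)
  rw [lt_exp_iff_le_exp_sub_one] at hlt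
  exact le_exp_of_le hlt (by norm_num)

include hπ in
/-- An element of trace `1` for the wild inertia group, from Euler's formula. -/
theorem exists_sum_smul_eq_one [FaithfulSMul D L] (hw : ramificationGroup hv 2 = ⊥)
    [Fintype (ramificationGroup hv 1)] : ∃ y : L,
      v y = exp ((Fintype.card (ramificationGroup hv 1) : ℤ) - 1) ∧
      ∑ h : ramificationGroup hv 1, h • y = 1 := by
  classical
  have hinj : Function.Injective fun h : ramificationGroup hv 1 => h • π := by
    intro h j hhj
    by_contra hne
    have h1 := T.map_smul_sub_uniformizer_eq he hv hπ hw (h⁻¹ * j).2 (fun h2 => hne (by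
      have : h⁻¹ * j = 1 := Subtype.ext h2
      exact inv_mul_eq_one.1 this))
    have h2 : ((h⁻¹ * j : ramificationGroup hv 1) : D) • π = π := by
      change (h⁻¹ * j) • π = π
      rw [mul_smul, inv_smul_eq_iff]
      exact hhj.symm
    rw [h2, sub_self, map_zero] at h1
    exact exp_ne_zero h1.symm
  refine ⟨_, ?_, sum_smul_pow_div_prod_sub hinj⟩
  have hprod : v (∏ j ∈ Finset.univ.erase (1 : ramificationGroup hv 1), (π - j • π)) =
      exp (-2) ^ (Fintype.card (ramificationGroup hv 1) - 1) := by
    rw [map_prod, Finset.prod_congr rfl fun j hj => ?_, Finset.prod_const,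
      Finset.card_erase_of_mem (Finset.mem_univ _), Finset.card_univ]
    rw [Valuation.map_sub_swap]
    exact T.map_smul_sub_uniformizer_eq he hv hπ hw j.2 fun h =>
      (Finset.mem_erase.1 hj).1 (Subtype.ext h)
  rw [map_div₀, map_pow, hπ, hprod, ← exp_nsmul, ← exp_nsmul, ← exp_sub]
  congr 1
  have : 1 ≤ Fintype.card (ramificationGroup hv 1) := Fintype.card_pos
  push_cast [nsmul_eq_mul, this]
  ring

end Eigen

end ResidueLift

end ResidueLift

/-! ### Quotients of powers of the maximal ideal -/

section Layer

open WithZero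

variable {L : Type*} [Field L] (v : Valuation L (WithZero (Multiplicative ℤ)))

/-- The `n`-th power of the maximal ideal of the valuation ring, as an additive subgroup. -/
def level (n : ℤ) : AddSubgroup L where
  carrier := {x | v x ≤ exp (-n)}
  zero_mem' := by simp
  add_mem' := v.map_add_le
  neg_mem' {x} hx := by
    change v (-x) ≤ _
    rw [Valuation.map_neg]
    exact hx

variable {v}

theorem mem_level {n : ℤ} {x : L} : x ∈ level v n ↔ v x ≤ exp (-n) := Iff.rfl

theorem level_antitone {m n : ℤ} (h : m ≤ n) {x : L} (hx : x ∈ level v n) : x ∈ level v m :=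
  le_exp_of_le hx (by omega)

namespace ResidueLift

variable {D : Type*} [Group D] [MulSemiringAction D L] {l : Type*} [Field l]
  [MulSemiringAction D l] {e n : ℕ} (T : ResidueLift v D l e)

/-- The quotient of the `b`-th power of the maximal ideal by the `(b + n)`-th, as a vector space
over the residue field through `T`. This needs `n ≤ e`, hence the argument. -/
@[nolint unusedArguments]
def Layer (_T : ResidueLift v D l e) (_hn : n ≤ e) (b : ℤ) : Type _ :=
  level v b ⧸ (level v (b + n)).addSubgroupOf (level v b)

namespace Layer

variable {T} {hn : n ≤ e} {b : ℤ}

instance : AddCommGroup (T.Layer hn b) :=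
  inferInstanceAs (AddCommGroup (level v b ⧸ (level v (b + n)).addSubgroupOf (level v b)))

variable (T hn b) in
/-- The class of an element. -/
def mk : level v b →+ T.Layer hn b :=
  QuotientAddGroup.mk' _

theorem mk_surjective : Function.Surjective (mk T hn b) :=
  QuotientAddGroup.mk'_surjective _

theorem mk_eq_zero_iff {x : level v b} : mk T hn b x = 0 ↔ v (x : L) ≤ exp (-(b + n)) := by
  refine (QuotientAddGroup.eq_zero_iff x).trans ?_
  rw [AddSubgroup.mem_addSubgroupOf, mem_level]

theorem mk_eq_mk_iff {x y : level v b} :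
    mk T hn b x = mk T hn b y ↔ v ((x : L) - y) ≤ exp (-(b + n)) := by
  rw [← sub_eq_zero, ← map_sub, mk_eq_zero_iff, AddSubgroup.coe_sub]

/-- Multiplication by an integral element. -/
def mulLevel {b : ℤ} (a : L) (ha : v a ≤ 1) : level v b →+ level v b where
  toFun x := ⟨a * x, by
    rw [mem_level, map_mul]
    exact mul_le_of_le_one_of_le ha x.2⟩
  map_zero' := by simp
  map_add' x y := Subtype.ext (mul_add _ _ _)

instance : SMul l (T.Layer hn b) where
  smul a := QuotientAddGroup.map _ _ (mulLevel (T.toFun a) (T.map_le_one a)) fun x hx => by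
    change v (T.toFun a * x) ≤ _
    rw [map_mul]
    exact mul_le_of_le_one_of_le (T.map_le_one a) hx

theorem smul_mk (a : l) (x : level v b) :
    a • mk T hn b x = mk T hn b (mulLevel (T.toFun a) (T.map_le_one a) x) := rfl

instance : Module l (T.Layer hn b) where
  one_smul X := by
    obtain ⟨x, rfl⟩ := mk_surjective X
    rw [smul_mk, mk_eq_mk_iff]
    change v (T.toFun 1 * x - x) ≤ _
    rw [← sub_one_mul]
    exact (map_mul_le_exp T.map_one_sub x.2).trans (exp_le_exp.2 (by omega))
  mul_smul a c X := by
    obtain ⟨x, rfl⟩ := mk_surjective X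
    rw [smul_mk, smul_mk, smul_mk, mk_eq_mk_iff]
    change v (T.toFun (a * c) * x - T.toFun a * (T.toFun c * x)) ≤ _
    rw [← mul_assoc, ← sub_mul]
    exact (map_mul_le_exp (T.map_mul_sub a c) x.2).trans (exp_le_exp.2 (by omega))
  smul_zero a := by rw [← map_zero (mk T hn b), smul_mk, map_zero]
  smul_add a X Y := by
    obtain ⟨x, rfl⟩ := mk_surjective X
    obtain ⟨y, rfl⟩ := mk_surjective Y
    rw [← map_add, smul_mk, smul_mk, smul_mk, ← map_add, map_add]
  add_smul a c X := by
    obtain ⟨x, rfl⟩ := mk_surjective X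
    rw [smul_mk, smul_mk, smul_mk, ← map_add, mk_eq_mk_iff]
    change v (T.toFun (a + c) * x - (T.toFun a * x + T.toFun c * x)) ≤ _
    rw [← add_mul, ← sub_mul]
    exact (map_mul_le_exp (T.map_add_sub a c) x.2).trans (exp_le_exp.2 (by omega))
  zero_smul X := by
    obtain ⟨x, rfl⟩ := mk_surjective X
    rw [smul_mk, mk_eq_zero_iff]
    exact (map_mul_le_exp T.map_zero_le x.2).trans (exp_le_exp.2 (by omega))

section Action

variable (hv : ∀ (g : D) (x : L), v (g • x) = v x)

/-- The action of a group element on a power of the maximal ideal. -/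
def smulLevel {b : ℤ} (g : D) : level v b →+ level v b where
  toFun x := ⟨g • (x : L), by
    rw [mem_level, hv]
    exact x.2⟩
  map_zero' := by simp
  map_add' x y := Subtype.ext (smul_add _ _ _)

/-- The action of `D` on a layer. It depends on the invariance of the valuation, hence is not an
instance. -/
abbrev distribMulAction : DistribMulAction D (T.Layer hn b) where
  smul g := QuotientAddGroup.map _ _ (smulLevel hv g) fun x hx => by
    change v (g • (x : L)) ≤ _
    rw [hv]
    exact hx
  one_smul X := by
    obtain ⟨x, rfl⟩ := mk_surjective X
    exact congrArg (mk T hn b) (Subtype.ext (one_smul D (x : L)))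
  mul_smul g h X := by
    obtain ⟨x, rfl⟩ := mk_surjective X
    exact congrArg (mk T hn b) (Subtype.ext (mul_smul g h (x : L)))
  smul_zero g := map_zero (QuotientAddGroup.map _ _ _ _)
  smul_add g X Y := map_add (QuotientAddGroup.map _ _ _ _) X Y

theorem smul_smul_eq (g : D) (a : l) (X : T.Layer hn b) :
    let := distribMulAction (T := T) (hn := hn) (b := b) hv
    g • (a • X) = (g • a) • (g • X) := by
  obtain ⟨x, rfl⟩ := mk_surjective X
  refine mk_eq_mk_iff.2 ?_
  change v (g • (T.toFun a * (x : L)) - T.toFun (g • a) * (g • (x : L))) ≤ _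
  rw [smul_mul', ← sub_mul]
  refine (map_mul_le_exp (T.map_smul_sub g a) (b := -b) ?_).trans (exp_le_exp.2 (by omega))
  rw [hv]
  exact x.2

end Action

variable (T hn b) in
/-- The classes of the elements of the `m`-th power of the maximal ideal. -/
def filtration (m : ℤ) : Submodule l (T.Layer hn b) where
  carrier := {X | ∃ x, X = mk T hn b x ∧ v (x : L) ≤ exp (-m)}
  zero_mem' := ⟨0, by simp, by simp⟩
  add_mem' := by
    rintro _ _ ⟨x, rfl, hx⟩ ⟨y, rfl, hy⟩
    exact ⟨x + y, (map_add _ _ _).symm, v.map_add_le hx hy⟩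
  smul_mem' := by
    rintro a _ ⟨x, rfl, hx⟩
    refine ⟨_, smul_mk a x, ?_⟩
    change v (T.toFun a * x) ≤ _
    rw [map_mul]
    exact mul_le_of_le_one_of_le (T.map_le_one a) hx

theorem filtration_eq_top {m : ℤ} (hm : m ≤ b) : filtration T hn b m = ⊤ := by
  refine eq_top_iff.2 fun X _ => ?_
  obtain ⟨x, rfl⟩ := mk_surjective X
  exact ⟨x, rfl, level_antitone hm x.2⟩

theorem filtration_eq_bot {m : ℤ} (hm : b + n ≤ m) : filtration T hn b m = ⊥ := by
  refine eq_bot_iff.2 ?_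
  rintro _ ⟨x, rfl, hx⟩
  exact mk_eq_zero_iff.2 (le_exp_of_le hx (by omega))

theorem zpow_mem_level {π : L} (hπ : v π = exp (-1)) {m : ℤ} (hm : b ≤ m) : π ^ m ∈ level v b := by
  rw [mem_level, map_zpow₀, hπ, ← exp_zsmul, exp_le_exp, smul_eq_mul]
  omega

/-- The steps of the filtration are at most one-dimensional. -/
theorem filtration_eq_span_sup {π : L} (hπ : v π = exp (-1)) {m : ℤ} (hm : b ≤ m) :
    filtration T hn b m =
      Submodule.span l {mk T hn b ⟨π ^ m, zpow_mem_level hπ hm⟩} ⊔ filtration T hn b (m + 1) := by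
  refine le_antisymm ?_ (sup_le ?_ ?_)
  · rintro _ ⟨x, rfl, hx⟩
    obtain ⟨a, ha⟩ := T.exists_sub_mul_zpow_le hπ hx
    rw [← add_sub_cancel (a • mk T hn b ⟨π ^ m, zpow_mem_level hπ hm⟩) (mk T hn b x)]
    refine add_mem (Submodule.mem_sup_left (Submodule.smul_mem _ _
      (Submodule.mem_span_singleton_self _))) (Submodule.mem_sup_right ?_)
    rw [smul_mk, ← map_sub]
    exact ⟨_, rfl, ha⟩
  · rw [Submodule.span_singleton_le_iff_mem]
    exact ⟨_, rfl, zpow_mem_level hπ le_rfl⟩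
  · rintro _ ⟨x, rfl, hx⟩
    exact ⟨x, rfl, level_antitone (by omega) hx⟩

/-- The layer is spanned by the classes of `n` consecutive powers of a uniformizer. -/
theorem exists_span_range_eq_top {π : L} (hπ : v π = exp (-1)) :
    ∃ f : Fin n → T.Layer hn b, Submodule.span l (Set.range f) = ⊤ := by
  refine ⟨fun i => mk T hn b ⟨π ^ (b + (i : ℤ)), zpow_mem_level hπ (by omega)⟩, ?_⟩
  set S := Submodule.span l (Set.range fun i : Fin n =>
    mk T hn b ⟨π ^ (b + (i : ℤ)), zpow_mem_level hπ (by omega)⟩) with hS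
  have key : ∀ j ≤ n, filtration T hn b b ≤ S ⊔ filtration T hn b (b + j) := by
    intro j hj
    induction j with
    | zero => rw [Nat.cast_zero, add_zero]; exact le_sup_right
    | succ j ih =>
      refine (ih (by omega)).trans (sup_le le_sup_left ?_)
      rw [filtration_eq_span_sup hπ (by omega)]
      refine sup_le (le_sup_of_le_left ?_) (le_sup_of_le_right ?_)
      · rw [Submodule.span_singleton_le_iff_mem]
        exact Submodule.subset_span ⟨⟨j, by omega⟩, rfl⟩
      · rw [Nat.cast_succ, add_assoc]
  have := key n le_rfl
  rwa [filtration_eq_top le_rfl, filtration_eq_bot le_rfl, sup_bot_eq, top_le_iff] at this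

end Layer

end ResidueLift

end Layer

/-! ### Weakly ramified actions -/

section Weak

open WithZero

variable {L : Type*} [Field L] {v : Valuation L (WithZero (Multiplicative ℤ))}
  {D : Type*} [Group D] [MulSemiringAction D L] [FaithfulSMul D L] {l : Type*} [Field l]
  [MulSemiringAction D l] {e : ℕ}

namespace ResidueLift

variable (T : ResidueLift v D l e) (he : 1 ≤ e) (hv : ∀ (g : D) (x : L), v (g • x) = v x)
  (hw : ramificationGroup hv 2 = ⊥) {π : L} (hπ : v π = exp (-1))

include T he hw hπ

/-- In the weakly ramified case, the augmentation ideal of the wild inertia group `G₁`, of order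
`q`, carries the `b`-th power of the maximal ideal onto the `(b + 1)`-st modulo the `(b + q)`-th
when `b ≡ 1` modulo `q`: a suitable element of exact level `b` has a trace of exact level
`b + q - 1`, so its conjugates are a basis of the quotient. -/
theorem exists_sub_sum_smul_sub_le [Finite l] (p : ℕ) [Fact p.Prime] [CharP l p] [Finite D]
    [Fintype (ramificationGroup hv 1)] {q : ℕ} (hq : Fintype.card (ramificationGroup hv 1) = q)
    (hqe : q ≤ e) (c : ℤ) {x : L} (hx : v x ≤ exp (-(1 + q * c + 1))) :
    ∃ u : ramificationGroup hv 1 → L, (∀ h, v (u h) ≤ exp (-(1 + q * c))) ∧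
      v (x - ∑ h : ramificationGroup hv 1, (h • u h - u h)) ≤ exp (-(1 + q * c + q)) := by
  obtain ⟨y, hy, hysum⟩ := T.exists_sum_smul_eq_one he hv hπ hw
  rw [hq] at hy
  -- A power of the norm `z` of `π`, which is invariant, shifts the element `y` of trace `1` to
  -- level `b`. The class of `y'` then has nonzero trace in the quotient of dimension `q`.
  set z : L := ∏ h : ramificationGroup hv 1, h • π with hz
  have hvz : v z = exp (-(q : ℤ)) := by
    rw [hz, map_prod, Finset.prod_congr rfl (g := fun _ => exp (-1)) fun h _ => by
      rw [← hπ]; exact hv h π, Finset.prod_const, Finset.card_univ, hq, ← exp_nsmul]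
    simp
  have hz0 : z ≠ 0 := (Valuation.ne_zero_iff v).1 (by rw [hvz]; exact exp_ne_zero)
  have hgz : ∀ h : ramificationGroup hv 1, h • z = z := fun h => by
    rw [hz, Finset.smul_prod']
    exact Fintype.prod_equiv (Equiv.mulLeft h) _ _ fun j => by
      rw [Equiv.coe_mulLeft, mul_smul]
  set b : ℤ := 1 + q * c with hb
  set y' := y * z ^ (c + 1) with hy'
  have hvzc : v (z ^ (c + 1)) = exp (-(b + q - 1)) := by
    rw [map_zpow₀, hvz, ← exp_zsmul, smul_eq_mul, hb]
    congr 1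
    ring
  have hvy' : v y' = exp (-b) := by
    rw [hy', map_mul, hy, hvzc, ← exp_add]
    congr 1
    ring
  have hgzc : ∀ h : ramificationGroup hv 1, h • z ^ (c + 1) = z ^ (c + 1) := fun h => by
    rw [smul_zpow₀', hgz]
  have hsum : ∑ h : ramificationGroup hv 1, h • y' = z ^ (c + 1) := by
    simp_rw [hy', smul_mul', hgzc]
    rw [← Finset.sum_mul, hysum, one_mul]
  let := Layer.distribMulAction (T := T) (hn := hqe) (b := b) hv
  have hH0 : ∀ (h : ramificationGroup hv 1) (a : l), (h : D) • a = a := fun h =>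
    (T.mem_ramificationGroup_zero_iff he hv).1 (ramificationGroup_antitone hv zero_le_one h.2)
  have : SMulCommClass (ramificationGroup hv 1) l (T.Layer hqe b) := ⟨fun h a X => by
    have := Layer.smul_smul_eq hv (h : D) a X
    rw [hH0] at this
    exact this⟩
  have hy'mem : y' ∈ level v b := hvy'.le
  set Y : T.Layer hqe b := Layer.mk T hqe b ⟨y', hy'mem⟩ with hY
  have hsumY : ∑ h : ramificationGroup hv 1, h • Y ≠ 0 := by
    have h1 : ∑ h : ramificationGroup hv 1, h • Y =
        Layer.mk T hqe b
          (∑ h : ramificationGroup hv 1, Layer.smulLevel hv (h : D) ⟨y', hy'mem⟩) := by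
      rw [map_sum]
      rfl
    rw [h1, Ne, Layer.mk_eq_zero_iff, AddSubgroup.val_finsetSum]
    change ¬ v (∑ h : ramificationGroup hv 1, h • y') ≤ _
    rw [hsum, hvzc, exp_le_exp]
    omega
  have hli := linearIndependent_orbit_of_isPGroup (l := l)
    (T.isPGroup_ramificationGroup_one he hv hπ p) Y hsumY
  obtain ⟨f, hf⟩ := Layer.exists_span_range_eq_top (T := T) (hn := hqe) (b := b) hπ
  have : Module.Finite l (T.Layer hqe b) := ⟨hf ▸ Submodule.fg_span (Set.finite_range f)⟩
  have hfin : Fintype.card (ramificationGroup hv 1) = Module.finrank l (T.Layer hqe b) := by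
    refine le_antisymm hli.fintype_card_le_finrank ?_
    rw [hq]
    have := finrank_range_le_card (R := l) f
    rwa [Set.finrank, hf, finrank_top, Fintype.card_fin] at this
  have hspan := hli.span_eq_top_of_card_eq_finrank' hfin
  have hxb : x ∈ level v b := level_antitone (by omega) hx
  obtain ⟨a, ha⟩ := (Submodule.mem_span_range_iff_exists_fun l).1
    (hspan ▸ Submodule.mem_top (x := Layer.mk T hqe b ⟨x, hxb⟩))
  have hq1 : 1 ≤ q := hq ▸ Fintype.card_pos
  -- The coefficients sum to zero, because `x` and all `h • y' - y'` have level `b + 1`.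
  have ha0 : ∑ h, a h = 0 := by
    have h1 : (∑ h, a h) • Y ∈ Layer.filtration T hqe b (b + 1) := by
      have h2 : (∑ h, a h) • Y =
          Layer.mk T hqe b ⟨x, hxb⟩ - ∑ h, a h • (h • Y - Y) := by
        simp_rw [← ha, smul_sub, Finset.sum_sub_distrib, sub_sub_cancel, Finset.sum_smul]
      rw [h2]
      refine sub_mem ⟨_, rfl, hx⟩ (sum_mem fun h _ => Submodule.smul_mem _ _ ?_)
      refine ⟨Layer.smulLevel hv (h : D) ⟨y', hy'mem⟩ - ⟨y', hy'mem⟩,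
        (map_sub (Layer.mk T hqe b) _ _).symm, ?_⟩
      change v ((h : D) • y' - y') ≤ _
      refine (map_smul_sub_le_of_mem_ramificationGroup hv hπ h.2 y').trans ?_
      rw [hvy', ← exp_add, exp_le_exp]
      push_cast
      omega
    obtain ⟨x', hx', hvx'⟩ := h1
    rw [hY, Layer.smul_mk, Layer.mk_eq_mk_iff] at hx'
    change v (T.toFun (∑ h, a h) * y' - x') ≤ _ at hx'
    have h3 := v.map_add_le (le_exp_of_le hx' (b := -(b + 1)) (by omega)) hvx'
    rw [sub_add_cancel, map_mul, hvy'] at h3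
    by_contra hne
    rw [T.map_eq_one he hne, one_mul, exp_le_exp] at h3
    omega
  refine ⟨fun h => T.toFun (a h) * y', fun h => ?_, ?_⟩
  · rw [map_mul]
    exact mul_le_of_le_one_of_le (T.map_le_one _) hvy'.le
  let U : ramificationGroup hv 1 → level v b := fun h =>
    Layer.mulLevel (T.toFun (a h)) (T.map_le_one _) ⟨y', hy'mem⟩
  have hU : Layer.mk T hqe b ⟨x, hxb⟩ =
      Layer.mk T hqe b
        (∑ h : ramificationGroup hv 1, (Layer.smulLevel hv (h : D) (U h) - U h)) := by
    have h1 : ∀ h : ramificationGroup hv 1,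
        Layer.mk T hqe b (Layer.smulLevel hv (h : D) (U h) - U h) = a h • h • Y - a h • Y := by
      intro h
      rw [map_sub, ← smul_comm h (a h) Y]
      rfl
    rw [map_sum, Finset.sum_congr rfl fun h _ => h1 h, Finset.sum_sub_distrib, ha,
      ← Finset.sum_smul, ha0, zero_smul, sub_zero]
  rw [Layer.mk_eq_mk_iff, AddSubgroup.val_finsetSum] at hU
  exact hU

variable [Finite l] (p : ℕ) [Fact p.Prime] [CharP l p]
  (hcard : Nat.card (ramificationGroup hv 0) = e)

include p hcard in
/-- The trace of the elements of valuation at least `-(e + q - 2)`, in the weakly ramified case.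
Modulo elements of valuation at least `-e + 1`, they lie in the image of the augmentation ideal of
the wild inertia group by `exists_sub_sum_smul_sub_le`, and the trace vanishes on that image. -/
theorem map_sum_smul_le [Fintype D] {x : L}
    (hx : v x ≤ exp (e + (Nat.card (ramificationGroup hv 1) : ℤ) - 2)) :
    v (∑ g : D, g • x) ≤ exp ((e : ℤ) - 1) := by
  classical
  have hle : Nat.card (ramificationGroup hv 1) ∣ e :=
    hcard ▸ Subgroup.card_dvd_of_le (ramificationGroup_antitone hv zero_le_one)
  obtain ⟨t, ht⟩ := hle
  have ht0 : 1 ≤ t := by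
    rcases Nat.eq_zero_or_pos t with rfl | h
    · simp at ht; omega
    · exact h
  have hqe : Nat.card (ramificationGroup hv 1) ≤ e :=
    Nat.le_of_dvd (by omega) ⟨t, ht⟩
  set q := Nat.card (ramificationGroup hv 1) with hq
  have het : (e : ℤ) = q * t := by exact_mod_cast ht
  obtain ⟨u, -, hu⟩ := T.exists_sub_sum_smul_sub_le he hv hw hπ p (q := q)
    (Nat.card_eq_fintype_card.symm) hqe (-1 - t) (x := x)
    (le_exp_of_le hx (by rw [het]; linarith))
  have hkill : ∀ (h : D) (y : L), ∑ g : D, g • (h • y - y) = 0 := fun h y => by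
    simp_rw [smul_sub, Finset.sum_sub_distrib, smul_smul, sub_eq_zero]
    exact Fintype.sum_equiv (Equiv.mulRight h) _ _ fun g => rfl
  set r := x - ∑ h : ramificationGroup hv 1, (h • u h - u h) with hr
  have hx' : ∑ g : D, g • x = ∑ g : D, g • r := by
    have h0 : ∑ g : D, g • (∑ h : ramificationGroup hv 1, (h • u h - u h)) = 0 := by
      simp_rw [Finset.smul_sum]
      rw [Finset.sum_comm]
      exact Finset.sum_eq_zero fun h _ => hkill (h : D) (u h)
    rw [hr, Finset.sum_congr rfl fun g _ => smul_sub g x _, Finset.sum_sub_distrib, h0, sub_zero]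
  rw [hx']
  refine v.map_sum_le fun g _ => ?_
  rw [hv]
  exact le_exp_of_le hu (by rw [het]; linarith)

omit [FaithfulSMul D L] in
include hcard in
/-- The different exponent in the weakly ramified case, computed from an element congruent to
`π + T(λ)`, where `λ` generates the multiplicative group of the residue field. The automorphism `g`
moves it by valuation `0`, `1` or `2`, according to the last ramification group that contains `g`,
so the sum over `g ≠ 1` is `(e - q) + 2 (q - 1)`. -/
theorem exists_prod_map_smul_sub_eq [Fintype D] [DecidableEq D] : ∃ α₀ : L, v α₀ = 1 ∧
    ∀ α : L, v (α - α₀) ≤ exp (-3) → ∏ g ∈ Finset.univ.erase (1 : D), v (g • α - α) =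
      exp (-(e + (Nat.card (ramificationGroup hv 1) : ℤ) - 2)) := by
  classical
  obtain ⟨lam, hlam⟩ := IsCyclic.exists_generator (α := lˣ)
  have hlam1 : v (T.toFun lam) = 1 := T.map_eq_one he lam.ne_zero
  refine ⟨π + T.toFun lam, ?_, fun α hα => ?_⟩
  · rw [v.map_add_eq_of_lt_right, hlam1]
    rw [hlam1, hπ, ← exp_zero, exp_lt_exp]
    omega
  have hsub : ∀ g : D, v ((g • α - α) - (g • (π + T.toFun lam) - (π + T.toFun lam))) ≤ exp (-3) :=
    fun g => by
      rw [sub_sub_sub_comm, ← smul_sub]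
      refine v.map_sub_le ?_ hα
      rwa [hv]
  have hT : ∀ g : D, v (g • (π + T.toFun lam) - (π + T.toFun lam) -
      ((g • π - π) + (T.toFun (g • (lam : l)) - T.toFun lam))) ≤ exp (-3) := fun g => by
    refine le_of_eq_of_le (congrArg v ?_) (T.map_smul_sub_three g (lam : l))
    rw [smul_add]
    ring
  have hα' : ∀ g : D, v ((g • α - α) -
      ((g • π - π) + (T.toFun (g • (lam : l)) - T.toFun lam))) ≤ exp (-3) := fun g =>
    map_sub_le_of_sub_le (hsub g) (hT g)
  -- Outside of the inertia group, `g` moves `λ` in the residue field, as `λ` generates it.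
  have hmove : ∀ g : D, g ∉ ramificationGroup hv 0 → v (g • α - α) = 1 := by
    intro g hg
    have hne : g • (lam : l) ≠ lam := by
      intro h
      refine hg ((T.mem_ramificationGroup_zero_iff he hv).2 fun a => ?_)
      rcases eq_or_ne a 0 with rfl | ha
      · exact smul_zero g
      obtain ⟨m, hm⟩ := hlam (Units.mk0 a ha)
      have hm' : (lam : l) ^ m = a := by
        have := congrArg Units.val hm
        simpa using this
      rw [← hm', smul_zpow₀', h]
    have h1 : exp (-1) < v (T.toFun (g • (lam : l)) - T.toFun lam) := by
      by_contra! h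
      exact hne (T.eq_of_map_sub_le he h)
    have h2 : v (T.toFun (g • (lam : l)) - T.toFun lam) = 1 := by
      refine le_antisymm (v.map_sub_le (T.map_le_one _) (T.map_le_one _)) ?_
      by_contra! h
      rw [← exp_zero, lt_exp_iff_le_exp_sub_one] at h
      exact absurd h1 (not_lt.2 h)
    rw [← h2]
    refine map_eq_of_sub_lt (lt_of_le_of_lt ?_ h1)
    have h3 : v (g • π - π) ≤ exp (-1) := v.map_sub_le (by rw [hv, hπ]) hπ.le
    have := v.map_add_le (le_exp_of_le (hα' g) (b := -1) (by omega)) h3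
    refine le_of_eq_of_le (congrArg v ?_) this
    ring
  -- The inertia group fixes `λ`, so that it moves `α` as it moves `π`.
  have hin : ∀ g ∈ ramificationGroup hv 0, v ((g • α - α) - (g • π - π)) ≤ exp (-3) := by
    intro g hg
    have := hα' g
    rwa [(T.mem_ramificationGroup_zero_iff he hv).1 hg, sub_self, add_zero] at this
  have htame : ∀ g ∈ ramificationGroup hv 0, g ∉ ramificationGroup hv 1 →
      v (g • α - α) = exp (-1) := by
    intro g hg hg1
    rw [← T.map_smul_sub_uniformizer_eq_of_notMem he hv hπ hg hg1]
    refine map_eq_of_sub_lt ((hin g hg).trans_lt ?_)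
    rw [T.map_smul_sub_uniformizer_eq_of_notMem he hv hπ hg hg1, exp_lt_exp]
    omega
  have hwild : ∀ g ∈ ramificationGroup hv 1, g ≠ 1 → v (g • α - α) = exp (-2) := by
    intro g hg hg1
    rw [← T.map_smul_sub_uniformizer_eq he hv hπ hw hg hg1]
    refine map_eq_of_sub_lt ((hin g (ramificationGroup_antitone hv zero_le_one hg)).trans_lt ?_)
    rw [T.map_smul_sub_uniformizer_eq he hv hπ hw hg hg1, exp_lt_exp]
    omega
  set q := Nat.card (ramificationGroup hv 1) with hq
  have hval : ∀ g ∈ Finset.univ.erase (1 : D), v (g • α - α) =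
      (if g ∈ ramificationGroup hv 0 then exp (-1) else 1) *
        (if g ∈ ramificationGroup hv 1 then exp (-1) else 1) := by
    intro g hg
    by_cases h0 : g ∈ ramificationGroup hv 0
    · by_cases h1 : g ∈ ramificationGroup hv 1
      · rw [if_pos h0, if_pos h1, hwild g h1 (Finset.mem_erase.1 hg).1, ← exp_add]
        norm_num
      · rw [if_pos h0, if_neg h1, htame g h0 h1, mul_one]
    · have h1 : g ∉ ramificationGroup hv 1 := fun h =>
        h0 (ramificationGroup_antitone hv zero_le_one h)
      rw [if_neg h0, if_neg h1, hmove g h0, mul_one]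
  have hcount : ∀ H : Subgroup D, ∏ g ∈ Finset.univ.erase (1 : D),
      (if g ∈ H then exp (-1 : ℤ) else 1) = exp (-1 : ℤ) ^ (Nat.card H - 1) := by
    intro H
    rw [Finset.prod_ite, Finset.prod_const, Finset.prod_const_one, mul_one]
    congr 1
    rw [Finset.filter_erase, Finset.card_erase_of_mem (by simp [H.one_mem]),
      Nat.card_eq_fintype_card, Fintype.card_subtype]
  have hq1 : 1 ≤ q := Nat.card_pos
  rw [Finset.prod_congr rfl hval, Finset.prod_mul_distrib, hcount, hcount, hcard, ← exp_nsmul,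
    ← exp_nsmul, ← exp_add, ← hq]
  congr 1
  push_cast [nsmul_eq_mul, hq1, he]
  ring

omit hw [FaithfulSMul D L] in
include hcard in
/-- The image of the tame character is cyclic, as a finite subgroup of the units of a field, and its
order is the index of the wild inertia group in the inertia group. -/
theorem exists_orderOf_tameCharacter_eq [Finite D] {t : ℕ}
    (ht : e = Nat.card (ramificationGroup hv 1) * t) :
    ∃ c : ramificationGroup hv 0, orderOf (T.tameCharacter he hv hπ c) = t := by
  set χ := T.tameCharacter he hv hπ with hχ
  set q := Nat.card (ramificationGroup hv 1) with hq
  have hq0 : q ≠ 0 := Nat.card_pos.ne'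
  obtain ⟨⟨_, c, rfl⟩, hc⟩ := IsCyclic.exists_generator (α := χ.range)
  refine ⟨c, ?_⟩
  have h1 : Nat.card χ.range = orderOf (χ c) := by
    rw [← orderOf_eq_card_of_forall_mem_zpowers hc]
    exact (Subgroup.orderOf_coe (⟨χ c, c, rfl⟩ : χ.range)).symm
  have h2 : Nat.card χ.ker = q := by
    rw [T.ker_tameCharacter he hv hπ]
    exact Nat.card_congr (Subgroup.subgroupOfEquivOfLe
      (ramificationGroup_antitone hv zero_le_one)).toEquiv
  have h3 := Subgroup.card_mul_index χ.ker
  rw [Subgroup.index_ker, h1, h2, hcard, ht] at h3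
  exact Nat.eq_of_mul_eq_mul_left (Nat.pos_of_ne_zero hq0) h3

omit hw in
include he hπ p hcard T in
/-- The tame ramification index is prime to the order of the wild inertia group: it is the order of
an element of the multiplicative group of the residue field. -/
theorem coprime_card_ramificationGroup_one [Finite D] {t : ℕ}
    (ht : e = Nat.card (ramificationGroup hv 1) * t) :
    t.Coprime (Nat.card (ramificationGroup hv 1)) := by
  obtain ⟨c, hc⟩ := T.exists_orderOf_tameCharacter_eq he hv hπ hcard ht
  set χ := T.tameCharacter he hv hπ with hχ
  obtain ⟨m, hm⟩ := IsPGroup.iff_card.1 (T.isPGroup_ramificationGroup_one he hv hπ p)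
  rw [hm, ← hc]
  refine Nat.Coprime.pow_right _ ?_
  classical
  have : Fintype l := Fintype.ofFinite l
  obtain ⟨n, -, hn⟩ := FiniteField.card l p
  have h1 : orderOf (χ c) ∣ p ^ (n : ℕ) - 1 := by
    rw [← hn, ← Fintype.card_units]
    exact orderOf_dvd_card
  refine Nat.Coprime.coprime_dvd_left h1 ?_
  have h2 : (p ^ (n : ℕ) - 1).Coprime (p ^ (n : ℕ)) := by
    have h3 := Nat.coprime_self_sub_left (Nat.one_le_pow n p (Nat.Prime.pos Fact.out))
    rw [h3]
    exact Nat.coprime_one_left _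
  exact Nat.Coprime.coprime_dvd_right (dvd_pow_self p n.ne_zero) h2

omit hw in
include p hcard in
/-- A generator of the image of the tame character separates the characters `χ ^ (b + q j)`,
`j < t`, for `q` the order of the wild inertia group and `t` its index in the inertia group. -/
theorem exists_tameCharacter_pow_injective [Finite D] (b : ℤ) {t : ℕ}
    (ht : e = Nat.card (ramificationGroup hv 1) * t) :
    ∃ c : ramificationGroup hv 0, ∀ i < t, ∀ j < t,
      (T.tameCharacter he hv hπ c : l) ^ (b + Nat.card (ramificationGroup hv 1) * (i : ℤ)) =
        (T.tameCharacter he hv hπ c : l) ^ (b + Nat.card (ramificationGroup hv 1) * (j : ℤ)) →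
      i = j := by
  obtain ⟨c, hord⟩ := T.exists_orderOf_tameCharacter_eq he hv hπ hcard ht
  have hcop := T.coprime_card_ramificationGroup_one he hv hπ p hcard ht
  rw [← hord] at hcop
  set χ := T.tameCharacter he hv hπ with hχ
  set q := Nat.card (ramificationGroup hv 1) with hq
  refine ⟨c, ?_⟩
  have key : ∀ i < t, ∀ j < t, i ≤ j →
      (χ c : l) ^ (b + q * (i : ℤ)) = (χ c : l) ^ (b + q * (j : ℤ)) → i = j := by
    intro i hi j hj hij h
    rw [← Units.val_zpow_eq_zpow_val, ← Units.val_zpow_eq_zpow_val, Units.val_inj] at h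
    have h1 : χ c ^ (q * (j - i)) = 1 := by
      rw [← zpow_natCast, Nat.cast_mul, Nat.cast_sub hij,
        show (q : ℤ) * (j - i : ℤ) = (b + q * j) - (b + q * i) by ring, zpow_sub, h, mul_inv_cancel]
    have h2 := hcop.dvd_of_dvd_mul_left (orderOf_dvd_of_pow_eq_one h1)
    rw [hord] at h2
    have h3 := Nat.eq_zero_of_dvd_of_lt h2 (by omega)
    omega
  intro i hi j hj h
  rcases le_total i j with hij | hij
  · exact key i hi j hj hij h
  · exact (key j hj i hi hij h.symm).symm

variable {k : Type*} [Field k] [Algebra k l]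

include p hcard in
/-- In the weakly ramified case, the `b`-th power of the maximal ideal has a normal basis generator
modulo the `(b + e)`-th power when `b ≡ 1` modulo the order of the wild inertia group. -/
theorem exists_generator_mod [Fintype D]
    (hcomm : ∀ (g : D) (a : k), g • algebraMap k l a = algebraMap k l a)
    (haut : ∀ τ : l ≃ₐ[k] l, ∃ g : D, ∀ x, τ x = g • x) {b c : ℤ}
    (hb : b = 1 + Nat.card (ramificationGroup hv 1) * c) :
    ∃ z : L, v z ≤ exp (-b) ∧ ∀ x, v x ≤ exp (-b) → ∃ a : D → k,
      v (x - ∑ g, T.toFun (algebraMap k l (a g)) * g • z) ≤ exp (-(b + e)) := by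
  classical
  have : CharP k p := (algebraMap k l).charP (algebraMap k l).injective p
  obtain ⟨t, ht⟩ : Nat.card (ramificationGroup hv 1) ∣ e :=
    hcard ▸ Subgroup.card_dvd_of_le (ramificationGroup_antitone hv zero_le_one)
  have hqe : Nat.card (ramificationGroup hv 1) ≤ e := Nat.le_of_dvd (by omega) ⟨t, ht⟩
  obtain ⟨s, hs⟩ := T.exists_tameCharacter_pow_injective he hv hπ p hcard b ht
  set χ := T.tameCharacter he hv hπ with hχ
  set q := Nat.card (ramificationGroup hv 1) with hq
  have het : (e : ℤ) = q * t := by exact_mod_cast ht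
  let := Layer.distribMulAction (T := T) (hn := le_refl e) (b := b) hv
  obtain ⟨φ, hφ⟩ := Layer.exists_span_range_eq_top (T := T) (hn := le_refl e) (b := b) hπ
  have : Module.Finite l (T.Layer le_rfl b) := ⟨hφ ▸ Submodule.fg_span (Set.finite_range φ)⟩
  have : Finite (T.Layer le_rfl b) := Module.finite_of_finite l
  have hG₀ : ∀ g ∈ ramificationGroup hv 0, ∀ a : l, g • a = a := fun g hg =>
    (T.mem_ramificationGroup_zero_iff he hv).1 hg
  have hlin : ∀ g ∈ ramificationGroup hv 0, ∀ (a : l) (X : T.Layer le_rfl b),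
      g • (a • X) = a • (g • X) := fun g hg a X => by
    have := Layer.smul_smul_eq hv g a X
    rwa [hG₀ g hg] at this
  let f : T.Layer le_rfl b →ₗ[l] T.Layer le_rfl b :=
    { toFun X := (s : D) • X
      map_add' := smul_add _
      map_smul' a X := hlin _ s.2 a X }
  -- Modulo the span `W` of the image of the augmentation ideal of `G₁`, the levels between
  -- `b + q j + 1` and `b + q (j + 1)` collapse, which leaves a flag with one step for each `j < t`.
  let W : Submodule l (T.Layer le_rfl b) :=
    Submodule.span l {x | ∃ h ∈ ramificationGroup hv 1, ∃ u : T.Layer le_rfl b, x = h • u - u}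
  let F : ℕ → Submodule l (T.Layer le_rfl b) := fun j =>
    W ⊔ Layer.filtration T le_rfl b (b + q * j)
  have hlev : ∀ j : ℕ, b ≤ b + q * j := fun j => by
    have : (0 : ℤ) ≤ q * j := by positivity
    omega
  let x : ℕ → T.Layer le_rfl b := fun j =>
    Layer.mk T le_rfl b ⟨π ^ (b + q * (j : ℤ)), Layer.zpow_mem_level hπ (hlev j)⟩
  have hstep : ∀ j : ℕ, Layer.filtration T le_rfl b (b + q * j + 1) ≤ F (j + 1) := by
    rintro j _ ⟨z, rfl, hz⟩
    obtain ⟨u, hu, hzu⟩ := T.exists_sub_sum_smul_sub_le he hv hw hπ p (q := q)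
      (Nat.card_eq_fintype_card.symm) hqe (c + j) (x := z)
      (le_exp_of_le hz (by rw [hb]; linarith))
    have huL : ∀ h, u h ∈ level v b := fun h =>
      level_antitone (hlev j) (le_exp_of_le (hu h) (by rw [hb]; linarith))
    have hrL : ((z : L) - ∑ h : ramificationGroup hv 1, (h • u h - u h)) ∈ level v b :=
      level_antitone (hlev (j + 1)) (le_exp_of_le hzu (by rw [hb]; push_cast; linarith))
    have hzeq : z = (∑ h : ramificationGroup hv 1,
        (Layer.smulLevel hv (h : D) ⟨u h, huL h⟩ - ⟨u h, huL h⟩)) + ⟨_, hrL⟩ := by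
      refine Subtype.ext ?_
      rw [AddSubgroup.coe_add, AddSubgroup.val_finsetSum]
      exact (add_sub_cancel _ _).symm
    rw [hzeq, map_add, map_sum]
    refine add_mem (Submodule.mem_sup_left (sum_mem fun h _ => Submodule.subset_span
      ⟨h, h.2, Layer.mk T le_rfl b ⟨u h, huL h⟩, map_sub (Layer.mk T le_rfl b) _ _⟩))
      (Submodule.mem_sup_right ⟨_, rfl, le_exp_of_le hzu (by rw [hb]; push_cast; linarith)⟩)
  have hanti : ∀ m m' : ℤ, m ≤ m' →
      Layer.filtration T le_rfl b m' ≤ Layer.filtration T (le_refl e) b m := by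
    rintro m m' hm _ ⟨z, rfl, hz⟩
    exact ⟨z, rfl, level_antitone hm hz⟩
  have hF : ∀ j < t, F j = Submodule.span l {x j} ⊔ F (j + 1) := by
    intro j _
    change W ⊔ _ = _ ⊔ F (j + 1)
    rw [Layer.filtration_eq_span_sup hπ (hlev j)]
    refine le_antisymm (sup_le (le_sup_of_le_right le_sup_left) (sup_le le_sup_left
      (le_sup_of_le_right (hstep j)))) (sup_le (le_sup_of_le_right le_sup_left) (sup_le le_sup_left
      (le_sup_of_le_right (le_sup_of_le_right (hanti _ _ ?_)))))
    have : 1 ≤ q := Nat.card_pos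
    push_cast
    linarith [(by exact_mod_cast this : (1 : ℤ) ≤ q)]
  have hfF : ∀ j ≤ t, ∀ X ∈ F j, f X ∈ F j := by
    intro j _ X hX
    obtain ⟨A, hA, B, hB, rfl⟩ := Submodule.mem_sup.1 hX
    rw [map_add]
    refine add_mem (Submodule.mem_sup_left ?_) (Submodule.mem_sup_right ?_)
    · have : W ≤ W.comap f := by
        refine Submodule.span_le.2 ?_
        rintro _ ⟨h, hh, u, rfl⟩
        refine Submodule.subset_span ⟨(s : D) * h * (s : D)⁻¹,
          (ramificationGroup_normal hv 1).conj_mem h hh s, (s : D) • u, ?_⟩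
        change (s : D) • (h • u - u) = _
        rw [smul_sub, smul_smul, smul_smul, inv_mul_cancel_right]
      exact this hA
    · obtain ⟨z, rfl, hz⟩ := hB
      refine ⟨Layer.smulLevel hv (s : D) z, rfl, ?_⟩
      change v ((s : D) • (z : L)) ≤ _
      rwa [hv]
  -- On the `j`-th step, the generator `s` of tame inertia acts through `χ s ^ (b + q j)`.
  have hx : ∀ j < t, f (x j) - (χ s : l) ^ (b + q * (j : ℤ)) • x j ∈ F (j + 1) := by
    intro j _
    refine hstep j ⟨Layer.smulLevel hv (s : D) ⟨π ^ (b + q * (j : ℤ)), _⟩ -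
      Layer.mulLevel (T.toFun ((χ s : l) ^ (b + q * (j : ℤ)))) (T.map_le_one _) ⟨_, _⟩,
      (map_sub (Layer.mk T le_rfl b) _ _).symm, ?_⟩
    exact T.map_smul_zpow_sub_le he hv hπ s _
  obtain ⟨y, -, hy⟩ := exists_cyclic_vector_of_flag f F x _ t hF hfF hx hs
  obtain ⟨z, hz⟩ := exists_generator_of_semilinear (k := k) hcomm haut
    (Layer.smul_smul_eq hv) (ramificationGroup hv 1)
    (T.isPGroup_ramificationGroup_one he hv hπ p) (ramificationGroup hv 0 : Set D)
    (fun h hh => ramificationGroup_antitone hv zero_le_one hh) hG₀ y (by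
      rw [Submodule.span_union]
      refine eq_top_iff.2 ?_
      have h0 : F 0 = ⊤ := by
        refine eq_top_iff.2 (le_sup_of_le_right ?_)
        rw [Layer.filtration_eq_top (by simp)]
      have hFt : F t = W := by
        change W ⊔ Layer.filtration T le_rfl b (b + q * t) = W
        rw [Layer.filtration_eq_bot (by rw [het]), sup_bot_eq]
      rw [h0, hFt] at hy
      refine hy.trans (sup_le_sup_right (Submodule.span_mono ?_) _)
      rintro _ ⟨i, rfl⟩
      refine ⟨(s : D) ^ i, pow_mem s.2 i, ?_⟩
      induction i with
      | zero => simp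
      | succ i ih =>
        rw [pow_succ', pow_succ', Module.End.mul_apply, ih, mul_smul]
        rfl)
  obtain ⟨z, rfl⟩ := Layer.mk_surjective z
  refine ⟨z, z.2, fun x hx => ?_⟩
  obtain ⟨a, ha⟩ := hz (Layer.mk T le_rfl b ⟨x, hx⟩)
  refine ⟨a, ?_⟩
  have h1 : Layer.mk T le_rfl b ⟨x, hx⟩ = Layer.mk T le_rfl b (∑ g : D,
      Layer.mulLevel (T.toFun (algebraMap k l (a g))) (T.map_le_one _)
        (Layer.smulLevel hv g z)) := by
    rw [ha, map_sum]
    rfl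
  rw [Layer.mk_eq_mk_iff, AddSubgroup.val_finsetSum] at h1
  exact h1

end ResidueLift

end Weak

/-! ### Fractional ideals and valuations -/

section Dictionary

open WithZero FractionalIdeal

variable {B L : Type*} [CommRing B] [IsDedekindDomain B] [Field L] [Algebra B L]
  [IsFractionRing B L]

theorem valuation_eq_exp_neg_count (w : HeightOneSpectrum B) {x : L} (hx : x ≠ 0) :
    w.valuation L x = exp (-count L w (spanSingleton B⁰ x)) := by
  classical
  have hint : ∀ r : B, r ≠ 0 → w.valuation L (algebraMap B L r) =
      exp (-count L w (spanSingleton B⁰ (algebraMap B L r))) := by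
    intro r hr
    rw [valuation_of_algebraMap, intValuation_if_neg w hr, ← coeIdeal_span_singleton, count_coe]
    simpa using hr
  obtain ⟨a, b, hb, rfl⟩ := IsFractionRing.div_surjective (A := B) x
  have hb0 : b ≠ 0 := nonZeroDivisors.ne_zero hb
  have ha0 : a ≠ 0 := by
    rintro rfl
    simp at hx
  have ha0' : algebraMap B L a ≠ 0 := by simpa using ha0
  have hb0' : algebraMap B L b ≠ 0 := by simpa using hb0
  rw [map_div₀, hint a ha0, hint b hb0, ← exp_sub, div_eq_mul_inv,
    ← spanSingleton_mul_spanSingleton, count_mul L w (spanSingleton_ne_zero_iff.2 ha0')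
      (spanSingleton_ne_zero_iff.2 (inv_ne_zero hb0')), ← spanSingleton_inv, count_inv]
  congr 1
  ring

/-- Membership in a fractional ideal is a condition on valuations. -/
theorem mem_iff_valuation_le {J : FractionalIdeal B⁰ L} (hJ : J ≠ 0) {x : L} :
    x ∈ J ↔ ∀ w : HeightOneSpectrum B, w.valuation L x ≤ exp (-count L w J) := by
  have hle : ∀ {J : FractionalIdeal B⁰ L}, J ≠ 0 → ∀ {x : L}, x ∈ J →
      ∀ w : HeightOneSpectrum B, w.valuation L x ≤ exp (-count L w J) := by
    intro J hJ x hx w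
    rcases eq_or_ne x 0 with rfl | h0
    · simp
    rw [valuation_eq_exp_neg_count w h0, exp_le_exp, neg_le_neg_iff]
    exact count_mono L w (spanSingleton_ne_zero_iff.2 h0) (by rwa [spanSingleton_le_iff_mem])
  refine ⟨hle hJ, fun h => ?_⟩
  rw [← spanSingleton_le_iff_mem]
  have h1 : spanSingleton B⁰ x * J⁻¹ ≤ 1 := by
    rw [spanSingleton_mul_le_iff]
    intro y hy
    rw [mem_one_iff]
    refine mem_integers_of_valuation_le_one (R := B) L (x * y) fun w => ?_
    have h2 := hle (inv_ne_zero hJ) hy w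
    rw [count_inv, neg_neg] at h2
    refine (map_mul_le_exp (h w) h2).trans ?_
    rw [neg_add_cancel, exp_zero]
  calc spanSingleton B⁰ x = spanSingleton B⁰ x * J⁻¹ * J := by
        rw [mul_assoc, inv_mul_cancel₀ hJ, mul_one]
    _ ≤ 1 * J := mul_le_mul_left h1 J
    _ = J := one_mul J

theorem count_coe_asIdeal_of_ne {w w' : HeightOneSpectrum B} (h : w ≠ w') :
    count L w' (w.asIdeal : FractionalIdeal B⁰ L) = 0 :=
  count_maximal_coprime L w' h

omit [IsDedekindDomain B] in
theorem coe_asIdeal_ne_zero (w : HeightOneSpectrum B) :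
    (w.asIdeal : FractionalIdeal B⁰ L) ≠ 0 := by
  simpa using w.ne_bot

/-- Locally at `w`, a fractional ideal is generated by some element of it. -/
theorem exists_mem_valuation_eq {J : FractionalIdeal B⁰ L} (hJ : J ≠ 0)
    (w : HeightOneSpectrum B) : ∃ x ∈ J, w.valuation L x = exp (-count L w J) := by
  by_contra! hne
  have hJw : J * w.asIdeal ≠ 0 := mul_ne_zero hJ (coe_asIdeal_ne_zero w)
  have hle : J ≤ J * w.asIdeal := by
    intro x hx
    rw [mem_iff_valuation_le hJw]
    intro w'
    have hx' := (mem_iff_valuation_le hJ).1 hx w'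
    rw [count_mul L w' hJ (coe_asIdeal_ne_zero w)]
    rcases eq_or_ne w w' with rfl | hww'
    · rw [count_self]
      have := lt_of_le_of_ne hx' (hne x hx)
      rw [lt_exp_iff_le_exp_sub_one] at this
      exact le_exp_of_le this (by omega)
    · rwa [count_coe_asIdeal_of_ne hww', add_zero]
  have := count_mono L w hJ hle
  rw [count_mul L w hJ (coe_asIdeal_ne_zero w), count_self] at this
  omega

/-- An element which satisfies the condition at `w` for membership in a fractional ideal can be
moved into it by an integer prime to `w`. -/
theorem exists_valuation_eq_one_mul_mem {J : FractionalIdeal B⁰ L} (hJ : J ≠ 0)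
    (w : HeightOneSpectrum B) {z : L} (hz : w.valuation L z ≤ exp (-count L w J)) :
    ∃ s : B, w.valuation L (algebraMap B L s) = 1 ∧ algebraMap B L s * z ∈ J := by
  rcases eq_or_ne z 0 with rfl | hz0
  · exact ⟨1, by simp, by simpa using J.zero_mem⟩
  obtain ⟨d, hd0, hdz⟩ : ∃ d : B, d ≠ 0 ∧ algebraMap B L d * z ∈ J := by
    obtain ⟨y, hyJ, hy⟩ := exists_mem_valuation_eq hJ w
    have hy0 : y ≠ 0 := (Valuation.ne_zero_iff (w.valuation L)).1 (by rw [hy]; exact exp_ne_zero)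
    obtain ⟨a, b, hb, hab⟩ := IsFractionRing.div_surjective (A := B) (y / z)
    have hb0 : algebraMap B L b ≠ 0 := by simpa using nonZeroDivisors.ne_zero hb
    refine ⟨a, ?_, ?_⟩
    · rintro rfl
      rw [map_zero, zero_div, eq_comm, div_eq_zero_iff] at hab
      tauto
    · have : algebraMap B L a * z = b • y := by
        rw [Algebra.smul_def, ← div_mul_cancel₀ y hz0, ← hab]
        field_simp
      rw [this]
      exact (J : Submodule B L).smul_mem b hyJ
  have hd0' : spanSingleton B⁰ (algebraMap B L d) ≠ 0 :=
    spanSingleton_ne_zero_iff.2 (by simpa using hd0)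
  set n := count L w (spanSingleton B⁰ (algebraMap B L d)) with hn
  have hw0 : (w.asIdeal : FractionalIdeal B⁰ L) ^ (-n) ≠ 0 :=
    zpow_ne_zero _ (coe_asIdeal_ne_zero w)
  set J' := spanSingleton B⁰ (algebraMap B L d) * (w.asIdeal : FractionalIdeal B⁰ L) ^ (-n)
    with hJ'
  have hJ'0 : J' ≠ 0 := mul_ne_zero hd0' hw0
  have hcount : count L w J' = 0 := by
    rw [hJ', count_mul L w hd0' hw0, count_zpow, count_self]
    omega
  obtain ⟨s, hs, hsw⟩ := exists_mem_valuation_eq hJ'0 w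
  rw [hcount, neg_zero, exp_zero] at hsw
  have hs' : ∀ w' : HeightOneSpectrum B, w' ≠ w →
      w'.valuation L s ≤ w'.valuation L (algebraMap B L d) := by
    intro w' hw'
    refine ((mem_iff_valuation_le hJ'0).1 hs w').trans_eq ?_
    rw [valuation_eq_exp_neg_count w' (by simpa using hd0), hJ', count_mul L w' hd0' hw0,
      count_zpow, count_coe_asIdeal_of_ne hw'.symm, mul_zero, add_zero]
  obtain ⟨s, rfl⟩ := mem_integers_of_valuation_le_one (R := B) L s fun w' => by
    rcases eq_or_ne w' w with rfl | hw'
    · exact hsw.le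
    · exact (hs' w' hw').trans (w'.valuation_le_one d)
  refine ⟨s, hsw, (mem_iff_valuation_le hJ).2 fun w' => ?_⟩
  rcases eq_or_ne w' w with rfl | hw'
  · rwa [map_mul, hsw, one_mul]
  · refine le_trans ?_ ((mem_iff_valuation_le hJ).1 hdz w')
    rw [map_mul, map_mul]
    exact mul_le_mul_left (hs' w' hw') _

theorem exists_algebraMap_sub_le (w : HeightOneSpectrum B) {x : L} (hx : w.valuation L x ≤ 1)
    (n : ℤ) : ∃ r : B, w.valuation L (algebraMap B L r - x) ≤ exp n := by
  obtain ⟨r, hr⟩ := w.exists_valuation_sub_lt_of_integer hx (Units.mk0 (exp n) exp_ne_zero)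
  exact ⟨r, hr.le⟩

theorem valuation_algebraMap_le_exp_iff (w : HeightOneSpectrum B) {r : B} {n : ℕ} :
    w.valuation L (algebraMap B L r) ≤ exp (-(n : ℤ)) ↔ r ∈ w.asIdeal ^ n := by
  rw [valuation_of_algebraMap, intValuation_le_pow_iff_mem]

theorem valuation_algebraMap_eq_one_iff (w : HeightOneSpectrum B) {r : B} :
    w.valuation L (algebraMap B L r) = 1 ↔ r ∉ w.asIdeal := by
  rw [valuation_of_algebraMap, intValuation_eq_one_iff]

/-- An ideal not contained in the prime `w` contains elements arbitrarily close to `1` at `w`. -/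
theorem exists_mem_valuation_sub_one_le (w : HeightOneSpectrum B) {C : Ideal B}
    (hC : ¬ C ≤ w.asIdeal) (n : ℤ) :
    ∃ s ∈ C, w.valuation L (algebraMap B L s - 1) ≤ exp n := by
  obtain ⟨t, htC, ht⟩ := SetLike.not_le_iff_exists.1 hC
  rw [← valuation_algebraMap_eq_one_iff (L := L)] at ht
  have ht0 : algebraMap B L t ≠ 0 := by
    intro h
    rw [h, map_zero] at ht
    exact zero_ne_one ht
  obtain ⟨r, hr⟩ := exists_algebraMap_sub_le w (x := (algebraMap B L t)⁻¹)
    (by rw [map_inv₀, ht, inv_one]) n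
  refine ⟨r * t, C.mul_mem_left r htC, ?_⟩
  have : algebraMap B L (r * t) - 1 = (algebraMap B L r - (algebraMap B L t)⁻¹) * algebraMap B L t
      := by
    rw [sub_mul, inv_mul_cancel₀ ht0, map_mul]
  rwa [this, map_mul, ht, mul_one]

end Dictionary

/-! ### The action on primes -/

section Action

open WithZero FractionalIdeal
open scoped Pointwise

variable {B L G : Type*} [CommRing B] [IsDedekindDomain B] [Field L] [Algebra B L]
  [IsFractionRing B L] [Group G] [MulSemiringAction G B] [MulSemiringAction G L]
  [SMulDistribClass G B L]

omit [IsDedekindDomain B] [IsFractionRing B L] in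
theorem smul_algebraMap (g : G) (r : B) : g • algebraMap B L r = algebraMap B L (g • r) :=
  (algebraMap.smul' g r L).symm

/-- The translate of a prime under an automorphism. -/
def smulPrime (g : G) (w : HeightOneSpectrum B) : HeightOneSpectrum B where
  asIdeal := g • w.asIdeal
  isPrime := inferInstance
  ne_bot h := w.ne_bot (by rw [← inv_smul_smul g w.asIdeal, h, Ideal.smul_bot])

theorem valuation_smulPrime (g : G) (w : HeightOneSpectrum B) (x : L) :
    (smulPrime g w).valuation L (g • x) = w.valuation L x := by
  have hint : ∀ r : B, (smulPrime g w).intValuation (g • r) = w.intValuation r := by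
    intro r
    have h : ∀ n : ℕ, (smulPrime g w).intValuation (g • r) ≤ exp (-(n : ℤ)) ↔
        w.intValuation r ≤ exp (-(n : ℤ)) := fun n => by
      rw [intValuation_le_pow_iff_mem, intValuation_le_pow_iff_mem]
      change g • r ∈ (g • w.asIdeal) ^ n ↔ _
      rw [← smul_pow', Ideal.smul_mem_pointwise_smul_iff]
    rcases eq_or_ne r 0 with rfl | hr
    · simp
    have hgr : g • r ≠ 0 := by rwa [smul_ne_zero_iff_ne]
    refine le_antisymm ?_ ?_
    · rw [w.intValuation_eq_exp_neg_multiplicity hr]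
      rw [h, w.intValuation_eq_exp_neg_multiplicity hr]
    · rw [(smulPrime g w).intValuation_eq_exp_neg_multiplicity hgr]
      rw [← h, (smulPrime g w).intValuation_eq_exp_neg_multiplicity hgr]
  obtain ⟨a, b, hb, rfl⟩ := IsFractionRing.div_surjective (A := B) x
  rw [smul_div₀', smul_algebraMap, smul_algebraMap, map_div₀, map_div₀, valuation_of_algebraMap,
    valuation_of_algebraMap, valuation_of_algebraMap, valuation_of_algebraMap, hint, hint]

theorem valuation_smul (g : G) (w : HeightOneSpectrum B) (x : L) :
    w.valuation L (g • x) = (smulPrime g⁻¹ w).valuation L x := by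
  rw [← valuation_smulPrime g⁻¹ w, inv_smul_smul]

theorem valuation_stabilizer_smul (w : HeightOneSpectrum B)
    (g : MulAction.stabilizer G w.asIdeal) (x : L) :
    w.valuation L (g • x) = w.valuation L x := by
  have : smulPrime (g : G) w = w := HeightOneSpectrum.ext g.2
  have h := valuation_smulPrime (g : G) w x
  rwa [this] at h

omit [IsDedekindDomain B] in
theorem smulPrime_ne {w : HeightOneSpectrum B} {g : G} (hg : g ∉ MulAction.stabilizer G w.asIdeal) :
    smulPrime g w ≠ w := fun h => hg (congrArg HeightOneSpectrum.asIdeal h)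

end Action

/-! ### Teichmüller representatives -/

section Teichmueller

open WithZero
open scoped Pointwise

/-- Congruences modulo an ideal containing the prime `p` improve with every `p`-th power. -/
theorem pow_prime_pow_sub_mem {B : Type*} [CommRing B] {P : Ideal B} {p : ℕ} (hp : p.Prime)
    (hpP : (p : B) ∈ P) {x y : B} (h : x - y ∈ P) (n : ℕ) :
    x ^ p ^ n - y ^ p ^ n ∈ P ^ (n + 1) := by
  induction n with
  | zero => simpa using h
  | succ n ih =>
    set d := x ^ p ^ n - y ^ p ^ n with hd
    obtain ⟨r, hr⟩ := exists_add_pow_prime_eq hp (y ^ p ^ n) d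
    have : x ^ p ^ (n + 1) - y ^ p ^ (n + 1) = d ^ p + p * d * (y ^ p ^ n * r) := by
      rw [pow_succ, pow_mul, pow_mul, show x ^ p ^ n = y ^ p ^ n + d by rw [hd]; ring, hr]
      ring
    rw [this]
    refine add_mem ?_ (Ideal.mul_mem_right _ _ ?_)
    · have h1 : d ^ p ∈ P ^ ((n + 1) * p) := by
        rw [pow_mul]
        exact Ideal.pow_mem_pow ih p
      refine Ideal.pow_le_pow_right ?_ h1
      have := hp.two_le
      nlinarith
    · rw [pow_succ']
      exact Ideal.mul_mem_mul hpP ih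

variable {B L G : Type*} [CommRing B] [IsDedekindDomain B] [Field L] [Algebra B L]
  [IsFractionRing B L] [Group G] [MulSemiringAction G B] [MulSemiringAction G L]
  [SMulDistribClass G B L]

instance isMaximal_asIdeal (w : HeightOneSpectrum B) : w.asIdeal.IsMaximal := w.isMaximal

/-- The residue field of a prime of a Dedekind domain. -/
instance residueField (w : HeightOneSpectrum B) : Field (B ⧸ w.asIdeal) :=
  Ideal.Quotient.field w.asIdeal

/-- The action of the decomposition group on the residue field. -/
instance residueAction (w : HeightOneSpectrum B) :
    MulSemiringAction (MulAction.stabilizer G w.asIdeal) (B ⧸ w.asIdeal) :=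
  have h (g : MulAction.stabilizer G w.asIdeal) :
      w.asIdeal ≤ w.asIdeal.comap (MulSemiringAction.toRingHom _ B g) := fun x hx => by
    have := Ideal.smul_mem_pointwise_smul (g : G) x w.asIdeal hx
    rwa [g.2] at this
  { smul g := Ideal.quotientMap w.asIdeal (MulSemiringAction.toRingHom _ B g) (h g)
    one_smul := by
      rintro ⟨x⟩
      exact congrArg (Ideal.Quotient.mk w.asIdeal) (one_smul G x)
    mul_smul g h := by
      rintro ⟨x⟩
      exact congrArg (Ideal.Quotient.mk w.asIdeal) (mul_smul (g : G) (h : G) x)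
    smul_zero g := map_zero (Ideal.quotientMap _ _ (h g))
    smul_add g := map_add (Ideal.quotientMap _ _ (h g))
    smul_one g := map_one (Ideal.quotientMap _ _ (h g))
    smul_mul g := map_mul (Ideal.quotientMap _ _ (h g)) }

theorem smul_mk (w : HeightOneSpectrum B) (g : MulAction.stabilizer G w.asIdeal) (x : B) :
    g • Ideal.Quotient.mk w.asIdeal x = Ideal.Quotient.mk w.asIdeal (g • x) := rfl

/-- Teichmüller representatives: any lift to the ring of integers, raised to a high power of the
order of the residue field. -/
theorem exists_residueLift (w : HeightOneSpectrum B) [Finite (B ⧸ w.asIdeal)] (p : ℕ)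
    [Fact p.Prime] [CharP (B ⧸ w.asIdeal) p] {e : ℕ} (he : w.valuation L (p : L) ≤ exp (-(e : ℤ))) :
    ∃ (T : ResidueLift (w.valuation L) (MulAction.stabilizer G w.asIdeal) (B ⧸ w.asIdeal) e)
      (m : ℕ), ∀ r : B, w.valuation L
        (T.toFun (Ideal.Quotient.mk w.asIdeal r) - algebraMap B L (r ^ m)) ≤ exp (-(e : ℤ)) := by
  have : Fintype (B ⧸ w.asIdeal) := Fintype.ofFinite _
  have hp : p.Prime := Fact.out
  obtain ⟨f, -, hf⟩ := FiniteField.card (B ⧸ w.asIdeal) p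
  have hpw : (p : B) ∈ w.asIdeal := by
    rw [← Ideal.Quotient.eq_zero_iff_mem, map_natCast, CharP.cast_eq_zero]
  -- A multiple of `f`, so that raising to the power `m` is the identity of the residue field, and
  -- at least `e + 3`, so that the result is independent of the lift modulo the powers `e` and `3`
  -- of `w`.
  set n : ℕ := f * (e + 3) with hn
  set m : ℕ := p ^ n with hm
  let t : (B ⧸ w.asIdeal) → B := fun a => (Quotient.out a) ^ m
  have ht : ∀ r : B, w.valuation L (algebraMap B L (t (Ideal.Quotient.mk w.asIdeal r)) -
      algebraMap B L (r ^ m)) ≤ exp (-((e + 3 : ℕ) : ℤ)) := by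
    intro r
    rw [← map_sub, valuation_algebraMap_le_exp_iff]
    have h1 : Quotient.out (Ideal.Quotient.mk w.asIdeal r) - r ∈ w.asIdeal := by
      rw [← Ideal.Quotient.eq]
      exact Quotient.out_eq _
    refine Ideal.pow_le_pow_right ?_ (pow_prime_pow_sub_mem hp hpw h1 n)
    have : e + 3 ≤ n := Nat.le_mul_of_pos_left _ f.pos
    omega
  have hadd : ∀ r s : B, w.valuation L (algebraMap B L ((r + s) ^ m) -
      (algebraMap B L (r ^ m) + algebraMap B L (s ^ m))) ≤ exp (-(e : ℤ)) := by
    intro r s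
    obtain ⟨u, hu⟩ := exists_add_pow_prime_pow_eq hp r s n
    rw [hm, hu, ← map_add, ← map_sub, add_sub_cancel_left, mul_assoc, mul_assoc,
      map_mul, map_natCast, map_mul]
    exact mul_le_of_le_of_le_one he (w.valuation_le_one _)
  have hto3 : ((e + 3 : ℕ) : ℤ) = e + 3 := by push_cast; ring
  have hte : ∀ r : B, w.valuation L (algebraMap B L (t (Ideal.Quotient.mk w.asIdeal r)) -
      algebraMap B L (r ^ m)) ≤ exp (-(e : ℤ)) := fun r =>
    le_exp_of_le (ht r) (by omega)
  have hsmul : ∀ (g : MulAction.stabilizer G w.asIdeal) (a : B ⧸ w.asIdeal),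
      w.valuation L (g • algebraMap B L (t a) - algebraMap B L (t (g • a))) ≤
        exp (-((e + 3 : ℕ) : ℤ)) := by
    intro g a
    obtain ⟨r, rfl⟩ := Ideal.Quotient.mk_surjective a
    rw [smul_mk]
    refine map_sub_le_of_sub_le (y := algebraMap B L ((g • r) ^ m)) ?_ (map_sub_comm_le (ht _))
    have h1 := ht r
    rw [← valuation_stabilizer_smul w g, smul_sub] at h1
    convert h1 using 3
    rw [← smul_pow']
    exact (smul_algebraMap (g : G) _).symm
  let T : ResidueLift (w.valuation L) (MulAction.stabilizer G w.asIdeal) (B ⧸ w.asIdeal) e :=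
    { toFun a := algebraMap B L (t a)
      map_le_one a := w.valuation_le_one _
      map_add_sub a b := by
        obtain ⟨r, rfl⟩ := Ideal.Quotient.mk_surjective a
        obtain ⟨s, rfl⟩ := Ideal.Quotient.mk_surjective b
        rw [← map_add (Ideal.Quotient.mk w.asIdeal)]
        refine map_sub_le_of_sub_le (map_sub_le_of_sub_le (hte (r + s)) (hadd r s)) ?_
        rw [add_sub_add_comm]
        exact (w.valuation L).map_add_le (map_sub_comm_le (hte r)) (map_sub_comm_le (hte s))
      map_mul_sub a b := by
        obtain ⟨r, rfl⟩ := Ideal.Quotient.mk_surjective a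
        obtain ⟨s, rfl⟩ := Ideal.Quotient.mk_surjective b
        rw [← map_mul (Ideal.Quotient.mk w.asIdeal)]
        refine map_sub_le_of_sub_le (hte (r * s)) (map_sub_comm_le ?_)
        rw [mul_pow, map_mul, ← sub_add_sub_cancel _ (algebraMap B L (r ^ m) *
          algebraMap B L (t (Ideal.Quotient.mk w.asIdeal s))), ← sub_mul, ← mul_sub]
        refine (w.valuation L).map_add_le ?_ ?_
        · rw [map_mul]
          exact mul_le_of_le_of_le_one (hte r) (w.valuation_le_one _)
        · rw [map_mul]
          exact mul_le_of_le_one_of_le (w.valuation_le_one _) (hte s)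
      map_one_sub := by
        have := hte 1
        rwa [one_pow, map_one, map_one] at this
      map_smul_sub g a := le_exp_of_le (hsmul g a) (by omega)
      map_smul_sub_three g a := le_exp_of_le (hsmul g a) (by omega)
      exists_sub_le x hx := by
        obtain ⟨r, hr⟩ := exists_algebraMap_sub_le w hx (-1)
        refine ⟨Ideal.Quotient.mk w.asIdeal r, map_sub_le_of_sub_le (map_sub_comm_le hr)
          (map_sub_comm_le (map_sub_le_of_sub_le (le_exp_of_le (ht r) (by omega)) ?_))⟩
        rw [← map_sub]
        refine (valuation_algebraMap_le_exp_iff w (n := 1)).2 ?_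
        rw [pow_one, ← Ideal.Quotient.eq, map_pow, hm, hn, pow_mul, ← hf,
          FiniteField.pow_card_pow] }
  exact ⟨T, m, hte⟩

theorem mem_ramificationGroup_stabilizer_iff (w : HeightOneSpectrum B) {i : ℕ}
    {g : MulAction.stabilizer G w.asIdeal} :
    g ∈ ramificationGroup (valuation_stabilizer_smul (L := L) w) i ↔
      (g : G) ∈ (w.asIdeal ^ (i + 1)).toAddSubgroup.inertia G := by
  have key : ∀ r : B, w.valuation L (g • algebraMap B L r - algebraMap B L r) ≤
      exp (-(i + 1 : ℤ)) ↔ (g : G) • r - r ∈ w.asIdeal ^ (i + 1) := by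
    intro r
    rw [← valuation_algebraMap_le_exp_iff (L := L), map_sub (algebraMap B L),
      ← smul_algebraMap (g : G) r, Nat.cast_succ]
    rfl
  constructor
  · exact fun h r => (key r).1 (h _ (w.valuation_le_one r))
  · intro h x hx
    obtain ⟨r, hr⟩ := exists_algebraMap_sub_le w hx (-(i + 1 : ℤ))
    refine map_sub_le_of_sub_le (y := g • algebraMap B L r) ?_
      (map_sub_le_of_sub_le ((key r).2 (h r)) hr)
    rw [← smul_sub, valuation_stabilizer_smul]
    exact map_sub_comm_le hr

theorem ramificationGroup_eq_bot_iff (w : HeightOneSpectrum B) {i : ℕ} :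
    ramificationGroup (D := MulAction.stabilizer G w.asIdeal)
      (valuation_stabilizer_smul (L := L) w) i = ⊥ ↔
      (w.asIdeal ^ (i + 1)).toAddSubgroup.inertia G = ⊥ := by
  simp_rw [Subgroup.eq_bot_iff_forall]
  constructor
  · intro h g hg
    have hg0 : g ∈ w.asIdeal.inertia G := fun x =>
      Ideal.pow_le_self (Nat.succ_ne_zero i) (hg x)
    exact congrArg Subtype.val (h ⟨g, Ideal.inertia_le_stabilizer w.asIdeal hg0⟩
      ((mem_ramificationGroup_stabilizer_iff w).2 hg))
  · exact fun h g hg => Subtype.ext (h g ((mem_ramificationGroup_stabilizer_iff w).1 hg))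

theorem card_ramificationGroup (w : HeightOneSpectrum B) (i : ℕ) :
    Nat.card (ramificationGroup (D := MulAction.stabilizer G w.asIdeal)
      (valuation_stabilizer_smul (L := L) w) i) =
      Nat.card ((w.asIdeal ^ (i + 1)).toAddSubgroup.inertia G) := by
  refine Nat.card_congr ⟨fun g => ⟨(g : MulAction.stabilizer G w.asIdeal), ?_⟩,
    fun g => ⟨⟨g, Ideal.inertia_le_stabilizer w.asIdeal fun x =>
      Ideal.pow_le_self (Nat.succ_ne_zero i) (g.2 x)⟩, ?_⟩, fun _ => rfl, fun _ => rfl⟩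
  · exact (mem_ramificationGroup_stabilizer_iff w).1 g.2
  · rw [mem_ramificationGroup_stabilizer_iff]
    exact g.2

theorem card_ramificationGroup_zero (w : HeightOneSpectrum B) :
    Nat.card (ramificationGroup (D := MulAction.stabilizer G w.asIdeal)
      (valuation_stabilizer_smul (L := L) w) 0) = Nat.card (w.asIdeal.inertia G) := by
  rw [card_ramificationGroup, zero_add, pow_one]

end Teichmueller

/-! ### Galois extensions of Dedekind domains -/

section Galois

open WithZero
open scoped Pointwise

variable {A K B L : Type*} [CommRing A] [IsDedekindDomain A] [Field K] [Algebra A K]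
  [IsFractionRing A K] [CommRing B] [IsDedekindDomain B] [Field L] [Algebra B L]
  [IsFractionRing B L] [Algebra K L] [FiniteDimensional K L] [IsGalois K L] [Algebra A B]
  [Algebra A L] [IsScalarTower A K L] [IsScalarTower A B L] [IsIntegralClosure B A L]
  [Module.IsTorsionFree A B] [Module.Finite A B]
  [MulSemiringAction (L ≃ₐ[K] L) B] [SMulDistribClass (L ≃ₐ[K] L) B L]

omit [IsDedekindDomain B] [FiniteDimensional K L] [IsIntegralClosure B A L]
  [Module.IsTorsionFree A B] in
theorem isGaloisGroup_integers : IsGaloisGroup (L ≃ₐ[K] L) A B :=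
  have : Algebra.IsIntegral A B := inferInstance
  IsGaloisGroup.of_isFractionRing (L ≃ₐ[K] L) A B K L

variable (v : HeightOneSpectrum A) (w : HeightOneSpectrum B) [w.asIdeal.LiesOver v.asIdeal]
  [Finite (B ⧸ w.asIdeal)]

omit [IsIntegralClosure B A L] in
theorem valuation_algebraMap_eq_pow (x : K) : w.valuation L (algebraMap K L x) =
    v.valuation K x ^ Nat.card (w.asIdeal.inertia (L ≃ₐ[K] L)) := by
  have := isGaloisGroup_integers (A := A) (K := K) (B := B) (L := L)
  have : Finite (A ⧸ v.asIdeal) := Finite.of_injective _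
    (FaithfulSMul.algebraMap_injective (A ⧸ v.asIdeal) (B ⧸ w.asIdeal))
  have : PerfectField v.asIdeal.ResidueField := inferInstance
  rw [← valuation_liesOver L v w, Ideal.card_inertia_eq_ramificationIdxIn v.asIdeal,
    Ideal.ramificationIdxIn_eq_ramificationIdx v.asIdeal w.asIdeal (L ≃ₐ[K] L),
    Ideal.ramificationIdx'_eq_ramificationIdx v.asIdeal w.asIdeal v.ne_bot]

end Galois

section Switch

open WithZero
open scoped Pointwise

variable {B L G : Type*} [CommRing B] [IsDedekindDomain B] [Field L] [Algebra B L]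
  [IsFractionRing B L] [Group G] [Finite G] [MulSemiringAction G B]

/-- By the Chinese remainder theorem, some integer is close to `1` at `w` and close to `0` at all
other conjugates of `w`. -/
theorem exists_switch (w : HeightOneSpectrum B) (n : ℤ) (m : ℕ) :
    ∃ s : B, w.valuation L (algebraMap B L s - 1) ≤ exp n ∧
      ∀ g : G, g ∉ MulAction.stabilizer G w.asIdeal → s ∈ (g • w.asIdeal) ^ m := by
  classical
  have : Fintype G := Fintype.ofFinite G
  set S : Finset G := Finset.univ.filter fun g => g ∉ MulAction.stabilizer G w.asIdeal with hS
  have hC : ¬ ∏ g ∈ S, (g • w.asIdeal) ^ m ≤ w.asIdeal := by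
    rw [Ideal.IsPrime.prod_le w.isPrime]
    rintro ⟨g, hg, hle⟩
    have hle' : (smulPrime g w).asIdeal ≤ w.asIdeal := w.isPrime.le_of_pow_le hle
    refine (Finset.mem_filter.1 hg).2 ?_
    exact (smulPrime g w).isMaximal.eq_of_le w.isPrime.ne_top hle'
  obtain ⟨s, hsC, hs⟩ := exists_mem_valuation_sub_one_le (L := L) w hC n
  refine ⟨s, hs, fun g hg => ?_⟩
  exact (Finset.inf_le_of_le (f := fun g => (g • w.asIdeal) ^ m) (b := g)
    (by simpa [hS] using hg) le_rfl) (Ideal.prod_le_inf hsC)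

end Switch

/-- An element with distinct conjugates is primitive, and its different is the product of its
differences to the other conjugates. -/
theorem adjoin_eq_top_and_aeval_derivative {K L : Type*} [Field K] [Field L] [Algebra K L]
    [FiniteDimensional K L] [IsGalois K L] [DecidableEq (L ≃ₐ[K] L)] {α : L}
    (hα : Function.Injective fun g : L ≃ₐ[K] L => g α) :
    Algebra.adjoin K {α} = ⊤ ∧ Polynomial.aeval α (Polynomial.derivative (minpoly K α)) =
      ∏ g ∈ Finset.univ.erase (1 : L ≃ₐ[K] L), (α - g α) := by
  have hint : IsIntegral K α := Algebra.IsIntegral.isIntegral α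
  set P : Polynomial L := ∏ g : L ≃ₐ[K] L, (Polynomial.X - Polynomial.C (g α)) with hP
  have hPm : P.Monic := Polynomial.monic_prod_of_monic _ _ fun g _ => Polynomial.monic_X_sub_C _
  have hdvd : P ∣ (minpoly K α).map (algebraMap K L) := by
    refine Finset.prod_dvd_of_coprime
      (fun g _ h _ hgh => Polynomial.pairwise_coprime_X_sub_C hα hgh) fun g _ => ?_
    rw [Polynomial.dvd_iff_isRoot, Polynomial.IsRoot.def, Polynomial.eval_map_algebraMap]
    exact minpoly.aeval_algHom K (g : L →ₐ[K] L) α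
  have hPdeg : P.natDegree = Module.finrank K L := by
    rw [hP, Polynomial.natDegree_prod_of_monic _ _ fun g _ => Polynomial.monic_X_sub_C _]
    simp [← IsGalois.card_aut_eq_finrank K L]
  have heq : P = (minpoly K α).map (algebraMap K L) := by
    refine (Polynomial.eq_of_monic_of_dvd_of_natDegree_le hPm ((minpoly.monic hint).map _)
      hdvd ?_).symm
    rw [Polynomial.natDegree_map, hPdeg]
    exact minpoly.natDegree_le α
  constructor
  · have h1 : (minpoly K α).natDegree = Module.finrank K L := by
      rw [← hPdeg, heq, Polynomial.natDegree_map]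
    rw [← Field.primitive_element_iff_minpoly_natDegree_eq] at h1
    rw [← IntermediateField.adjoin_simple_toSubalgebra_of_isAlgebraic hint.isAlgebraic, h1,
      IntermediateField.top_toSubalgebra]
  · rw [← Polynomial.eval_map_algebraMap, ← Polynomial.derivative_map, ← heq, hP,
      ← Finset.mul_prod_erase _ _ (Finset.mem_univ (1 : L ≃ₐ[K] L)), Polynomial.derivative_mul]
    simp [Polynomial.eval_prod]

/-! ### The different at a weakly ramified prime -/

section Different

open WithZero FractionalIdeal
open scoped Pointwise

variable {A K B L : Type*} [CommRing A] [IsDedekindDomain A] [Field K] [Algebra A K]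
  [IsFractionRing A K] [CommRing B] [IsDedekindDomain B] [Field L] [Algebra B L]
  [IsFractionRing B L] [Algebra K L] [FiniteDimensional K L] [IsGalois K L] [Algebra A B]
  [Algebra A L] [IsScalarTower A K L] [IsScalarTower A B L]
  [Module.IsTorsionFree A B] [Module.Finite A B]
  [MulSemiringAction Gal(L/K) B] [SMulDistribClass Gal(L/K) B L]
  (v : HeightOneSpectrum A) (w : HeightOneSpectrum B) [w.asIdeal.LiesOver v.asIdeal]
  [Finite (B ⧸ w.asIdeal)]

variable (K L) in
/-- The ramification index of `w`: the order of its inertia group. -/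
abbrev ramificationIndex : ℕ := Nat.card (w.asIdeal.inertia Gal(L/K))

variable (K L) in
/-- The order of the wild inertia group of `w`. -/
abbrev wildIndex : ℕ :=
  Nat.card (ramificationGroup (D := MulAction.stabilizer Gal(L/K) w.asIdeal)
    (valuation_stabilizer_smul (L := L) w) 1)

theorem exists_liesOver : ∃ W : HeightOneSpectrum B, W.asIdeal.LiesOver v.asIdeal := by
  have : FaithfulSMul A B := Module.IsTorsionFree.to_faithfulSMul
  obtain ⟨P, hP, hPv⟩ := Ideal.exists_maximal_ideal_liesOver_of_isIntegral (S := B) v.asIdeal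
  exact ⟨⟨P, hP.isPrime, Ideal.ne_bot_of_liesOver_of_ne_bot v.ne_bot P⟩, hPv⟩

omit [IsDedekindDomain B] [FiniteDimensional K L] [Module.IsTorsionFree A B]
  [Finite (B ⧸ w.asIdeal)] in
variable (K L) in
theorem liesOver_smulPrime (g : Gal(L/K)) : (smulPrime g w).asIdeal.LiesOver v.asIdeal := by
  have := isGaloisGroup_integers (A := A) (K := K) (B := B) (L := L)
  have : SMulCommClass Gal(L/K) A B := IsGaloisGroup.commutes
  exact Ideal.LiesOver.smul g

include v in
/-- Residue lifts exist modulo the `e`-th power of the prime, for `e` the ramification index,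
because the residue characteristic `p` is divisible by `v`. The powers `r ^ m` represent
residue classes of the base by elements of the base. -/
theorem exists_residueLift_ramificationIndex : ∃ (p : ℕ) (_ : Fact p.Prime)
    (_ : CharP (B ⧸ w.asIdeal) p)
    (T : ResidueLift (w.valuation L) (MulAction.stabilizer Gal(L/K) w.asIdeal) (B ⧸ w.asIdeal)
      (ramificationIndex K L w)) (m : ℕ), ∀ r : B,
      w.valuation L (T.toFun (Ideal.Quotient.mk w.asIdeal r) - algebraMap B L (r ^ m)) ≤
        exp (-(ramificationIndex K L w : ℤ)) := by
  obtain ⟨p, hp⟩ := CharP.exists (B ⧸ w.asIdeal)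
  have hpp : Fact p.Prime := ⟨CharP.char_is_prime (B ⧸ w.asIdeal) p⟩
  have hpw : w.valuation L (algebraMap B L p) ≤ exp (-((1 : ℕ) : ℤ)) := by
    rw [valuation_algebraMap_le_exp_iff, pow_one, ← Ideal.Quotient.eq_zero_iff_mem, map_natCast,
      CharP.cast_eq_zero]
  have hpw' : w.valuation L (p : L) ≤ exp (-(ramificationIndex K L w : ℤ)) := by
    have h1 := valuation_algebraMap_eq_pow (K := K) (L := L) v w (p : K)
    rw [map_natCast] at h1 hpw
    have h2 : v.valuation K (p : K) ≤ exp (-1) := by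
      by_contra! h
      have h3 : v.valuation K (p : K) = 1 := by
        refine le_antisymm (by simpa using v.valuation_le_one (K := K) (p : A)) ?_
        by_contra! h4
        rw [← exp_zero, lt_exp_iff_le_exp_sub_one] at h4
        exact absurd h (not_lt.2 h4)
      rw [h1, h3, one_pow, ← exp_zero, exp_le_exp] at hpw
      omega
    rw [h1]
    refine (pow_le_pow_left₀ zero_le h2 _).trans_eq ?_
    rw [← exp_nsmul, nsmul_eq_mul, mul_neg, mul_one]
  obtain ⟨T, m, hT⟩ := exists_residueLift (G := Gal(L/K)) w p hpw'
  exact ⟨p, hpp, hp, T, m, hT⟩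

include v in
variable (K L) in
/-- The index of the wild inertia group in the inertia group is prime to the order of the wild
inertia group. -/
theorem exists_ramificationIndex_eq_mul : ∃ t : ℕ,
    ramificationIndex K L w = wildIndex K L w * t ∧ t.Coprime (wildIndex K L w) := by
  obtain ⟨p, _, _, T, -⟩ := exists_residueLift_ramificationIndex (K := K) (L := L) v w
  obtain ⟨π, hπ⟩ := w.valuation_exists_uniformizer L
  obtain ⟨t, ht⟩ : wildIndex K L w ∣ ramificationIndex K L w := by
    rw [ramificationIndex, ← card_ramificationGroup_zero (L := L) w]
    exact Subgroup.card_dvd_of_le (ramificationGroup_antitone _ zero_le_one)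
  exact ⟨t, ht, T.coprime_card_ramificationGroup_one Nat.card_pos _ hπ p
    (card_ramificationGroup_zero w) ht⟩

variable (hw : (w.asIdeal ^ 3).toAddSubgroup.inertia Gal(L/K) = ⊥)

include v hw

/-- In the weakly ramified case, traces from the decomposition group of elements of valuation at
least `-(e + q - 2)` at `w` have valuation greater than `-e`, hence are integral if they lie in
the base field. -/
theorem valuation_sum_stabilizer_smul_le [Fintype (MulAction.stabilizer Gal(L/K) w.asIdeal)] {x : L}
    (hx : w.valuation L x ≤
      exp ((ramificationIndex K L w : ℤ) + wildIndex K L w - 2)) :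
    w.valuation L (∑ g : MulAction.stabilizer Gal(L/K) w.asIdeal, g • x) ≤
      exp ((ramificationIndex K L w : ℤ) - 1) := by
  obtain ⟨p, _, _, T, -⟩ := exists_residueLift_ramificationIndex (K := K) (L := L) v w
  obtain ⟨π, hπ⟩ := w.valuation_exists_uniformizer L
  exact T.map_sum_smul_le Nat.card_pos _ ((ramificationGroup_eq_bot_iff w).2 hw) hπ p
    (card_ramificationGroup_zero w) hx

/-- The product of the differences between an element close to `α₀` and its conjugates under a
weakly ramified decomposition group has valuation `e + q - 2`. -/
theorem exists_prod_valuation_smul_sub_eq [Fintype (MulAction.stabilizer Gal(L/K) w.asIdeal)]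
    [DecidableEq (MulAction.stabilizer Gal(L/K) w.asIdeal)] :
    ∃ α₀ : L, w.valuation L α₀ = 1 ∧ ∀ α : L, w.valuation L (α - α₀) ≤ exp (-3) →
      ∏ g ∈ Finset.univ.erase (1 : MulAction.stabilizer Gal(L/K) w.asIdeal),
        w.valuation L (g • α - α) =
          exp (-((ramificationIndex K L w : ℤ) + wildIndex K L w - 2)) := by
  obtain ⟨p, _, _, T, -⟩ := exists_residueLift_ramificationIndex (K := K) (L := L) v w
  obtain ⟨π, hπ⟩ := w.valuation_exists_uniformizer L
  exact T.exists_prod_map_smul_sub_eq Nat.card_pos _ ((ramificationGroup_eq_bot_iff w).2 hw) hπ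
    (card_ramificationGroup_zero w)

/-- The generator modulo the `(b + e)`-th power of the prime of `ResidueLift.exists_generator_mod`,
with coefficients in the base ring. -/
theorem exists_generator_mod_stabilizer [Fintype (MulAction.stabilizer Gal(L/K) w.asIdeal)]
    {b c : ℤ} (hb : b = 1 + wildIndex K L w * c) :
    ∃ z : L, w.valuation L z ≤ exp (-b) ∧ ∀ x, w.valuation L x ≤ exp (-b) →
      ∃ a : MulAction.stabilizer Gal(L/K) w.asIdeal → A,
        w.valuation L (x - ∑ g, algebraMap A L (a g) * g • z) ≤
          exp (-(b + ramificationIndex K L w)) := by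
  obtain ⟨p, _, _, T, m, hT⟩ := exists_residueLift_ramificationIndex (K := K) (L := L) v w
  obtain ⟨π, hπ⟩ := w.valuation_exists_uniformizer L
  have hgal := isGaloisGroup_integers (A := A) (K := K) (B := B) (L := L)
  have hcomm : ∀ (g : MulAction.stabilizer Gal(L/K) w.asIdeal) (a : A ⧸ v.asIdeal),
      g • algebraMap (A ⧸ v.asIdeal) (B ⧸ w.asIdeal) a = algebraMap _ _ a := fun g a =>
    (Ideal.Quotient.stabilizerHom w.asIdeal v.asIdeal Gal(L/K) g).commutes a
  have haut : ∀ τ : (B ⧸ w.asIdeal) ≃ₐ[A ⧸ v.asIdeal] (B ⧸ w.asIdeal),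
      ∃ g : MulAction.stabilizer Gal(L/K) w.asIdeal, ∀ x, τ x = g • x := by
    intro τ
    obtain ⟨g, rfl⟩ := Ideal.Quotient.stabilizerHom_surjective Gal(L/K) v.asIdeal w.asIdeal τ
    exact ⟨g, fun x => rfl⟩
  obtain ⟨z, hz, hz'⟩ := T.exists_generator_mod Nat.card_pos _
    ((ramificationGroup_eq_bot_iff w).2 hw) hπ p (card_ramificationGroup_zero w) hcomm haut hb
  refine ⟨z, hz, fun x hx => ?_⟩
  obtain ⟨a, ha⟩ := hz' x hx
  refine ⟨fun g => (Quotient.out (a g)) ^ m, map_sub_le_of_sub_le ha ?_⟩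
  rw [← Finset.sum_sub_distrib]
  refine (w.valuation L).map_sum_le fun g _ => ?_
  rw [← sub_mul]
  refine (map_mul_le_exp (a := -(ramificationIndex K L w : ℤ)) (b := -b) ?_ ?_).trans
    (exp_le_exp.2 (by omega))
  · have h1 := hT (algebraMap A B (Quotient.out (a g)))
    have h2 : Ideal.Quotient.mk w.asIdeal (algebraMap A B (Quotient.out (a g))) =
        algebraMap (A ⧸ v.asIdeal) (B ⧸ w.asIdeal) (a g) := by
      conv_rhs => rw [← Quotient.out_eq (a g)]
      rfl
    rwa [h2, ← map_pow, ← IsScalarTower.algebraMap_apply] at h1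
  · rw [valuation_stabilizer_smul]
    exact hz

/-- The different divides the derivative of the minimal polynomial of a primitive integer at this
integer. For an integer which is close to `α₀` at `w` and divisible by the other conjugates of `w`,
only the decomposition group contributes to the valuation of this derivative at `w`. -/
theorem count_differentIdeal_le [IsIntegralClosure B A L] :
    count L w (differentIdeal A B : FractionalIdeal B⁰ L) ≤
      (ramificationIndex K L w : ℤ) + wildIndex K L w - 2 := by
  classical
  obtain ⟨α₀, hα₀, hprod⟩ := exists_prod_valuation_smul_sub_eq v w hw
  obtain ⟨r, hr⟩ := exists_algebraMap_sub_le w hα₀.le (-3)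
  obtain ⟨s, hs, hs'⟩ := exists_switch (L := L) (G := Gal(L/K)) w (-3) 1
  set α : L := algebraMap B L (s * r) with hα
  have hαα₀ : w.valuation L (α - α₀) ≤ exp (-3) := by
    refine map_sub_le_of_sub_le (y := algebraMap B L r) ?_ hr
    rw [hα, map_mul, ← sub_one_mul, map_mul]
    exact mul_le_of_le_of_le_one hs (w.valuation_le_one r)
  have hα1 : w.valuation L α = 1 := by
    rw [← hα₀]
    refine map_eq_of_sub_lt (hαα₀.trans_lt ?_)
    rw [hα₀, ← exp_zero, exp_lt_exp]
    omega
  have hout : ∀ g : Gal(L/K), g ∉ MulAction.stabilizer Gal(L/K) w.asIdeal →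
      w.valuation L (α - g • α) = 1 := by
    intro g hg
    have h1 : w.valuation L (g • α) < 1 := by
      rw [valuation_smul, hα, valuation_of_algebraMap, intValuation_lt_one_iff_mem]
      have := hs' g⁻¹ (fun h => hg (inv_mem_iff.1 h))
      rw [pow_one] at this
      exact Ideal.mul_mem_right _ _ this
    rw [Valuation.map_sub_eq_of_lt_left, hα1]
    rwa [hα1]
  have hval : ∏ g ∈ Finset.univ.erase (1 : Gal(L/K)), w.valuation L (α - g • α) =
      exp (-((ramificationIndex K L w : ℤ) + wildIndex K L w - 2)) := by
    rw [← hprod α hαα₀]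
    symm
    refine Finset.prod_of_injOn Subtype.val Subtype.val_injective.injOn ?_ ?_ ?_
    · intro g hg
      simpa using hg
    · intro g hg hg'
      refine hout g fun h => hg' ⟨⟨g, h⟩, ?_, rfl⟩
      simpa [Subtype.ext_iff] using hg
    · intro g _
      rw [Valuation.map_sub_swap]
      rfl
  have hinj : Function.Injective fun g : Gal(L/K) => g α := by
    intro g h hgh
    by_contra hne
    have h1 : α - (g⁻¹ * h) • α = 0 := by
      rw [mul_smul, sub_eq_zero, eq_inv_smul_iff]
      exact hgh
    have h2 : ∏ g ∈ Finset.univ.erase (1 : Gal(L/K)), w.valuation L (α - g • α) = 0 := by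
      refine Finset.prod_eq_zero (i := g⁻¹ * h) ?_ (by rw [h1, map_zero])
      simpa [inv_mul_eq_one] using hne
    rw [hval] at h2
    exact exp_ne_zero h2
  obtain ⟨hadj, hder⟩ := adjoin_eq_top_and_aeval_derivative hinj
  have hmem := aeval_derivative_mem_differentIdeal A K L (s * r) hadj
  have hint : IsIntegral A (s * r) := Algebra.IsIntegral.isIntegral _
  have hne : (differentIdeal A B : FractionalIdeal B⁰ L) ≠ 0 := by
    rw [coeIdeal_differentIdeal A K L B]
    exact inv_ne_zero (dual_ne_zero A K one_ne_zero)
  have h1 := (mem_iff_valuation_le hne).1 (mem_coeIdeal_of_mem B⁰ hmem) w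
  have h2 : algebraMap B L (Polynomial.aeval (s * r) (Polynomial.derivative (minpoly A (s * r)))) =
      ∏ g ∈ Finset.univ.erase (1 : Gal(L/K)), (α - g • α) := by
    rw [← Polynomial.aeval_algebraMap_apply, ← hα, ← Polynomial.aeval_map_algebraMap K,
      ← Polynomial.derivative_map]
    have h3 : (minpoly A (s * r)).map (algebraMap A K) = minpoly K α := by
      have : IsIntegral A α := hint.algebraMap
      rw [minpoly.isIntegrallyClosed_eq_field_fractions K L hint]
    rw [h3, hder]
    rfl
  rw [h2, map_prod, hval, exp_le_exp] at h1
  omega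

/-- The elements of valuation at least `-(e + q - 2)` at `w` that are integral elsewhere have
integral traces. Above `v` this can be tested at `w`, where the conjugates under elements outside of
the decomposition group are integral; above the other primes of the base all conjugates are
integral. -/
theorem le_count_differentIdeal [IsIntegralClosure B A L] :
    (ramificationIndex K L w : ℤ) + wildIndex K L w - 2 ≤
      count L w (differentIdeal A B : FractionalIdeal B⁰ L) := by
  classical
  set n : ℤ := (ramificationIndex K L w : ℤ) + wildIndex K L w - 2 with hn
  have he1 : 1 ≤ ramificationIndex K L w := Nat.card_pos
  have hdual : dual A K (1 : FractionalIdeal B⁰ L) ≠ 0 := dual_ne_zero A K one_ne_zero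
  have hle : (w.asIdeal : FractionalIdeal B⁰ L) ^ (-n) ≤ dual A K 1 := by
    intro x hx
    rw [mem_dual (I := (1 : FractionalIdeal B⁰ L)) one_ne_zero]
    intro a ha
    rw [Algebra.traceForm_apply]
    have hxa : x * a ∈ (w.asIdeal : FractionalIdeal B⁰ L) ^ (-n) := by
      obtain ⟨a, rfl⟩ := (mem_one_iff B⁰).1 ha
      rw [mul_comm, ← Algebra.smul_def]
      exact Submodule.smul_mem _ a hx
    have hxaw := (mem_iff_valuation_le (zpow_ne_zero _ (coe_asIdeal_ne_zero w))).1 hxa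
    have hw_self : w.valuation L (x * a) ≤ exp n := by
      have := hxaw w
      rwa [count_zpow, count_self, mul_one, neg_neg] at this
    have hw_other : ∀ w' ≠ w, w'.valuation L (x * a) ≤ 1 := by
      intro w' hw'
      have := hxaw w'
      rwa [count_zpow, count_coe_asIdeal_of_ne hw'.symm, mul_zero, neg_zero, exp_zero] at this
    refine mem_integers_of_valuation_le_one (R := A) K _ fun v' => ?_
    have htr : algebraMap K L (Algebra.trace K L (x * a)) = ∑ g : Gal(L/K), g • (x * a) :=
      trace_eq_sum_automorphisms _
    rcases eq_or_ne v' v with rfl | hv'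
    · have h1 : w.valuation L (∑ g : Gal(L/K), g • (x * a)) ≤
          exp ((ramificationIndex K L w : ℤ) - 1) := by
        rw [← Finset.sum_filter_add_sum_filter_not Finset.univ
          (fun g => g ∈ MulAction.stabilizer Gal(L/K) w.asIdeal)]
        refine (w.valuation L).map_add_le ?_ ((w.valuation L).map_sum_le fun g hg => ?_)
        · have h2 := valuation_sum_stabilizer_smul_le v' w hw (x := x * a) hw_self
          rwa [Finset.sum_subtype _ (p := fun g => g ∈ MulAction.stabilizer Gal(L/K) w.asIdeal)
            (by simp)]
        · rw [valuation_smul]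
          refine (hw_other _ (smulPrime_ne fun h => ?_)).trans ?_
          · exact (Finset.mem_filter.1 hg).2 (inv_mem_iff.1 h)
          · rw [← exp_zero, exp_le_exp]
            omega
      rw [← htr, valuation_algebraMap_eq_pow v' w] at h1
      by_contra! h
      have h3 : exp 1 ≤ v'.valuation K (Algebra.trace K L (x * a)) := by
        by_contra! h4
        rw [lt_exp_iff_le_exp_sub_one, sub_self, exp_zero] at h4
        exact absurd h (not_lt.2 h4)
      have h5 := (pow_le_pow_left₀ zero_le h3 (ramificationIndex K L w)).trans h1
      rw [← exp_nsmul, exp_le_exp, nsmul_eq_mul, mul_one] at h5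
      omega
    · obtain ⟨W, hW⟩ : ∃ W : HeightOneSpectrum B, W.asIdeal.LiesOver v'.asIdeal :=
        exists_liesOver v'
      have h1 : W.valuation L (∑ g : Gal(L/K), g • (x * a)) ≤ 1 := by
        refine (W.valuation L).map_sum_le fun g _ => ?_
        rw [valuation_smul]
        refine hw_other _ fun h => hv' ?_
        have h2 := liesOver_smulPrime K L v' W g⁻¹
        rw [h] at h2
        exact HeightOneSpectrum.ext (h2.over.trans (Ideal.over_def w.asIdeal v.asIdeal).symm)
      rw [← htr, ← valuation_liesOver L v' W] at h1
      exact (pow_le_one_iff_of_nonneg zero_le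
        (Ideal.IsDedekindDomain.ramificationIdx'_ne_zero_of_liesOver W.asIdeal v'.ne_bot)).1 h1
  have h1 := count_mono L w (zpow_ne_zero _ (coe_asIdeal_ne_zero w)) hle
  rw [coeIdeal_differentIdeal A K L B, count_inv]
  rw [count_zpow, count_self] at h1
  omega

end Different

/-! ### Projective modules over group rings -/

section Projective

/-- Projectivity is local on the base. At every maximal ideal, it suffices that multiplication by
some `s` outside of the ideal factors through `Λ`; the elements `s` generate the unit ideal, and a
combination of the factorizations splits a map from a free module onto `M`. -/
theorem projective_of_forall_isMaximal {A Λ M : Type*} [CommRing A] [Semiring Λ] [Algebra A Λ]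
    [AddCommMonoid M] [Module Λ M] (h : ∀ P : Ideal A, P.IsMaximal → ∃ s ∉ P, ∃ (x : M)
      (ψ : M →ₗ[Λ] Λ), ∀ y, ψ y • x = algebraMap A Λ s • y) : Module.Projective Λ M := by
  set S : Set A := {s | ∃ (x : M) (ψ : M →ₗ[Λ] Λ), ∀ y, ψ y • x = algebraMap A Λ s • y} with hS
  have htop : Ideal.span S = ⊤ := by
    by_contra hne
    obtain ⟨P, hP, hle⟩ := Ideal.exists_le_maximal _ hne
    obtain ⟨s, hsP, hs⟩ := h P hP
    exact hsP (hle (Ideal.subset_span hs))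
  have h1 : (1 : A) ∈ Submodule.span A S := by
    change (1 : A) ∈ Ideal.span S
    rw [htop]
    trivial
  obtain ⟨n, f, s, hfs⟩ := Submodule.mem_span_set'.1 h1
  choose x ψ hψ using fun i => (s i).2
  refine Module.Projective.of_split (LinearMap.pi ψ)
    (Fintype.linearCombination Λ fun i => algebraMap A Λ (f i) • x i) (LinearMap.ext fun y => ?_)
  rw [LinearMap.comp_apply, Fintype.linearCombination_apply, LinearMap.id_apply]
  have h2 : ∀ i, LinearMap.pi ψ y i • algebraMap A Λ (f i) • x i =
      algebraMap A Λ (f i * s i) • y := fun i => by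
    rw [LinearMap.pi_apply, smul_smul, ← Algebra.commutes, mul_smul, hψ, smul_smul, ← map_mul]
  rw [Finset.sum_congr rfl fun i _ => h2 i, ← Finset.sum_smul, ← map_sum]
  simp_rw [smul_eq_mul] at hfs
  rw [hfs, map_one, one_smul]

/-- The coordinate at `1` of a projective module over a group ring, as an endomorphism whose trace
is the identity. -/
theorem exists_sum_smul_eq_self (A : Type*) {G M : Type*} [CommRing A] [Group G] [Fintype G]
    [AddCommMonoid M] [Module A[G] M] [Module.Projective A[G] M] :
    ∃ F : M → M, ∀ z : M, ∑ g : G, MonoidAlgebra.single g (1 : A) •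
      F (MonoidAlgebra.single g⁻¹ (1 : A) • z) = z := by
  obtain ⟨s, hs⟩ := (Module.projective_def' (R := A[G]) (P := M)).1 inferInstance
  refine ⟨fun z => (s z).sum fun m a => MonoidAlgebra.single (1 : G) (a.coeff 1) • m, fun z => ?_⟩
  have h1 : ∀ g : G, (s (MonoidAlgebra.single g⁻¹ (1 : A) • z)).sum
      (fun m a => MonoidAlgebra.single (1 : G) (a.coeff 1) • m) =
      (s z).sum fun m a => MonoidAlgebra.single (1 : G) (a.coeff g) • m := by
    intro g
    rw [map_smul, Finsupp.sum_smul_index']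
    · refine Finsupp.sum_congr fun m _ => ?_
      rw [smul_eq_mul, MonoidAlgebra.coeff_single_mul_apply]
      simp
    · simp
  simp_rw [h1, Finsupp.smul_sum, smul_smul, MonoidAlgebra.single_mul_single, mul_one, one_mul]
  simp only [Finsupp.sum]
  rw [Finset.sum_comm]
  have h2 : z = (s z).sum fun m a => a • m := by
    conv_lhs => rw [← LinearMap.id_apply (R := A[G]) z, ← hs]
    rfl
  conv_rhs => rw [h2]
  refine Finset.sum_congr rfl fun m _ => ?_
  rw [← Finset.sum_smul]
  congr 1
  refine MonoidAlgebra.ext (Finsupp.ext fun g => ?_)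
  simp [MonoidAlgebra.coeff_sum]

/-- An element fixed by `σ` of a projective module over a group ring is a trace from the subgroup
generated by `σ`. -/
theorem exists_sum_pow_smul_eq {A G M : Type*} [CommRing A] [Group G] [Finite G]
    [AddCommMonoid M] [Module A[G] M] [Module.Projective A[G] M] (σ : G) {z : M}
    (hz : MonoidAlgebra.single σ (1 : A) • z = z) :
    ∃ x : M, ∑ j ∈ Finset.range (orderOf σ), MonoidAlgebra.single (σ ^ j) (1 : A) • x = z := by
  classical
  have : Fintype G := Fintype.ofFinite G
  obtain ⟨F, hF⟩ := exists_sum_smul_eq_self A (G := G) (M := M)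
  have hmul : ∀ (g h : G) (y : M), MonoidAlgebra.single (g * h) (1 : A) • y =
      MonoidAlgebra.single g (1 : A) • MonoidAlgebra.single h (1 : A) • y := fun g h y => by
    rw [smul_smul, MonoidAlgebra.single_mul_single, one_mul]
  have hz' : ∀ h : Subgroup.zpowers σ, MonoidAlgebra.single (h : G) (1 : A) • z = z := by
    rintro ⟨h, hh⟩
    obtain ⟨n, rfl⟩ := mem_powers_iff_mem_zpowers.2 hh
    change MonoidAlgebra.single (σ ^ n) (1 : A) • z = z
    clear hh
    induction n with
    | zero => rw [pow_zero, ← MonoidAlgebra.one_def, one_smul]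
    | succ n ih => rw [pow_succ, hmul, hz, ih]
  set x : M := ∑ r : G ⧸ Subgroup.zpowers σ, MonoidAlgebra.single (r.out)⁻¹ (1 : A) •
    F (MonoidAlgebra.single r.out (1 : A) • z) with hx
  have hbij : Function.Bijective fun a : (G ⧸ Subgroup.zpowers σ) × Subgroup.zpowers σ =>
      (a.1.out * (a.2 : G))⁻¹ := by
    refine inv_involutive.bijective.comp ⟨?_, fun g => ?_⟩
    · rintro ⟨r, h⟩ ⟨r', h'⟩ heq
      have hr : r = r' := by
        rw [← QuotientGroup.out_eq' r, ← QuotientGroup.out_eq' r',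
          ← QuotientGroup.mk_mul_of_mem r.out h.2, ← QuotientGroup.mk_mul_of_mem r'.out h'.2]
        exact congrArg _ heq
      subst hr
      exact Prod.ext rfl (Subtype.ext (mul_left_cancel heq))
    · refine ⟨⟨g, ⟨(g : G ⧸ Subgroup.zpowers σ).out⁻¹ * g, ?_⟩⟩, by simp⟩
      rw [← QuotientGroup.eq]
      exact QuotientGroup.out_eq' _
  refine ⟨x, ?_⟩
  calc ∑ j ∈ Finset.range (orderOf σ), MonoidAlgebra.single (σ ^ j) (1 : A) • x
      = ∑ h : Subgroup.zpowers σ, MonoidAlgebra.single (h : G) (1 : A) • x := by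
        rw [← Fin.sum_univ_eq_sum_range (fun j => MonoidAlgebra.single (σ ^ j) (1 : A) • x)]
        exact Fintype.sum_equiv (finEquivZPowers (isOfFinOrder_of_finite σ)) _ _ fun j => rfl
    _ = ∑ h : Subgroup.zpowers σ, MonoidAlgebra.single ((h : G)⁻¹) (1 : A) • x :=
        (Fintype.sum_equiv (Equiv.inv _) _ _ fun h => rfl).symm
    _ = ∑ g : G, MonoidAlgebra.single g (1 : A) •
          F (MonoidAlgebra.single g⁻¹ (1 : A) • z) := by
        rw [← hbij.sum_comp (fun g => MonoidAlgebra.single g (1 : A) •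
          F (MonoidAlgebra.single g⁻¹ (1 : A) • z)), Fintype.sum_prod_type_right]
        refine Finset.sum_congr rfl fun h _ => ?_
        rw [hx, Finset.smul_sum]
        refine Finset.sum_congr rfl fun r _ => ?_
        rw [inv_inv, hmul, hz', mul_inv_rev, hmul]
    _ = z := hF z

end Projective

/-! ### Stable fractional ideals and the square root of the inverse different -/

section Stable

open WithZero FractionalIdeal
open scoped Pointwise

variable {B L G : Type*} [CommRing B] [IsDedekindDomain B] [Field L] [Algebra B L]
  [IsFractionRing B L] [Group G] [MulSemiringAction G B] [MulSemiringAction G L]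
  [SMulDistribClass G B L]

theorem count_smulPrime {J : FractionalIdeal B⁰ L} (hJ : J ≠ 0)
    (hst : ∀ (g : G), ∀ x ∈ J, g • x ∈ J) (g : G) (w : HeightOneSpectrum B) :
    count L (smulPrime g w) J = count L w J := by
  have key : ∀ (g : G) (w : HeightOneSpectrum B), count L (smulPrime g w) J ≤ count L w J := by
    intro g w
    obtain ⟨x, hx, hxw⟩ := exists_mem_valuation_eq hJ w
    have h1 := (mem_iff_valuation_le hJ).1 (hst g x hx) (smulPrime g w)
    rw [valuation_smulPrime, hxw, exp_le_exp] at h1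
    omega
  refine le_antisymm (key g w) ?_
  have h1 := key g⁻¹ (smulPrime g w)
  have h2 : smulPrime g⁻¹ (smulPrime g w) = w := HeightOneSpectrum.ext (inv_smul_smul g _)
  rwa [h2] at h1

theorem smul_mem_of_count_smulPrime {J : FractionalIdeal B⁰ L} (hJ : J ≠ 0)
    (hst : ∀ (g : G) (w : HeightOneSpectrum B), count L (smulPrime g w) J = count L w J) (g : G)
    {x : L} (hx : x ∈ J) : g • x ∈ J := by
  rw [mem_iff_valuation_le hJ] at hx ⊢
  intro w
  rw [valuation_smul, ← hst g⁻¹ w]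
  exact hx _

end Stable

section Sqrt

open WithZero FractionalIdeal
open scoped Pointwise

variable {A K B L : Type*} [CommRing A] [IsDedekindDomain A] [Field K] [Algebra A K]
  [IsFractionRing A K] [CommRing B] [IsDedekindDomain B] [Field L] [Algebra B L]
  [IsFractionRing B L] [Algebra K L] [FiniteDimensional K L] [IsGalois K L] [Algebra A B]
  [Algebra A L] [IsScalarTower A K L] [IsScalarTower A B L] [IsIntegralClosure B A L]
  [Module.IsTorsionFree A B] [Module.Finite A B]

variable (A K B L) in
include K in
omit [Module.Finite A B] in
theorem coe_differentIdeal_ne_zero :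
    (differentIdeal A B : FractionalIdeal B⁰ L) ≠ 0 := by
  rw [coeIdeal_differentIdeal A K L B]
  exact inv_ne_zero (dual_ne_zero A K one_ne_zero)

variable {I : FractionalIdeal B⁰ L} (hI : IsSqrtInverseDifferent A I)

include hI

variable (K) in
include K in
omit [Module.Finite A B] in
theorem IsSqrtInverseDifferent.ne_zero : I ≠ 0 := by
  rintro rfl
  have h1 : (differentIdeal A B : FractionalIdeal B⁰ L)⁻¹ = 0 := by
    rw [← hI]
    exact zero_pow two_ne_zero
  exact inv_ne_zero (coe_differentIdeal_ne_zero A K B L) h1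

omit [Algebra A L] [IsScalarTower A B L] [IsIntegralClosure B A L] [Module.Finite A B] in
theorem IsSqrtInverseDifferent.two_mul_count (w : HeightOneSpectrum B) :
    2 * count L w I = -count L w (differentIdeal A B : FractionalIdeal B⁰ L) := by
  rw [← count_inv, ← hI, count_pow]
  rfl

variable [MulSemiringAction Gal(L/K) B] [SMulDistribClass Gal(L/K) B L]

omit [Module.Finite A B] in
/-- The square root of the inverse different is stable under the Galois group, since its exponents
are halves of those of the dual of the ring of integers under the trace form. -/
theorem IsSqrtInverseDifferent.smul_mem (g : Gal(L/K)) {x : L} (hx : x ∈ I) : g • x ∈ I := by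
  refine smul_mem_of_count_smulPrime (hI.ne_zero K) (fun g w => ?_) g hx
  have h1 := hI.two_mul_count w
  have h2 := hI.two_mul_count (smulPrime g w)
  have hst : ∀ (g : Gal(L/K)), ∀ x ∈ dual A K (1 : FractionalIdeal B⁰ L),
      g • x ∈ dual A K (1 : FractionalIdeal B⁰ L) := by
    intro g x hx
    rw [mem_dual (I := (1 : FractionalIdeal B⁰ L)) one_ne_zero] at hx ⊢
    intro a ha
    obtain ⟨a, rfl⟩ := (mem_one_iff B⁰).1 ha
    have h1 := hx (algebraMap B L (g⁻¹ • a)) ((mem_one_iff B⁰).2 ⟨_, rfl⟩)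
    rw [Algebra.traceForm_apply] at h1 ⊢
    rw [← Algebra.trace_eq_of_algEquiv g] at h1
    rw [← smul_algebraMap] at h1
    change Algebra.trace K L (g • (x * g⁻¹ • algebraMap B L a)) ∈ _ at h1
    rwa [smul_mul', smul_inv_smul] at h1
  have h3 := count_smulPrime (dual_ne_zero A K (one_ne_zero (α := FractionalIdeal B⁰ L))) hst g w
  rw [coeIdeal_differentIdeal A K L B, count_inv] at h1 h2
  omega

/-- At a weakly ramified prime, the exponent `b` of the square root of the inverse different
satisfies `2 b = -(e + q - 2)` with `e = q t`, hence `2 (b - 1) = -q (t + 1)`. If `t` is odd, then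
`q` divides `b - 1` visibly; if `t` is even, then `q`, being prime to `t`, is odd. -/
theorem IsSqrtInverseDifferent.exists_count_eq (v : HeightOneSpectrum A) (w : HeightOneSpectrum B)
    [w.asIdeal.LiesOver v.asIdeal] [Finite (B ⧸ w.asIdeal)]
    (hw : (w.asIdeal ^ 3).toAddSubgroup.inertia Gal(L/K) = ⊥) :
    ∃ c : ℤ, count L w I = 1 + wildIndex K L w * c := by
  obtain ⟨t, ht, hcop⟩ := exists_ramificationIndex_eq_mul K L v w
  have h1 := hI.two_mul_count w
  have h2 := count_differentIdeal_le v w hw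
  have h3 := le_count_differentIdeal v w hw
  have h4 : 2 * (count L w I - 1) = -(wildIndex K L w * (t + 1)) := by
    have : (ramificationIndex K L w : ℤ) = wildIndex K L w * t := by exact_mod_cast ht
    rw [this] at h2 h3
    linarith
  rcases Nat.even_or_odd' t with ⟨s, hs | hs⟩
  · have h5 : (wildIndex K L w : ℤ) ∣ 2 * (count L w I - 1) := by
      rw [h4]
      exact (Dvd.intro _ rfl).neg_right
    have h6 : IsCoprime (wildIndex K L w : ℤ) 2 := by
      rw [hs] at hcop
      exact_mod_cast Nat.isCoprime_iff_coprime.2 (Nat.Coprime.coprime_mul_right hcop).symm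
    obtain ⟨c, hc⟩ := h6.dvd_of_dvd_mul_left h5
    exact ⟨c, by omega⟩
  · refine ⟨-(s + 1), ?_⟩
    rw [hs] at h4
    push_cast at h4
    linarith

end Sqrt

/-! ### Normal basis generators modulo a prime of the base -/

section Generator

open WithZero FractionalIdeal
open scoped Pointwise

variable {A K B L : Type*} [CommRing A] [IsDedekindDomain A] [Field K] [Algebra A K]
  [IsFractionRing A K] [CommRing B] [IsDedekindDomain B] [Field L] [Algebra B L]
  [IsFractionRing B L] [Algebra K L] [FiniteDimensional K L] [IsGalois K L] [Algebra A B]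
  [Algebra A L] [IsScalarTower A K L] [IsScalarTower A B L]
  [Module.IsTorsionFree A B] [Module.Finite A B]
  [MulSemiringAction Gal(L/K) B] [SMulDistribClass Gal(L/K) B L]
  (v : HeightOneSpectrum A)

/-- An element of `I` which is divisible by `v`, locally at each prime above `v`, lies in `v I`. -/
theorem mem_smul_of_valuation_le [∀ w : HeightOneSpectrum B, Finite (B ⧸ w.asIdeal)]
    {I : FractionalIdeal B⁰ L} (hI : I ≠ 0) {y : L} (hy : y ∈ I)
    (h : ∀ w : HeightOneSpectrum B, w.asIdeal.LiesOver v.asIdeal → w.valuation L y ≤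
      exp (-(count L w I + ramificationIndex K L w))) :
    y ∈ v.asIdeal • (I : Submodule B L).restrictScalars A := by
  set J : FractionalIdeal B⁰ L := ((v.asIdeal.map (algebraMap A B) : Ideal B) :
    FractionalIdeal B⁰ L) with hJ
  have hmem : ∀ a ∈ v.asIdeal, algebraMap B L (algebraMap A B a) ∈ J := fun a ha =>
    mem_coeIdeal_of_mem B⁰ (Ideal.mem_map_of_mem _ ha)
  have hJ0 : J ≠ 0 := by
    obtain ⟨a, ha, ha0⟩ := Submodule.exists_mem_ne_zero_of_ne_bot v.ne_bot
    intro h0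
    have := hmem a ha
    rw [h0, mem_zero_iff, ← map_zero (algebraMap B L)] at this
    have h1 := IsFractionRing.injective B L this
    rw [← map_zero (algebraMap A B)] at h1
    exact ha0 ((Module.isTorsionFree_iff_algebraMap_injective.1 inferInstance) h1)
  have hyJ : y ∈ J * I := by
    rw [mem_iff_valuation_le (mul_ne_zero hJ0 hI)]
    intro w
    rw [count_mul L w hJ0 hI]
    by_cases hwv : w.asIdeal.LiesOver v.asIdeal
    · refine le_exp_of_le (h w hwv) ?_
      obtain ⟨a, ha⟩ := v.intValuation_exists_uniformizer
      have hav : a ∈ v.asIdeal := by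
        rw [← intValuation_lt_one_iff_mem, ha, ← exp_zero, exp_lt_exp]
        omega
      have h1 := (mem_iff_valuation_le hJ0).1 (hmem a hav) w
      rw [← IsScalarTower.algebraMap_apply A B L, IsScalarTower.algebraMap_apply A K L,
        valuation_algebraMap_eq_pow v w, valuation_of_algebraMap, ha, ← exp_nsmul, exp_le_exp,
        nsmul_eq_mul] at h1
      linarith
    · refine le_exp_of_le ((mem_iff_valuation_le hI).1 hy w) ?_
      obtain ⟨a, hav, haw⟩ : ∃ a ∈ v.asIdeal, algebraMap A B a ∉ w.asIdeal := by
        by_contra! hall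
        refine hwv ⟨v.isMaximal.eq_of_le (Ideal.IsPrime.ne_top inferInstance) fun a ha => ?_⟩
        exact hall a ha
      have h1 := (mem_iff_valuation_le hJ0).1 (hmem a hav) w
      rw [(valuation_algebraMap_eq_one_iff w).2 haw, ← exp_zero, exp_le_exp] at h1
      omega
  refine FractionalIdeal.mul_induction_on hyJ ?_ fun x y hx hy => add_mem hx hy
  intro i hi j hj
  obtain ⟨r, hr, rfl⟩ := (mem_coeIdeal B⁰).1 hi
  clear hi
  revert j
  refine Submodule.span_induction (p := fun r _ => ∀ j ∈ I, algebraMap B L r * j ∈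
    v.asIdeal • (I : Submodule B L).restrictScalars A) ?_ ?_ ?_ ?_ hr
  · rintro _ ⟨a, ha, rfl⟩ j hj
    rw [← IsScalarTower.algebraMap_apply, ← Algebra.smul_def]
    exact Submodule.smul_mem_smul ha hj
  · intro j hj
    rw [map_zero, zero_mul]
    exact zero_mem _
  · intro r s _ _ hr hs j hj
    rw [map_add, add_mul]
    exact add_mem (hr j hj) (hs j hj)
  · intro s r _ hr j hj
    rw [smul_eq_mul, mul_comm s, map_mul, mul_assoc, ← Algebra.smul_def s]
    exact hr _ ((I : Submodule B L).smul_mem s hj)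

variable (w : HeightOneSpectrum B) [w.asIdeal.LiesOver v.asIdeal]

include v in
/-- Conjugate primes have the same ramification index. -/
theorem ramificationIndex_smulPrime [Finite (B ⧸ w.asIdeal)] (g : Gal(L/K)) :
    ramificationIndex K L (smulPrime g w) = ramificationIndex K L w := by
  have := liesOver_smulPrime K L v w g
  have : Finite (B ⧸ (smulPrime g w).asIdeal) := Finite.of_equiv _
    (Ideal.quotientEquiv w.asIdeal (smulPrime g w).asIdeal
      (MulSemiringAction.toRingEquiv Gal(L/K) B g) rfl).toEquiv
  obtain ⟨π, hπ⟩ := v.valuation_exists_uniformizer K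
  have h1 := valuation_smulPrime g w (algebraMap K L π)
  have h2 : g • algebraMap K L π = algebraMap K L π := g.commutes π
  rw [h2, valuation_algebraMap_eq_pow v, valuation_algebraMap_eq_pow v, hπ, ← exp_nsmul,
    ← exp_nsmul, exp_inj, nsmul_eq_mul, nsmul_eq_mul, mul_neg, mul_one, mul_neg, mul_one, neg_inj,
    Nat.cast_inj] at h1
  exact h1

variable [∀ w : HeightOneSpectrum B, Finite (B ⧸ w.asIdeal)]
  (hw : (w.asIdeal ^ 3).toAddSubgroup.inertia Gal(L/K) = ⊥)

include hw

/-- Weak ramification at one prime above `v` provides a normal basis generator of `I` modulo `v`: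
a generator of the completion at `w`, approximated by an element of `I` which is small at
the conjugates of `w`, generates modulo `v` after induction from the decomposition group. -/
theorem exists_generator_mod_smul {I : FractionalIdeal B⁰ L} (hI : I ≠ 0)
    (hst : ∀ (g : Gal(L/K)), ∀ x ∈ I, g • x ∈ I)
    (hc : ∃ c : ℤ, count L w I = 1 + wildIndex K L w * c) :
    ∃ x ∈ I, (I : Submodule B L).restrictScalars A ≤
      Submodule.span A (Set.range fun g : Gal(L/K) => g • x) ⊔
        v.asIdeal • (I : Submodule B L).restrictScalars A := by
  classical
  obtain ⟨c, hc⟩ := hc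
  set b := count L w I with hb
  set e := ramificationIndex K L w with he
  have hcount : ∀ g : Gal(L/K), count L (smulPrime g w) I = b := fun g =>
    count_smulPrime hI hst g w
  have hmemI := fun x => mem_iff_valuation_le hI (x := x)
  -- a generator at `w`, moved into `I`
  obtain ⟨z, hz, hgen⟩ := exists_generator_mod_stabilizer v w hw hc
  obtain ⟨s₀, hs₀, hs₀z⟩ := exists_valuation_eq_one_mul_mem hI w hz
  obtain ⟨r, hr⟩ := exists_algebraMap_sub_le w (x := (algebraMap B L s₀)⁻¹)
    (by rw [map_inv₀, hs₀, inv_one]) (-(e : ℤ))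
  set z' : L := algebraMap B L r * (algebraMap B L s₀ * z) with hz'
  have hz'I : z' ∈ I := by
    rw [hz', ← Algebra.smul_def]
    exact (I : Submodule B L).smul_mem r hs₀z
  have hz'z : w.valuation L (z' - z) ≤ exp (-(b + e)) := by
    have h0 : algebraMap B L s₀ ≠ 0 := by
      intro h
      rw [h, map_zero] at hs₀
      exact zero_ne_one hs₀
    have h1 : z' - z = (algebraMap B L r - (algebraMap B L s₀)⁻¹) * (algebraMap B L s₀ * z) := by
      rw [sub_mul, inv_mul_cancel_left₀ h0]
    rw [h1]
    refine (map_mul_le_exp hr (b := -b) ?_).trans (exp_le_exp.2 (by omega))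
    rwa [map_mul, hs₀, one_mul]
  obtain ⟨s, hs, hs'⟩ := exists_switch (L := L) (G := Gal(L/K)) w (-(e : ℤ)) e
  set x : L := algebraMap B L s * z' with hx
  have hsmulI : ∀ (t : B) {y : L}, y ∈ I → algebraMap B L t * y ∈ I := fun t y hy => by
    rw [← Algebra.smul_def]
    exact (I : Submodule B L).smul_mem t hy
  have hxI : x ∈ I := hsmulI s hz'I
  set N : Submodule A L := (I : Submodule B L).restrictScalars A with hN
  set U : Submodule A L := Submodule.span A (Set.range fun g : Gal(L/K) => g • x) ⊔
    v.asIdeal • N with hU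
  have hsA : ∀ (g : Gal(L/K)) (a : A) (y : L), g • a • y = a • g • y := fun g a y => by
    rw [← IsScalarTower.algebraMap_smul K a y, ← IsScalarTower.algebraMap_smul K a (g • y)]
    exact map_smul g _ _
  let ρ : Gal(L/K) → L →ₗ[A] L := fun g =>
    { toFun y := g • y
      map_add' := smul_add g
      map_smul' := hsA g }
  have hNst : ∀ g : Gal(L/K), N ≤ N.comap (ρ g) := fun g y hy => hst g y hy
  have hUst : ∀ g : Gal(L/K), U ≤ U.comap (ρ g) := by
    intro g
    refine sup_le (Submodule.span_le.2 ?_) (Submodule.smul_le.2 fun a ha y hy => ?_)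
    · rintro _ ⟨h, rfl⟩
      refine Submodule.mem_sup_left (Submodule.subset_span ⟨g * h, ?_⟩)
      exact mul_smul g h x
    · rw [Submodule.mem_comap, map_smul]
      exact Submodule.mem_sup_right (Submodule.smul_mem_smul ha (hNst g hy))
  have hUstab : ∀ (g : Gal(L/K)) {y : L}, y ∈ U → g • y ∈ U := fun g y hy => hUst g hy
  -- the ideal of multipliers of `I` into `U`
  let 𝔟 : Ideal B :=
    { carrier := {r | ∀ y ∈ I, algebraMap B L r * y ∈ U}
      add_mem' := fun {r r'} hr hr' y hy => by
        rw [map_add, add_mul]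
        exact add_mem (hr y hy) (hr' y hy)
      zero_mem' := fun y _ => by
        rw [map_zero, zero_mul]
        exact zero_mem _
      smul_mem' := fun t r hr y hy => by
        rw [smul_eq_mul, mul_comm t, map_mul, mul_assoc]
        exact hr _ (hsmulI t hy) }
  have h𝔟st : ∀ (g : Gal(L/K)), ∀ r ∈ 𝔟, g • r ∈ 𝔟 := by
    intro g r hr y hy
    have h1 := hUstab g (hr (g⁻¹ • y) (hst _ y hy))
    rwa [smul_mul', smul_inv_smul, smul_algebraMap] at h1
  have h𝔟v : ∀ a ∈ v.asIdeal, algebraMap A B a ∈ 𝔟 := by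
    intro a ha y hy
    rw [← IsScalarTower.algebraMap_apply, ← Algebra.smul_def]
    exact Submodule.mem_sup_right (Submodule.smul_mem_smul ha hy)
  -- `s y` is a combination of the conjugates of `x` under the decomposition group, up to an element
  -- which is divisible by `v` at `w` by the choice of `x`, and at the other primes because `s` is.
  have hs𝔟 : s ∈ 𝔟 := by
    intro y hy
    obtain ⟨a, ha⟩ := hgen y ((hmemI y).1 hy w)
    rw [← sub_add_cancel (algebraMap B L s * y) (∑ g, algebraMap A L (a g) * g • x)]
    refine add_mem (Submodule.mem_sup_right ?_) (Submodule.mem_sup_left (sum_mem fun g _ => ?_))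
    swap
    · rw [← Algebra.smul_def]
      exact Submodule.smul_mem _ _ (Submodule.subset_span ⟨(g : Gal(L/K)), rfl⟩)
    have hsumI : ∀ g, algebraMap A L (a g) * g • x ∈ I := fun g => by
      rw [IsScalarTower.algebraMap_apply A B L]
      exact hsmulI _ (hst g x hxI)
    refine mem_smul_of_valuation_le (K := K) v hI ((I : Submodule B L).sub_mem (hsmulI s hy)
      ((I : Submodule B L).sum_mem fun g _ => hsumI g)) fun w' hw' => ?_
    have := isGaloisGroup_integers (A := A) (K := K) (B := B) (L := L)
    obtain ⟨τ, hτ⟩ := Ideal.exists_smul_eq_of_isGaloisGroup v.asIdeal w.asIdeal w'.asIdeal Gal(L/K)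
    obtain rfl : smulPrime τ w = w' := HeightOneSpectrum.ext hτ
    rw [hcount, ramificationIndex_smulPrime v w, ← he]
    have ha1 : ∀ g, (smulPrime τ w).valuation L (algebraMap A L (a g)) ≤ 1 := fun g => by
      rw [IsScalarTower.algebraMap_apply A B L]
      exact valuation_le_one _ _
    by_cases hτw : τ ∈ MulAction.stabilizer Gal(L/K) w.asIdeal
    · have hτw' : smulPrime τ w = w := HeightOneSpectrum.ext hτw
      rw [hτw'] at ha1 ⊢
      have hs1 : ∀ m ∈ I, w.valuation L ((algebraMap B L s - 1) * m) ≤ exp (-(b + e)) :=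
        fun m hm => (map_mul_le_exp hs ((hmemI m).1 hm w)).trans (exp_le_exp.2 (by omega))
      have hzx : w.valuation L (z - x) ≤ exp (-(b + e)) := by
        rw [show z - x = -((z' - z) + (algebraMap B L s - 1) * z') by rw [hx]; ring,
          Valuation.map_neg]
        exact (w.valuation L).map_add_le hz'z (hs1 z' hz'I)
      have h1 : algebraMap B L s * y - ∑ g, algebraMap A L (a g) * g • x =
          (algebraMap B L s - 1) * y + (y - ∑ g, algebraMap A L (a g) * g • z) +
            ∑ g, algebraMap A L (a g) * g • (z - x) := by
        simp_rw [smul_sub, mul_sub, Finset.sum_sub_distrib]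
        ring
      rw [h1]
      refine (w.valuation L).map_add_le ((w.valuation L).map_add_le (hs1 y hy) ha)
        ((w.valuation L).map_sum_le fun g _ => ?_)
      rw [map_mul, valuation_stabilizer_smul]
      exact mul_le_of_le_one_of_le (ha1 g) hzx
    · have hsm : ∀ g : Gal(L/K), g ∉ MulAction.stabilizer Gal(L/K) w.asIdeal → ∀ m ∈ I,
          (smulPrime g w).valuation L (algebraMap B L s * m) ≤ exp (-(b + e)) := by
        intro g hg m hm
        have h1 := (hmemI m).1 hm (smulPrime g w)
        rw [hcount] at h1
        exact (map_mul_le_exp ((valuation_algebraMap_le_exp_iff _).2 (hs' g hg)) h1).trans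
          (exp_le_exp.2 (by omega))
      refine Valuation.map_sub_le _ (hsm τ hτw y hy) (Valuation.map_sum_le _ fun g _ => ?_)
      rw [map_mul]
      refine mul_le_of_le_one_of_le (ha1 g) ?_
      change (smulPrime τ w).valuation L ((g : Gal(L/K)) • x) ≤ _
      rw [valuation_smul]
      have h1 : smulPrime (g : Gal(L/K))⁻¹ (smulPrime τ w) = smulPrime ((g : Gal(L/K))⁻¹ * τ) w :=
        HeightOneSpectrum.ext (mul_smul _ _ _).symm
      rw [h1]
      refine hsm _ (fun h => hτw ?_) z' hz'I
      rwa [Subgroup.mul_mem_cancel_left _ (inv_mem g.2)] at h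
  have h𝔟 : 𝔟 = ⊤ := by
    by_contra hne
    obtain ⟨P, hP, hle⟩ := Ideal.exists_le_maximal _ hne
    have hPv : P.LiesOver v.asIdeal := ⟨v.isMaximal.eq_of_le (Ideal.IsPrime.ne_top inferInstance)
      fun a ha => hle (h𝔟v a ha)⟩
    have := isGaloisGroup_integers (A := A) (K := K) (B := B) (L := L)
    obtain ⟨τ, hτ⟩ := Ideal.exists_smul_eq_of_isGaloisGroup v.asIdeal w.asIdeal P Gal(L/K)
    have h1 := hle (h𝔟st τ s hs𝔟)
    rw [← hτ, Ideal.smul_mem_pointwise_smul_iff] at h1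
    refine (valuation_algebraMap_eq_one_iff (L := L) w).1 ?_ h1
    rw [← map_one (w.valuation L)]
    refine map_eq_of_sub_lt (hs.trans_lt ?_)
    have he1 : 0 < e := Nat.card_pos
    rw [map_one, ← exp_zero, exp_lt_exp]
    omega
  refine ⟨x, hxI, fun y hy => ?_⟩
  have h1 : (1 : B) ∈ 𝔟 := h𝔟 ▸ Submodule.mem_top
  have h2 := h1 y hy
  rwa [map_one, one_mul] at h2

end Generator

/-! ### Galois modules -/

section GaloisModule

open WithZero FractionalIdeal
open scoped Pointwise

section Module

variable {A K B L : Type*} [CommRing A] [Field K] [Field L] [Algebra K L] [Algebra A K]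
variable [Algebra A L] [IsScalarTower A K L] [CommRing B] [Algebra B L]

theorem asModuleEquiv_single_smul (g : Gal(L/K)) (a : A) (m : (galoisRep A K L).asModule) :
    (galoisRep A K L).asModuleEquiv (MonoidAlgebra.single g a • m) =
      a • g • (galoisRep A K L).asModuleEquiv m := by
  rw [Representation.asModuleEquiv_map_smul, Representation.asAlgebraHom_single]
  rfl

theorem asModuleEquiv_smul [Fintype Gal(L/K)] (r : A[Gal(L/K)]) (m : (galoisRep A K L).asModule) :
    (galoisRep A K L).asModuleEquiv (r • m) =
      ∑ g, r.coeff g • g • (galoisRep A K L).asModuleEquiv m := by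
  induction r using MonoidAlgebra.induction_linear with
  | zero => simp
  | add r s hr hs =>
    rw [add_smul, map_add, hr, hs, ← Finset.sum_add_distrib]
    exact Finset.sum_congr rfl fun g _ => (add_smul _ _ _).symm
  | single g a =>
    rw [asModuleEquiv_single_smul, Finset.sum_eq_single g]
    · simp
    · intro h _ hh
      simp [hh.symm]
    · simp

variable [Algebra A B] [IsScalarTower A B L]

variable (A K) in
/-- A fractional ideal which is stable under the Galois group, as a module over the group ring. -/
def galoisSubmodule [FiniteDimensional K L] (I : FractionalIdeal B⁰ L)
    (hst : ∀ (g : Gal(L/K)), ∀ x ∈ I, g • x ∈ I) :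
    Submodule A[Gal(L/K)] (galoisRep A K L).asModule where
  carrier := {m | (galoisRep A K L).asModuleEquiv m ∈ I}
  add_mem' hx hy := by
    rw [Set.mem_ofPred_eq, map_add]
    exact (I : Submodule B L).add_mem hx hy
  zero_mem' := by
    rw [Set.mem_ofPred_eq, map_zero]
    exact (I : Submodule B L).zero_mem
  smul_mem' r m hm := by
    have : Fintype Gal(L/K) := Fintype.ofFinite _
    rw [Set.mem_ofPred_eq, asModuleEquiv_smul]
    exact ((I : Submodule B L).restrictScalars A).sum_mem fun g _ =>
      Submodule.smul_mem _ _ (hst g _ hm)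

end Module

variable {A K B L : Type*} [CommRing A] [IsDedekindDomain A] [Field K] [Algebra A K]
  [IsFractionRing A K] [CommRing B] [IsDedekindDomain B] [Field L] [Algebra B L]
  [IsFractionRing B L] [Algebra K L] [FiniteDimensional K L] [IsGalois K L] [Algebra A B]
  [Algebra A L] [IsScalarTower A K L] [IsScalarTower A B L]
  [Module.IsTorsionFree A B] [Module.Finite A B]
  [MulSemiringAction Gal(L/K) B] [SMulDistribClass Gal(L/K) B L]

section Local

variable (v : HeightOneSpectrum A)

omit [IsDedekindDomain A] [Algebra A K] [IsFractionRing A K] [FiniteDimensional K L] [IsGalois K L]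
  [IsScalarTower A K L] [Module.IsTorsionFree A B] [MulSemiringAction Gal(L/K) B]
  [SMulDistribClass Gal(L/K) B L] in
/-- Nakayama's lemma: a generator modulo `v` generates after multiplication by an element prime to
`v`. -/
theorem exists_notMem_smul_mem_span {I : FractionalIdeal B⁰ L} {x : L}
    (hx : (I : Submodule B L).restrictScalars A ≤
      Submodule.span A (Set.range fun g : Gal(L/K) => g • x) ⊔
        v.asIdeal • (I : Submodule B L).restrictScalars A) :
    ∃ s ∉ v.asIdeal, ∀ y ∈ I, s • y ∈ Submodule.span A (Set.range fun g : Gal(L/K) => g • x) := by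
  have hfg : ((I : Submodule B L).restrictScalars A).FG :=
    Submodule.FG.restrictScalars (Module.Finite.iff_fg.1
      (@Module.IsNoetherian.finite _ _ _ _ _ (FractionalIdeal.isNoetherian I)))
  obtain ⟨r, hr, hr'⟩ := Submodule.exists_sub_one_mem_and_smul_le_of_fg_of_le_sup hfg le_rfl hx
  refine ⟨r, fun h => ?_, fun y hy => hr' (Submodule.smul_mem_pointwise_smul _ _ _ hy)⟩
  have h1 := v.asIdeal.sub_mem h hr
  rw [sub_sub_cancel] at h1
  exact v.isPrime.ne_top ((Ideal.eq_top_iff_one _).2 h1)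

omit [Module.IsTorsionFree A B] [Module.Finite A B] [MulSemiringAction Gal(L/K) B]
  [SMulDistribClass Gal(L/K) B L] in
/-- If the conjugates of `x` span `I` up to multiplication by `s`, they span `L` over `K`, and there
are as many of them as the degree. -/
theorem linearIndependent_of_smul_mem_span {I : FractionalIdeal B⁰ L} (hI : I ≠ 0) {x : L}
    {s : A} (hs : s ≠ 0)
    (hx : ∀ y ∈ I, s • y ∈ Submodule.span A (Set.range fun g : Gal(L/K) => g • x)) :
    LinearIndependent A fun g : Gal(L/K) => g • x := by
  have : Fintype Gal(L/K) := Fintype.ofFinite _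
  have h1 : LinearIndependent K fun g : Gal(L/K) => g • x := by
    refine linearIndependent_of_top_le_span_of_card_eq_finrank (fun z _ => ?_) ?_
    · obtain ⟨y, hy0, hy⟩ := exists_ne_zero_mem_isInteger hI
      have : Algebra.IsAlgebraic A L :=
        (IsFractionRing.comap_isAlgebraic_iff (A := A) (K := K) (C := L)).2 inferInstance
      obtain ⟨a, ha, haz⟩ := (Algebra.IsAlgebraic.isAlgebraic (R := A)
        (z / algebraMap B L y)).exists_integral_multiple
      obtain ⟨r, hr⟩ := IsIntegrallyClosed.isIntegral_iff.1 (haz.tower_top (A := B))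
      have hy0' : algebraMap B L y ≠ 0 := by simpa using hy0
      have h2 : a • z = r • algebraMap B L y := by
        rw [Algebra.smul_def r, hr, smul_mul_assoc, div_mul_cancel₀ _ hy0']
      have h3 := hx (a • z) (h2 ▸ (I : Submodule B L).smul_mem r hy)
      have h4 := Submodule.span_le_restrictScalars A K (Set.range fun g : Gal(L/K) => g • x) h3
      rw [Submodule.restrictScalars_mem, smul_smul, ← IsScalarTower.algebraMap_smul K] at h4
      exact (Submodule.smul_mem_iff _ (by simpa using ⟨hs, ha⟩)).1 h4
    · rw [← Nat.card_eq_fintype_card, IsGalois.card_aut_eq_finrank]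
  exact h1.restrict_scalars' A

variable {I : FractionalIdeal B⁰ L} (hst : ∀ (g : Gal(L/K)), ∀ x ∈ I, g • x ∈ I)

omit [Module.IsTorsionFree A B] [Module.Finite A B] [MulSemiringAction Gal(L/K) B]
  [SMulDistribClass Gal(L/K) B L] in
/-- A generator of `I` up to multiplication by `s` embeds the group ring into `I`, with image
containing `s I`. -/
theorem exists_injective_and_smul_mem_range (hI : I ≠ 0) {x : L} (hxI : x ∈ I) {s : A} (hs : s ≠ 0)
    (hx : ∀ y ∈ I, s • y ∈ Submodule.span A (Set.range fun g : Gal(L/K) => g • x)) :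
    ∃ m : galoisSubmodule A K I hst,
      Function.Injective (LinearMap.toSpanSingleton A[Gal(L/K)] (galoisSubmodule A K I hst) m) ∧
      ∀ y, algebraMap A A[Gal(L/K)] s • y ∈
        (LinearMap.toSpanSingleton A[Gal(L/K)] (galoisSubmodule A K I hst) m).range := by
  have : Fintype Gal(L/K) := Fintype.ofFinite _
  obtain ⟨m, hm⟩ : ∃ m : galoisSubmodule A K I hst,
      (galoisRep A K L).asModuleEquiv (m : (galoisRep A K L).asModule) = x :=
    ⟨⟨(galoisRep A K L).asModuleEquiv.symm x, hxI⟩, rfl⟩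
  refine ⟨m, ?_, fun y => ?_⟩
  · refine (injective_iff_map_eq_zero _).2 fun r hr => ?_
    have h1 := congrArg (fun m : galoisSubmodule A K I hst =>
      (galoisRep A K L).asModuleEquiv (m : (galoisRep A K L).asModule)) hr
    simp only [LinearMap.toSpanSingleton_apply, Submodule.coe_smul, asModuleEquiv_smul,
      hm, Submodule.coe_zero, map_zero] at h1
    have h2 := Fintype.linearIndependent_iff.1
      (linearIndependent_of_smul_mem_span (K := K) hI hs hx) _ h1
    exact MonoidAlgebra.ext (Finsupp.ext h2)
  · obtain ⟨c, hc⟩ := (Submodule.mem_span_range_iff_exists_fun A).1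
      (hx ((galoisRep A K L).asModuleEquiv y) y.2)
    refine ⟨∑ g, MonoidAlgebra.single g (c g), Subtype.ext
      ((galoisRep A K L).asModuleEquiv.injective ?_)⟩
    have h1 : algebraMap A A[Gal(L/K)] s = MonoidAlgebra.single 1 s := rfl
    rw [LinearMap.toSpanSingleton_apply, Submodule.coe_smul, Submodule.coe_smul, h1,
      asModuleEquiv_single_smul, one_smul, Finset.sum_smul, map_sum, ← hc]
    exact Finset.sum_congr rfl fun g _ => by
      rw [asModuleEquiv_single_smul, hm]

include hst

omit [Module.IsTorsionFree A B] [MulSemiringAction Gal(L/K) B] [SMulDistribClass Gal(L/K) B L] in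
/-- If `I` has a generator modulo every prime of the base, it is projective: at each prime, the
group ring embeds into `I` with a cokernel killed by some `s` outside of the prime, and dividing
`s I` by this embedding gives the factorization of `projective_of_forall_isMaximal`. -/
theorem isProjectiveGaloisModule_of_generator_mod (hA : ¬ IsField A) (hI : I ≠ 0)
    (h : ∀ v : HeightOneSpectrum A, ∃ x ∈ I, (I : Submodule B L).restrictScalars A ≤
      Submodule.span A (Set.range fun g : Gal(L/K) => g • x) ⊔
        v.asIdeal • (I : Submodule B L).restrictScalars A) :
    IsProjectiveGaloisModule A K I := by
  refine ⟨galoisSubmodule A K I hst, fun x => Iff.rfl, projective_of_forall_isMaximal (A := A) ?_⟩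
  intro P hP
  let v : HeightOneSpectrum A := ⟨P, hP.isPrime, Ring.ne_bot_of_isMaximal_of_not_isField hP hA⟩
  obtain ⟨x, hxI, hx⟩ := h v
  obtain ⟨s, hs, hsx⟩ := exists_notMem_smul_mem_span v hx
  have hs0 : s ≠ 0 := fun h => hs (h ▸ zero_mem _)
  obtain ⟨m, hinj, hm⟩ := exists_injective_and_smul_mem_range hst hI hxI hs0 hsx
  set f := LinearMap.toSpanSingleton A[Gal(L/K)] (galoisSubmodule A K I hst) m with hf
  let φ : galoisSubmodule A K I hst →ₗ[A[Gal(L/K)]] galoisSubmodule A K I hst :=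
    { toFun y := algebraMap A A[Gal(L/K)] s • y
      map_add' := smul_add _
      map_smul' r y := by rw [smul_smul, Algebra.commutes, mul_smul, RingHom.id_apply] }
  refine ⟨s, hs, m, (LinearEquiv.ofInjective f hinj).symm.toLinearMap ∘ₗ φ.codRestrict f.range hm,
    fun y => ?_⟩
  exact congrArg Subtype.val
    ((LinearEquiv.ofInjective f hinj).apply_symm_apply (φ.codRestrict f.range hm y))

omit [Module.IsTorsionFree A B] [MulSemiringAction Gal(L/K) B] [SMulDistribClass Gal(L/K) B L] in
/-- Over a local base, a generator of `I` modulo the maximal ideal is a basis of `I` over the group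
ring. -/
theorem isFreeGaloisModule_of_generator_mod [IsLocalRing A] {v : HeightOneSpectrum A} (hI : I ≠ 0)
    {x : L} (hxI : x ∈ I) (hx : (I : Submodule B L).restrictScalars A ≤
      Submodule.span A (Set.range fun g : Gal(L/K) => g • x) ⊔
        v.asIdeal • (I : Submodule B L).restrictScalars A) :
    IsFreeGaloisModule A K I := by
  obtain ⟨s, hs, hsx⟩ := exists_notMem_smul_mem_span v hx
  have hs0 : s ≠ 0 := fun h => hs (h ▸ zero_mem _)
  obtain ⟨m, hinj, hm⟩ := exists_injective_and_smul_mem_range hst hI hxI hs0 hsx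
  rw [IsLocalRing.eq_maximalIdeal v.isMaximal, IsLocalRing.notMem_maximalIdeal] at hs
  refine ⟨galoisSubmodule A K I hst, fun x => Iff.rfl, Module.Free.of_equiv
    (LinearEquiv.ofBijective _ ⟨hinj, fun y => ?_⟩)⟩
  have h1 := hm (algebraMap A A[Gal(L/K)] (hs.unit⁻¹ : Aˣ) • y)
  rw [smul_smul, ← map_mul, IsUnit.mul_val_inv, map_one, one_smul] at h1
  exact h1

end Local

section Converse

variable (w : HeightOneSpectrum B)

omit [IsDedekindDomain A] [IsFractionRing A K] [IsGalois K L] [Algebra A B] [IsScalarTower A B L]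
  [Module.IsTorsionFree A B] [Module.Finite A B] in
/-- If `I` is projective, then the elements of `I` fixed by `σ` are traces; an element fixed by a
nontrivial `σ` in the second ramification group at `w` can be chosen not to be the trace of an
element of `I`. -/
theorem inertia_eq_bot_of_isProjectiveGaloisModule {I : FractionalIdeal B⁰ L} (hI : I ≠ 0)
    (h : IsProjectiveGaloisModule A K I) :
    (w.asIdeal ^ 3).toAddSubgroup.inertia Gal(L/K) = ⊥ := by
  classical
  obtain ⟨M, hM, hproj⟩ := h
  refine (Subgroup.eq_bot_iff_forall _).2 fun τ hτ => ?_
  by_contra hτ1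
  -- an element of prime order
  set n := (orderOf τ).minFac with hn
  have hnp : Fact n.Prime := ⟨Nat.minFac_prime (by rwa [Ne, orderOf_eq_one_iff])⟩
  obtain ⟨k, hk⟩ := Nat.minFac_dvd (orderOf τ)
  set σ := τ ^ k with hσ
  have hσn : orderOf σ = n := by
    rw [hσ, orderOf_pow_of_dvd (by rintro rfl; exact (orderOf_pos τ).ne' (by simpa using hk))
      ⟨n, by rw [mul_comm]; exact hk⟩]
    exact Nat.div_eq_of_eq_mul_left (Nat.pos_of_ne_zero (by
      rintro rfl; exact (orderOf_pos τ).ne' (by simpa using hk))) hk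
  have hσi : σ ∈ (w.asIdeal ^ 3).toAddSubgroup.inertia Gal(L/K) := Subgroup.pow_mem _ hτ k
  have hσ0 : σ ∈ MulAction.stabilizer Gal(L/K) w.asIdeal :=
    Ideal.inertia_le_stabilizer w.asIdeal fun x => Ideal.pow_le_self three_ne_zero (hσi x)
  set σ' : MulAction.stabilizer Gal(L/K) w.asIdeal := ⟨σ, hσ0⟩ with hσ'
  have hσ'2 : σ' ∈ ramificationGroup (valuation_stabilizer_smul (L := L) w) 2 :=
    (mem_ramificationGroup_stabilizer_iff w).2 hσi
  have hσ'n : σ' ^ n = 1 := Subtype.ext (by rw [← hσn]; exact pow_orderOf_eq_one σ)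
  obtain ⟨y, hy⟩ : ∃ y : L, σ' • y ≠ y := by
    by_contra! hall
    have : σ = 1 := AlgEquiv.ext hall
    rw [this, orderOf_one] at hσn
    exact hnp.out.one_lt.ne hσn
  -- an element of `I` fixed by `σ`
  set b := count L w I with hb
  obtain ⟨c, hbc, hcb⟩ : ∃ c : ℤ, b ≤ n * c ∧ n * c ≤ b + n - 1 := by
    have hn0 : (0 : ℤ) < n := by exact_mod_cast hnp.out.pos
    refine ⟨(b + n - 1) / n, ?_, Int.mul_ediv_self_le hn0.ne'⟩
    have := Int.lt_mul_ediv_self_add (x := b + n - 1) hn0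
    omega
  obtain ⟨π, hπ⟩ := w.valuation_exists_uniformizer L
  have hπ0 : π ≠ 0 := (Valuation.ne_zero_iff (w.valuation L)).1 (by rw [hπ]; exact exp_ne_zero)
  have hfix : ∀ u : L, σ • ∏ j ∈ Finset.range n, σ ^ j • u = ∏ j ∈ Finset.range n, σ ^ j • u := by
    intro u
    have h1 : ∏ j ∈ Finset.range n, σ ^ (j + 1) • u = ∏ j ∈ Finset.range n, σ ^ j • u := by
      rcases eq_or_ne u 0 with rfl | hu
      · simp
      have h2 := Finset.prod_range_succ' (fun j => σ ^ j • u) n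
      have h3 : σ ^ n = 1 := hσn ▸ pow_orderOf_eq_one σ
      rw [Finset.prod_range_succ, h3, pow_zero, one_smul] at h2
      exact (mul_right_cancel₀ hu h2).symm
    rw [Finset.smul_prod']
    rw [← h1]
    exact Finset.prod_congr rfl fun j _ => by rw [pow_succ', mul_smul]
  have hval : ∀ (j : ℕ) (u : L), w.valuation L (σ ^ j • u) = w.valuation L u := fun j u =>
    valuation_stabilizer_smul w (σ' ^ j) u
  -- Norms from `L` to the field fixed by `σ` are fixed: that of a power of `π` has the right
  -- valuation at `w`, and that of `s` is a unit at `w` and moves it into `I`.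
  set z₀ : L := (∏ j ∈ Finset.range n, σ ^ j • π) ^ c with hz₀
  have hz₀v : w.valuation L z₀ = exp (-(n * c)) := by
    rw [hz₀, map_zpow₀, map_prod, Finset.prod_congr rfl fun j _ => (hval j π).trans hπ,
      Finset.prod_const, Finset.card_range, ← exp_nsmul, ← exp_zsmul]
    congr 1
    simp only [nsmul_eq_mul, zsmul_eq_mul, Int.cast_id]
    ring
  obtain ⟨s, hs, hsz⟩ := exists_valuation_eq_one_mul_mem hI w (z := z₀)
    (by rw [hz₀v, exp_le_exp]; omega)
  set z : L := (∏ j ∈ Finset.range n, σ ^ j • algebraMap B L s) * z₀ with hz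
  have hzv : w.valuation L z = exp (-(n * c)) := by
    rw [hz, map_mul, map_prod, Finset.prod_congr rfl fun j _ => (hval j _).trans hs,
      Finset.prod_const_one, one_mul, hz₀v]
  have hzσ : σ • z = z := by
    rw [hz, smul_mul', hfix, hz₀, smul_zpow₀', hfix]
  have hzI : z ∈ I := by
    obtain ⟨n', hn'⟩ := Nat.exists_eq_succ_of_ne_zero hnp.out.ne_zero
    rw [hz, hn', Finset.prod_range_succ', pow_zero, one_smul, mul_assoc]
    have h1 : ∏ j ∈ Finset.range n', σ ^ (j + 1) • algebraMap B L s =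
        algebraMap B L (∏ j ∈ Finset.range n', σ ^ (j + 1) • s) := by
      rw [map_prod]
      exact Finset.prod_congr rfl fun j _ => smul_algebraMap _ _
    rw [h1, ← Algebra.smul_def]
    exact (I : Submodule B L).smul_mem _ hsz
  -- its preimage under the trace
  obtain ⟨x, hx⟩ := exists_sum_pow_smul_eq (A := A) (M := M) σ
    (z := ⟨(galoisRep A K L).asModuleEquiv.symm z, (hM z).2 hzI⟩)
    (Subtype.ext ((galoisRep A K L).asModuleEquiv.injective (by
      rw [Submodule.coe_smul, asModuleEquiv_single_smul, LinearEquiv.apply_symm_apply, one_smul,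
        hzσ])))
  have hxI : (galoisRep A K L).asModuleEquiv (x : (galoisRep A K L).asModule) ∈ I := by
    rw [← hM, LinearEquiv.symm_apply_apply]
    exact x.2
  refine not_exists_trace_eq (valuation_stabilizer_smul w) hπ hσ'2 hσ'n hy hcb hzv
    ((mem_iff_valuation_le hI).1 hxI w) ?_
  have h1 := congrArg (fun m : M => (galoisRep A K L).asModuleEquiv
    (m : (galoisRep A K L).asModule)) hx
  simp only [AddSubmonoidClass.coe_finsetSum, map_sum, Submodule.coe_smul,
    asModuleEquiv_single_smul, one_smul, LinearEquiv.apply_symm_apply] at h1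
  rw [← h1, hσn]
  rfl

end Converse

end GaloisModule

/-! ### Topology of the completions -/

section Topology

open WithZero Topology

/-- Every neighbourhood of `0` contains a ball, also when the valuation is not surjective. -/
theorem exists_setOf_valued_le_subset {R : Type*} [Ring R] [Valued R (WithZero (Multiplicative ℤ))]
    {s : Set R} (hs : s ∈ 𝓝 (0 : R)) : ∃ n : ℤ, {y | Valued.v y ≤ exp n} ⊆ s := by
  obtain ⟨γ, hγ⟩ := Valued.mem_nhds_zero.1 hs
  have h0 : MonoidWithZeroHom.ValueGroup₀.embedding γ.1 ≠ 0 := by simp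
  refine ⟨log (MonoidWithZeroHom.ValueGroup₀.embedding γ.1) - 1, fun y hy => hγ ?_⟩
  rw [Set.mem_ofPred_eq, Valuation.restrict_lt_iff_lt_embedding]
  refine lt_of_le_of_lt hy ?_
  conv_rhs => rw [← exp_log h0]
  rw [exp_lt_exp]
  omega

variable {B L : Type*} [CommRing B] [IsDedekindDomain B] [Field L] [Algebra B L]
  [IsFractionRing B L] (w : HeightOneSpectrum B)

theorem valued_algebraMap (x : L) :
    Valued.v (algebraMap L (w.adicCompletion L) x) = w.valuation L x :=
  valuedAdicCompletion_eq_valuation' w x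

theorem setOf_valued_sub_le_mem_nhds (x : w.adicCompletion L) (n : ℤ) :
    {y : w.adicCompletion L | Valued.v (y - x) ≤ exp n} ∈ 𝓝 x := by
  obtain ⟨c, hc⟩ := w.valuedAdicCompletion_surjective L (exp n)
  have h1 : IsOpen {y : w.adicCompletion L | Valued.v y ≤ exp n} := by
    have h2 := Valued.isOpen_closedBall (w.adicCompletion L) (r := Valued.v.restrict c) (by
      rw [Ne, Valuation.restrict_eq_zero_iff, hc]
      exact exp_ne_zero)
    simp_rw [Valuation.restrict_le_iff, hc] at h2
    exact h2
  refine (h1.preimage (continuous_sub_right x)).mem_nhds ?_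
  rw [Set.mem_preimage, sub_self]
  simp

/-- Elements of the completion can be approximated by elements of the field. -/
theorem exists_valued_algebraMap_sub_le (x : w.adicCompletion L) {s : Set (w.adicCompletion L)}
    (hs : s ∈ 𝓝 x) (n : ℤ) : ∃ y : L, Valued.v (algebraMap L (w.adicCompletion L) y - x) ≤ exp n ∧
      algebraMap L (w.adicCompletion L) y ∈ s := by
  obtain ⟨y, hy⟩ := (denseRange_algebraMap L w).exists_mem_open isOpen_interior
    ⟨x, mem_interior_iff_mem_nhds.2 (Filter.inter_mem (setOf_valued_sub_le_mem_nhds w x n) hs)⟩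
  exact ⟨y, (interior_subset hy).1, (interior_subset hy).2⟩

/-- Valuations are locally constant away from `0`, so that a ring homomorphism which raises the
valuations of elements of `L` to the `e`-th power does so on the completion. -/
theorem valued_map_eq_pow {F : Type*} [Field F] [Valued F (WithZero (Multiplicative ℤ))]
    {f : w.adicCompletion L →+* F} (hf : Continuous f) {e : ℕ} (he : e ≠ 0)
    (h : ∀ x : L, Valued.v (f (algebraMap L _ x)) = w.valuation L x ^ e) (x : w.adicCompletion L) :
    Valued.v (f x) = Valued.v x ^ e := by
  rcases eq_or_ne x 0 with rfl | hx
  · simp [he]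
  obtain ⟨n, hn⟩ := exists_eq_exp (v := (Valued.v : Valuation (w.adicCompletion L) _)) hx
  have hs : {y | Valued.v (f y) = Valued.v (f x)} ∈ 𝓝 x :=
    hf.continuousAt.preimage_mem_nhds (Valued.locally_const (by simpa using hx))
  obtain ⟨y, hy, hy'⟩ := exists_valued_algebraMap_sub_le w x hs (n - 1)
  have h1 : Valued.v (algebraMap L (w.adicCompletion L) y) = Valued.v x := by
    refine map_eq_of_sub_lt (hy.trans_lt ?_)
    rw [hn, exp_lt_exp]
    omega
  rw [← h1, valued_algebraMap, ← h]
  exact hy'.symm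

end Topology

/-! ### The action of the decomposition group on the completion -/

section CompletedAction

open WithZero Topology
open scoped Pointwise

variable {B L G : Type*} [CommRing B] [IsDedekindDomain B] [Field L] [Algebra B L]
  [IsFractionRing B L] [Group G] [MulSemiringAction G B] [MulSemiringAction G L]
  [SMulDistribClass G B L] (w : HeightOneSpectrum B) (g : MulAction.stabilizer G w.asIdeal)

theorem continuous_withVal_smul : Continuous (WithVal.map (w.valuation L) (w.valuation L)
    (MulSemiringAction.toRingHom _ L g)) := by
  refine continuous_of_continuousAt_zero _ ?_
  rw [ContinuousAt, map_zero]
  intro s hs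
  obtain ⟨γ, hγ⟩ := Valued.mem_nhds_zero.1 hs
  refine Valued.mem_nhds_zero.2 ⟨γ, fun y hy => hγ ?_⟩
  rw [Set.mem_ofPred_eq, Valuation.restrict_lt_iff_lt_embedding] at hy ⊢
  refine lt_of_eq_of_lt ?_ hy
  exact valuation_stabilizer_smul w g y.ofVal

variable (L) in
/-- The continuous extension to the completion of an element of the decomposition group. -/
def completionSMul : w.adicCompletion L →+* w.adicCompletion L :=
  ((adicCompletion.equiv L w).symm.toRingHom.comp
    (UniformSpace.Completion.mapRingHom _ (continuous_withVal_smul (L := L) w g))).comp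
    (adicCompletion.equiv L w).toRingHom

theorem continuous_completionSMul : Continuous (completionSMul L w g) :=
  (adicCompletion.continuous_ofCompletion L w).comp <|
    UniformSpace.Completion.continuous_map.comp (adicCompletion.continuous_toCompletion L w)

theorem completionSMul_algebraMap (x : L) :
    completionSMul L w g (algebraMap L (w.adicCompletion L) x) =
      algebraMap L (w.adicCompletion L) (g • x) := by
  apply adicCompletion.ext
  exact UniformSpace.Completion.mapRingHom_coe (continuous_withVal_smul (L := L) w g) _

/-- The action of the decomposition group on the completion. -/
instance completionAction :
    MulSemiringAction (MulAction.stabilizer G w.asIdeal) (w.adicCompletion L) where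
  smul g x := completionSMul L w g x
  one_smul := by
    refine fun x => congrFun ((denseRange_algebraMap L w).equalizer
      (continuous_completionSMul w 1) continuous_id (funext fun y => ?_)) x
    exact (completionSMul_algebraMap w 1 y).trans (by rw [one_smul]; rfl)
  mul_smul g h := by
    refine fun x => congrFun ((denseRange_algebraMap L w).equalizer
      (continuous_completionSMul w (g * h))
      ((continuous_completionSMul w g).comp (continuous_completionSMul w h))
      (funext fun y => ?_)) x
    simp only [Function.comp_apply, completionSMul_algebraMap, mul_smul]
  smul_zero g := map_zero (completionSMul L w g)
  smul_add g := map_add (completionSMul L w g)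
  smul_one g := map_one (completionSMul L w g)
  smul_mul g := map_mul (completionSMul L w g)

theorem completion_smul_algebraMap (x : L) : g • algebraMap L (w.adicCompletion L) x =
    algebraMap L (w.adicCompletion L) (g • x) :=
  completionSMul_algebraMap w g x

theorem valued_completion_smul (x : w.adicCompletion L) : Valued.v (g • x) = Valued.v x := by
  have h := valued_map_eq_pow w (continuous_completionSMul (L := L) w g) one_ne_zero
    (fun x => ?_) x
  · rwa [pow_one] at h
  · rw [completionSMul_algebraMap, valued_algebraMap, valuation_stabilizer_smul, pow_one]

/-- The action of the decomposition group on the ring of integers of the completion. -/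
instance completionIntegersAction :
    MulSemiringAction (MulAction.stabilizer G w.asIdeal) (w.adicCompletionIntegers L) where
  smul g x := ⟨g • (x : w.adicCompletion L), by
    rw [mem_adicCompletionIntegers, valued_completion_smul]
    exact x.2⟩
  one_smul x := Subtype.ext (one_smul _ (x : w.adicCompletion L))
  mul_smul g h x := Subtype.ext (mul_smul g h (x : w.adicCompletion L))
  smul_zero g := Subtype.ext (smul_zero g)
  smul_add g x y := Subtype.ext (smul_add g (x : w.adicCompletion L) y)
  smul_one g := Subtype.ext (smul_one g)
  smul_mul g x y := Subtype.ext (smul_mul' g (x : w.adicCompletion L) y)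

end CompletedAction

/-! ### The extension of completions -/

section LocalExtension

open WithZero Topology
open scoped Pointwise

variable {K L : Type*} [Field K] [NumberField K] [Field L] [NumberField L] [Algebra K L]
  (v : HeightOneSpectrum (𝓞 K)) (w : HeightOneSpectrum (𝓞 L)) [w.asIdeal.LiesOver v.asIdeal]

theorem algebraMap_completion_algebraMap (x : K) :
    algebraMap (v.adicCompletion K) (w.adicCompletion L) (algebraMap K _ x) =
      algebraMap L _ (algebraMap K L x) :=
  completionMap_algebraMap v w x

variable [IsGalois K L]

theorem valued_algebraMap_completion (x : v.adicCompletion K) :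
    Valued.v (algebraMap (v.adicCompletion K) (w.adicCompletion L) x) =
      Valued.v x ^ ramificationIndex K L w := by
  refine valued_map_eq_pow v (continuous_completionMap v w) Nat.card_pos.ne' (fun x => ?_) x
  rw [completionMap_algebraMap, valued_algebraMap]
  exact valuation_algebraMap_eq_pow v w x

/-- `K_v` is complete for the topology induced by `L_w`, since the valuation of `L_w` restricts to a
power of that of `K_v`. Hence it is closed. -/
theorem isClosed_range_algebraMap_completion :
    IsClosed (Set.range (algebraMap (v.adicCompletion K) (w.adicCompletion L))) := by
  have hind : IsInducing (algebraMap (v.adicCompletion K) (w.adicCompletion L)) := by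
    refine IsTopologicalAddGroup.isInducing_iff_nhds_zero.2 (le_antisymm ?_ ?_)
    · exact ((continuous_completionMap v w).tendsto' 0 0 (map_zero _)).le_comap
    · intro s hs
      obtain ⟨n, hn⟩ := exists_setOf_valued_le_subset hs
      refine ⟨_, setOf_valued_sub_le_mem_nhds w 0 (ramificationIndex K L w * n), fun y hy => hn ?_⟩
      rw [Set.mem_preimage, Set.mem_ofPred_eq, sub_zero, valued_algebraMap_completion] at hy
      rw [Set.mem_ofPred_eq]
      by_contra! h
      rcases eq_or_ne y 0 with rfl | hy0
      · simp at h
      obtain ⟨m, hm⟩ := exists_eq_exp (v := (Valued.v : Valuation (v.adicCompletion K) _)) hy0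
      rw [hm, exp_lt_exp] at h
      rw [hm, ← exp_nsmul, exp_le_exp, nsmul_eq_mul] at hy
      have he : 0 < ramificationIndex K L w := Nat.card_pos
      exact absurd hy (not_le.2 (mul_lt_mul_of_pos_left h (by exact_mod_cast he)))
  exact (AddMonoidHom.isUniformInducing_of_isInducing hind).isComplete_range.isClosed

/-- An element of the completion fixed by the decomposition group is a limit of traces from `L` to
`K` of elements which are small at the other primes above `v`. -/
theorem mem_range_algebraMap_completion {x : w.adicCompletion L}
    (hx : ∀ g : MulAction.stabilizer Gal(L/K) w.asIdeal, g • x = x) :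
    x ∈ Set.range (algebraMap (v.adicCompletion K) (w.adicCompletion L)) := by
  classical
  rw [← (isClosed_range_algebraMap_completion v w).closure_eq, mem_closure_iff_nhds]
  intro t ht
  obtain ⟨n, hn⟩ : ∃ n : ℤ, {y | Valued.v (y - x) ≤ exp n} ⊆ t := by
    have h0 : (fun y => y + x) ⁻¹' t ∈ 𝓝 (0 : w.adicCompletion L) :=
      (continuous_add_const x).continuousAt.preimage_mem_nhds (by rwa [zero_add])
    obtain ⟨n, hn⟩ := exists_setOf_valued_le_subset h0
    refine ⟨n, fun y hy => ?_⟩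
    have := hn hy
    rwa [Set.mem_preimage, sub_add_cancel] at this
  set d : ℕ := Fintype.card (MulAction.stabilizer Gal(L/K) w.asIdeal) with hd
  have hd0 : (d : w.adicCompletion L) ≠ 0 := by
    rw [← map_natCast (algebraMap L (w.adicCompletion L)), Ne,
      map_eq_zero_iff _ (RingHom.injective _)]
    exact_mod_cast Fintype.card_ne_zero
  obtain ⟨y, hy, -⟩ :=
    exists_valued_algebraMap_sub_le w (x / (d : w.adicCompletion L)) Filter.univ_mem n
  -- The approximation `y` of `x / d` is made small at the other primes above `v`, so that the terms
  -- of its trace outside of the decomposition group do not matter, and the others sum up to about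
  -- `x`.
  obtain ⟨m, hm⟩ : ∃ m : ℕ, ∀ g : Gal(L/K),
      exp (-(m : ℤ)) * (smulPrime g w).valuation L y ≤ exp n := by
    rcases eq_or_ne y 0 with rfl | hy0
    · exact ⟨0, by simp⟩
    choose a ha using fun g : Gal(L/K) => exists_eq_exp (v := (smulPrime g w).valuation L) hy0
    refine ⟨Finset.univ.sup fun g => (a g - n).toNat, fun g => ?_⟩
    rw [ha, ← exp_add, exp_le_exp]
    have := Finset.le_sup (f := fun g => (a g - n).toNat) (Finset.mem_univ g)
    have := Int.self_le_toNat (a g - n)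
    omega
  obtain ⟨s, hs, hs'⟩ := exists_switch (L := L) (G := Gal(L/K)) w (-(m : ℤ)) m
  set z : L := algebraMap (𝓞 L) L s * y with hz
  have hzx :
      Valued.v (algebraMap L (w.adicCompletion L) z - x / (d : w.adicCompletion L)) ≤ exp n := by
    refine map_sub_le_of_sub_le ?_ hy
    rw [← map_sub, valued_algebraMap, hz, ← sub_one_mul, map_mul]
    have h1 := hm 1
    rw [show smulPrime (1 : Gal(L/K)) w = w from HeightOneSpectrum.ext (one_smul _ _)] at h1
    exact (mul_le_mul_left hs _).trans h1
  refine ⟨algebraMap L _ (algebraMap K L (Algebra.trace K L z)), hn ?_,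
    ⟨_, algebraMap_completion_algebraMap v w _⟩⟩
  rw [trace_eq_sum_automorphisms, ← Finset.sum_filter_add_sum_filter_not Finset.univ
    (fun g => g ∈ MulAction.stabilizer Gal(L/K) w.asIdeal), map_add, Set.mem_ofPred_eq,
    add_sub_right_comm]
  refine Valuation.map_add_le _ ?_ ?_
  · have h1 : x = ∑ g : MulAction.stabilizer Gal(L/K) w.asIdeal,
        g • (x / (d : w.adicCompletion L)) := by
      have h2 : ∀ g : MulAction.stabilizer Gal(L/K) w.asIdeal,
          g • (x / (d : w.adicCompletion L)) = x / d := fun g => by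
        rw [smul_div₀', hx]
        exact congrArg (x / ·) (map_natCast (MulSemiringAction.toRingHom _ _ g) d)
      rw [Finset.sum_congr rfl fun g _ => h2 g, Finset.sum_const, Finset.card_univ, ← hd,
        nsmul_eq_mul, mul_div_cancel₀ _ hd0]
    rw [Finset.sum_subtype _ (p := fun g => g ∈ MulAction.stabilizer Gal(L/K) w.asIdeal)
      (by simp), map_sum]
    rw [h1]
    rw [← Finset.sum_sub_distrib]
    refine Valuation.map_sum_le _ fun g _ => ?_
    have h3 := valued_completion_smul w g
      (algebraMap L (w.adicCompletion L) z - x / (d : w.adicCompletion L))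
    rw [smul_sub, completion_smul_algebraMap] at h3
    exact h3.trans_le hzx
  · rw [valued_algebraMap]
    refine Valuation.map_sum_le _ fun g hg => ?_
    change w.valuation L (g • z) ≤ _
    rw [valuation_smul, hz, map_mul]
    refine (mul_le_mul_left ((valuation_algebraMap_le_exp_iff _).2 (hs' g⁻¹ fun h => ?_)) _).trans
      (hm g⁻¹)
    exact (Finset.mem_filter.1 hg).2 (inv_mem_iff.1 h)

omit [IsGalois K L] in
theorem smul_algebraMap_completion (g : MulAction.stabilizer Gal(L/K) w.asIdeal)
    (x : v.adicCompletion K) : g • algebraMap (v.adicCompletion K) (w.adicCompletion L) x =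
      algebraMap (v.adicCompletion K) (w.adicCompletion L) x := by
  refine congrFun ((denseRange_algebraMap K v).equalizer
    ((continuous_completionSMul w g).comp (continuous_completionMap v w))
    (continuous_completionMap v w) (funext fun y => ?_)) x
  simp only [Function.comp_apply, completionMap_algebraMap, completionSMul_algebraMap]
  exact congrArg _ ((g : Gal(L/K)).commutes y)

/-- The decomposition group acts faithfully on `L_w`, with fixed field `K_v`. -/
instance isGaloisGroup_completion : IsGaloisGroup (MulAction.stabilizer Gal(L/K) w.asIdeal)
    (v.adicCompletion K) (w.adicCompletion L) where
  faithful := ⟨fun {g h} hgh => Subtype.ext (AlgEquiv.ext fun x => by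
    have h1 := hgh (algebraMap L _ x)
    rw [completion_smul_algebraMap, completion_smul_algebraMap] at h1
    exact RingHom.injective _ h1)⟩
  commutes := ⟨fun g a x => by
    rw [Algebra.smul_def, smul_mul', smul_algebraMap_completion, ← Algebra.smul_def]⟩
  isInvariant := ⟨fun x hx => mem_range_algebraMap_completion v w hx⟩

end LocalExtension

/-! ### The ring of integers of the completion -/

section MaximalIdeal

open WithZero Topology
open scoped Pointwise

variable {B L : Type*} [CommRing B] [IsDedekindDomain B] [Field L] [Algebra B L]
  [IsFractionRing B L] (w : HeightOneSpectrum B)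

variable (L) in
/-- The maximal ideal of the ring of integers of the completion. -/
abbrev completedPrime : HeightOneSpectrum (w.adicCompletionIntegers L) :=
  IsDiscreteValuationRing.maximalIdeal (w.adicCompletionIntegers L)

theorem eq_completedPrime (P : HeightOneSpectrum (w.adicCompletionIntegers L)) :
    P = completedPrime L w :=
  HeightOneSpectrum.ext (IsLocalRing.eq_maximalIdeal P.isMaximal)

theorem mem_completedPrime_pow_iff {x : w.adicCompletionIntegers L} {n : ℕ} :
    x ∈ (completedPrime L w).asIdeal ^ n ↔ Valued.v (x : w.adicCompletion L) ≤ exp (-(n : ℤ)) := by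
  obtain ⟨π, hπ⟩ := w.valuedAdicCompletion_surjective L (exp (-1))
  have hπ1 : π ∈ w.adicCompletionIntegers L := by
    rw [mem_adicCompletionIntegers, hπ, ← exp_zero, exp_le_exp]
    omega
  have hdvd : ∀ {x y : w.adicCompletionIntegers L}, x ∣ y ↔
      Valued.v (y : w.adicCompletion L) ≤ Valued.v (x : w.adicCompletion L) :=
    (adicCompletionIntegers.integers L w).dvd_iff_le
  have h1 : (completedPrime L w).asIdeal = Ideal.span {⟨π, hπ1⟩} := by
    ext y
    change y ∈ IsLocalRing.maximalIdeal _ ↔ _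
    rw [Ideal.mem_span_singleton, hdvd, IsLocalRing.mem_maximalIdeal, mem_nonunits_iff,
      adicCompletionIntegers.isUnit_iff_valued_eq_one, hπ, ← zero_sub, ← lt_exp_iff_le_exp_sub_one,
      exp_zero]
    exact ⟨fun h => lt_of_le_of_ne y.2 h, fun h => h.ne⟩
  rw [h1, Ideal.span_singleton_pow, Ideal.mem_span_singleton, hdvd]
  rw [show (((⟨π, hπ1⟩ : w.adicCompletionIntegers L) ^ n : w.adicCompletionIntegers L) :
    w.adicCompletion L) = π ^ n from rfl, map_pow, hπ, ← exp_nsmul, nsmul_eq_mul, mul_neg, mul_one]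

/-- The integers of the completion can be approximated by integers of the field. -/
theorem exists_valued_algebraMap_sub_coe_le (x : w.adicCompletionIntegers L) (n : ℕ) :
    ∃ r : B, Valued.v (algebraMap L (w.adicCompletion L) (algebraMap B L r) - x) ≤
      exp (-(n : ℤ)) := by
  obtain ⟨y, hy, -⟩ := exists_valued_algebraMap_sub_le w (x : w.adicCompletion L) Filter.univ_mem
    (-(n : ℤ))
  have hy1 : w.valuation L y ≤ 1 := by
    rw [← valued_algebraMap, ← sub_add_cancel (algebraMap L (w.adicCompletion L) y) x]
    refine Valuation.map_add_le _ (hy.trans ?_) x.2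
    rw [← exp_zero, exp_le_exp]
    omega
  obtain ⟨r, hr⟩ := exists_algebraMap_sub_le w hy1 (-(n : ℤ))
  refine ⟨r, map_sub_le_of_sub_le ?_ hy⟩
  rwa [← valued_algebraMap, map_sub] at hr

/-- The residue field of the completion is a quotient of the residue field of `w`. -/
instance finite_quotient_completedPrime [Finite (B ⧸ w.asIdeal)]
    (P : HeightOneSpectrum (w.adicCompletionIntegers L)) :
    Finite (w.adicCompletionIntegers L ⧸ P.asIdeal) := by
  obtain rfl := eq_completedPrime w P
  have hle : w.asIdeal ≤ (completedPrime L w).asIdeal.comap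
      (algebraMap B (w.adicCompletionIntegers L)) := by
    intro r hr
    rw [Ideal.mem_comap, ← pow_one (completedPrime L w).asIdeal, mem_completedPrime_pow_iff]
    refine (valued_algebraMap w _).trans_le ((valuation_algebraMap_le_exp_iff w).2 ?_)
    rwa [pow_one]
  refine Finite.of_surjective (Ideal.quotientMap _ _ hle) fun x => ?_
  obtain ⟨x, rfl⟩ := Ideal.Quotient.mk_surjective x
  obtain ⟨r, hr⟩ := exists_valued_algebraMap_sub_coe_le w x 1
  refine ⟨Ideal.Quotient.mk _ r, ?_⟩
  rw [Ideal.quotientMap_mk, Ideal.Quotient.eq, ← pow_one (completedPrime L w).asIdeal,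
    mem_completedPrime_pow_iff]
  exact hr

end MaximalIdeal

/-! ### The Galois group of the completions -/

section LocalSetup

open WithZero Topology
open scoped Pointwise

variable {K L : Type*} [Field K] [NumberField K] [Field L] [NumberField L] [Algebra K L]
  (v : HeightOneSpectrum (𝓞 K)) (w : HeightOneSpectrum (𝓞 L)) [w.asIdeal.LiesOver v.asIdeal]

instance isScalarTower_completionIntegers : IsScalarTower (v.adicCompletionIntegers K)
    (w.adicCompletionIntegers L) (w.adicCompletion L) :=
  IsScalarTower.of_algebraMap_eq fun _ => rfl

variable [IsGalois K L]

instance isInvariant_completionIntegers : Algebra.IsInvariant (v.adicCompletionIntegers K)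
    (w.adicCompletionIntegers L) (MulAction.stabilizer Gal(L/K) w.asIdeal) where
  isInvariant x hx := by
    obtain ⟨y, hy⟩ := mem_range_algebraMap_completion v w (x := (x : w.adicCompletion L))
      fun g => congrArg Subtype.val (hx g)
    have hy1 : Valued.v y ≤ 1 := by
      have h1 : Valued.v (x : w.adicCompletion L) ≤ 1 := x.2
      rw [← hy, valued_algebraMap_completion] at h1
      exact (pow_le_one_iff_of_nonneg zero_le Nat.card_pos.ne').1 h1
    exact ⟨⟨y, hy1⟩, Subtype.ext hy⟩

instance isIntegral_completionIntegers : Algebra.IsIntegral (v.adicCompletionIntegers K)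
    (w.adicCompletionIntegers L) :=
  Algebra.IsInvariant.isIntegral _ _ (MulAction.stabilizer Gal(L/K) w.asIdeal)

instance finiteDimensional_completion :
    FiniteDimensional (v.adicCompletion K) (w.adicCompletion L) :=
  IsGaloisGroup.finiteDimensional (MulAction.stabilizer Gal(L/K) w.asIdeal) _ _

instance isGalois_completion : IsGalois (v.adicCompletion K) (w.adicCompletion L) :=
  IsGaloisGroup.isGalois (MulAction.stabilizer Gal(L/K) w.asIdeal) _ _

instance isIntegralClosure_completionIntegers : IsIntegralClosure (w.adicCompletionIntegers L)
    (v.adicCompletionIntegers K) (w.adicCompletion L) where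
  algebraMap_injective := IsFractionRing.injective _ _
  isIntegral_iff {x} := by
    constructor
    · intro hx
      exact IsIntegrallyClosed.isIntegral_iff.1 (hx.tower_top (A := w.adicCompletionIntegers L))
    · rintro ⟨y, rfl⟩
      exact (Algebra.IsIntegral.isIntegral (R := v.adicCompletionIntegers K) y).algebraMap

instance finite_completionIntegers : Module.Finite (v.adicCompletionIntegers K)
    (w.adicCompletionIntegers L) :=
  IsIntegralClosure.finite _ (v.adicCompletion K) (w.adicCompletion L) _

/-- The action of the Galois group of the completions on the ring of integers. -/
instance completionGaloisAction : MulSemiringAction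
    Gal(w.adicCompletion L/v.adicCompletion K) (w.adicCompletionIntegers L) :=
  IsIntegralClosure.MulSemiringAction (v.adicCompletionIntegers K) _ _ _

instance smulDistribClass_completion : SMulDistribClass
    Gal(w.adicCompletion L/v.adicCompletion K) (w.adicCompletionIntegers L)
    (w.adicCompletion L) := by
  unfold completionGaloisAction
  infer_instance

instance liesOver_completedPrime :
    (completedPrime L w).asIdeal.LiesOver (completedPrime K v).asIdeal :=
  ⟨(IsLocalRing.eq_maximalIdeal (Ideal.isMaximal_comap_of_isIntegral_of_isMaximal
    (R := v.adicCompletionIntegers K) (completedPrime L w).asIdeal)).symm⟩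

/-- The decomposition group is the Galois group of the completions. -/
def decompositionEquiv : MulAction.stabilizer Gal(L/K) w.asIdeal ≃*
    Gal(w.adicCompletion L/v.adicCompletion K) :=
  IsGaloisGroup.mulEquivCongr _ _ (v.adicCompletion K) (w.adicCompletion L)

theorem decompositionEquiv_smul (g : MulAction.stabilizer Gal(L/K) w.asIdeal)
    (x : w.adicCompletion L) : decompositionEquiv v w g • x = g • x :=
  IsGaloisGroup.mulEquivCongr_apply_smul _ _ _ _ g x

/-- The ramification groups of the completion are those of `w`, because the integers of `L` are
dense in those of `L_w`. -/
theorem decompositionEquiv_mem_inertia_iff (g : MulAction.stabilizer Gal(L/K) w.asIdeal) (n : ℕ) :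
    decompositionEquiv v w g ∈ ((completedPrime L w).asIdeal ^ n).toAddSubgroup.inertia
      Gal(w.adicCompletion L/v.adicCompletion K) ↔
      (g : Gal(L/K)) ∈ (w.asIdeal ^ n).toAddSubgroup.inertia Gal(L/K) := by
  have hcoe : ∀ x : w.adicCompletionIntegers L,
      ((decompositionEquiv v w g • x : w.adicCompletionIntegers L) : w.adicCompletion L) =
        g • (x : w.adicCompletion L) := fun x => by
    rw [← decompositionEquiv_smul v w]
    exact (smul_algebraMap (L := w.adicCompletion L) (decompositionEquiv v w g) x).symm
  have key : ∀ r : 𝓞 L, Valued.v (g • algebraMap L (w.adicCompletion L) (algebraMap (𝓞 L) L r) -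
      algebraMap L (w.adicCompletion L) (algebraMap (𝓞 L) L r)) ≤ exp (-(n : ℤ)) ↔
        (g : Gal(L/K)) • r - r ∈ w.asIdeal ^ n := by
    intro r
    rw [completion_smul_algebraMap, ← map_sub, valued_algebraMap,
      ← valuation_algebraMap_le_exp_iff (L := L), map_sub (algebraMap (𝓞 L) L),
      ← smul_algebraMap (g : Gal(L/K)) r]
    rfl
  constructor
  · intro h r
    have h1 := (mem_completedPrime_pow_iff w).1 (h (algebraMap (𝓞 L) _ r))
    refine (key r).1 ?_
    rw [AddSubgroupClass.coe_sub, hcoe] at h1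
    exact h1
  · intro h x
    refine (mem_completedPrime_pow_iff w).2 ?_
    rw [AddSubgroupClass.coe_sub, hcoe]
    obtain ⟨r, hr'⟩ := exists_valued_algebraMap_sub_coe_le w x n
    refine map_sub_le_of_sub_le (y := g • algebraMap L (w.adicCompletion L) (algebraMap (𝓞 L) L r))
      ?_ (map_sub_le_of_sub_le ((key r).2 (h r)) hr')
    rw [← smul_sub, valued_completion_smul]
    exact map_sub_comm_le hr'

theorem card_inertia_completedPrime_pow {n : ℕ} (hn : n ≠ 0) :
    Nat.card (((completedPrime L w).asIdeal ^ n).toAddSubgroup.inertia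
      Gal(w.adicCompletion L/v.adicCompletion K)) =
      Nat.card ((w.asIdeal ^ n).toAddSubgroup.inertia Gal(L/K)) := by
  let f : (w.asIdeal ^ n).toAddSubgroup.inertia Gal(L/K) →
      ((completedPrime L w).asIdeal ^ n).toAddSubgroup.inertia
        Gal(w.adicCompletion L/v.adicCompletion K) := fun g =>
    ⟨decompositionEquiv v w ⟨g, Ideal.inertia_le_stabilizer w.asIdeal fun x =>
      Ideal.pow_le_self hn (g.2 x)⟩, (decompositionEquiv_mem_inertia_iff v w _ n).2 g.2⟩
  refine (Nat.card_eq_of_bijective f ⟨fun g h hgh => ?_, ?_⟩).symm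
  · have h1 : (f g : Gal(w.adicCompletion L/v.adicCompletion K)) = f h := congrArg Subtype.val hgh
    exact Subtype.ext (Subtype.mk.inj ((decompositionEquiv v w).injective h1))
  · rintro ⟨g, hg⟩
    obtain ⟨g, rfl⟩ := (decompositionEquiv v w).surjective g
    exact ⟨⟨g, (decompositionEquiv_mem_inertia_iff v w _ n).1 hg⟩, rfl⟩

end LocalSetup

/-! ### Comparison of global and local ramification -/

section Comparison

open WithZero FractionalIdeal
open scoped Pointwise

variable {K L : Type*} [Field K] [NumberField K] [Field L] [NumberField L] [Algebra K L]
  [IsGalois K L]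

section Local

variable (v : HeightOneSpectrum (𝓞 K)) (w : HeightOneSpectrum (𝓞 L)) [w.asIdeal.LiesOver v.asIdeal]

theorem inertia_completedPrime_eq_bot_iff :
    ((completedPrime L w).asIdeal ^ 3).toAddSubgroup.inertia
      Gal(w.adicCompletion L/v.adicCompletion K) = ⊥ ↔
      (w.asIdeal ^ 3).toAddSubgroup.inertia Gal(L/K) = ⊥ := by
  rw [← Subgroup.card_eq_one, card_inertia_completedPrime_pow v w three_ne_zero,
    Subgroup.card_eq_one]

theorem ramificationIndex_completedPrime :
    ramificationIndex (v.adicCompletion K) (w.adicCompletion L) (completedPrime L w) =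
      ramificationIndex K L w := by
  have h1 := card_inertia_completedPrime_pow v w one_ne_zero
  rwa [pow_one, pow_one] at h1

theorem wildIndex_completedPrime :
    wildIndex (v.adicCompletion K) (w.adicCompletion L) (completedPrime L w) =
      wildIndex K L w := by
  rw [wildIndex, wildIndex, card_ramificationGroup, card_ramificationGroup]
  exact card_inertia_completedPrime_pow v w two_ne_zero

variable {w} in
/-- Locally at a weakly ramified prime, the different has the same exponent as the global one, so
that it has a square root. -/
theorem exists_isSqrtInverseDifferent_completion {I : FractionalIdeal (𝓞 L)⁰ L}
    (hI : IsSqrtInverseDifferent (𝓞 K) I)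
    (hw : (w.asIdeal ^ 3).toAddSubgroup.inertia Gal(L/K) = ⊥) :
    ∃ J : FractionalIdeal (w.adicCompletionIntegers L)⁰ (w.adicCompletion L),
      IsSqrtInverseDifferent (v.adicCompletionIntegers K) J := by
  have hw' := (inertia_completedPrime_eq_bot_iff v w).2 hw
  have h0 := hI.two_mul_count w
  have h1 := count_differentIdeal_le v w hw
  have h2 := le_count_differentIdeal v w hw
  have h3 := count_differentIdeal_le (completedPrime K v) (completedPrime L w) hw'
  have h4 := le_count_differentIdeal (completedPrime K v) (completedPrime L w) hw'
  rw [ramificationIndex_completedPrime, wildIndex_completedPrime] at h3 h4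
  have hJ : ((completedPrime L w).asIdeal :
      FractionalIdeal (w.adicCompletionIntegers L)⁰ (w.adicCompletion L)) ≠ 0 :=
    coe_asIdeal_ne_zero _
  have hD := coe_differentIdeal_ne_zero (v.adicCompletionIntegers K) (v.adicCompletion K)
    (w.adicCompletionIntegers L) (w.adicCompletion L)
  refine ⟨((completedPrime L w).asIdeal : FractionalIdeal _ _) ^ count L w I, ?_⟩
  refine FractionalIdeal.ext fun x => ?_
  rw [mem_iff_valuation_le (pow_ne_zero _ (zpow_ne_zero _ hJ)),
    mem_iff_valuation_le (inv_ne_zero hD)]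
  refine forall_congr' fun P => ?_
  obtain rfl := eq_completedPrime w P
  rw [count_pow, count_zpow, count_self, count_inv]
  have h5 : ((2 : ℕ) : ℤ) * (count L w I * 1) = -count (w.adicCompletion L) (completedPrime L w)
      (differentIdeal (v.adicCompletionIntegers K) (w.adicCompletionIntegers L) :
        FractionalIdeal _ _) := by
    push_cast
    omega
  rw [h5]

variable {w} in
/-- At a weakly ramified prime, the square root of the inverse different of the completion is free
over the group ring of the decomposition group. -/
theorem isLocallyFreeAt_of_inertia_eq_bot {I : FractionalIdeal (𝓞 L)⁰ L}
    (hI : IsSqrtInverseDifferent (𝓞 K) I)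
    (hw : (w.asIdeal ^ 3).toAddSubgroup.inertia Gal(L/K) = ⊥) : IsLocallyFreeAt v w := by
  obtain ⟨J, hJ⟩ := exists_isSqrtInverseDifferent_completion v hI hw
  have hw' := (inertia_completedPrime_eq_bot_iff v w).2 hw
  have hst : ∀ (g : Gal(w.adicCompletion L/v.adicCompletion K)), ∀ x ∈ J, g • x ∈ J :=
    fun g x hx => hJ.smul_mem g hx
  obtain ⟨x, hx, hgen⟩ := exists_generator_mod_smul (completedPrime K v) (completedPrime L w) hw'
    (hJ.ne_zero (v.adicCompletion K)) hst
    (hJ.exists_count_eq (completedPrime K v) (completedPrime L w) hw')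
  exact ⟨J, hJ, isFreeGaloisModule_of_generator_mod hst (hJ.ne_zero (v.adicCompletion K)) hx hgen⟩

variable {v w} in
theorem inertia_eq_bot_of_isLocallyFreeAt (h : IsLocallyFreeAt v w) :
    (w.asIdeal ^ 3).toAddSubgroup.inertia Gal(L/K) = ⊥ := by
  obtain ⟨J, hJ, M, hM, hfree⟩ := h
  rw [← inertia_completedPrime_eq_bot_iff v w]
  exact inertia_eq_bot_of_isProjectiveGaloisModule _ (hJ.ne_zero (v.adicCompletion K))
    ⟨M, hM, Module.Projective.of_free⟩

end Local

omit [NumberField K] [NumberField L] [IsGalois K L] in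
/-- The higher ramification groups of conjugate primes are conjugate. -/
theorem inertia_smulPrime_eq_bot {w : HeightOneSpectrum (𝓞 L)} (τ : Gal(L/K)) {n : ℕ}
    (hw : (w.asIdeal ^ n).toAddSubgroup.inertia Gal(L/K) = ⊥) :
    ((smulPrime τ w).asIdeal ^ n).toAddSubgroup.inertia Gal(L/K) = ⊥ := by
  rw [Subgroup.eq_bot_iff_forall] at hw ⊢
  intro σ hσ
  have h1 : τ⁻¹ * σ * τ = 1 := by
    refine hw _ fun x => ?_
    have h2 : σ • τ • x - τ • x ∈ (τ • w.asIdeal) ^ n := hσ (τ • x)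
    rw [← smul_pow', Ideal.mem_pointwise_smul_iff_inv_smul_mem, smul_sub, inv_smul_smul] at h2
    rw [mul_smul, mul_smul]
    exact h2
  rw [mul_assoc, inv_mul_eq_one] at h1
  exact (mul_eq_right.1 h1.symm)

/-- Freeness at one prime above `v` gives weak ramification at that prime, hence at all the primes
above `v`, which are conjugate. -/
theorem isWeaklyRamified_of_isLocallyFreeAt (h : ∀ v : HeightOneSpectrum (𝓞 K),
    ∃ (w : HeightOneSpectrum (𝓞 L)) (_ : w.asIdeal.LiesOver v.asIdeal), IsLocallyFreeAt v w) :
    IsWeaklyRamified K L := by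
  intro w
  let v : HeightOneSpectrum (𝓞 K) := ⟨w.asIdeal.under (𝓞 K), inferInstance,
    mt Ideal.eq_bot_of_comap_eq_bot w.ne_bot⟩
  obtain ⟨w₀, hw₀, hfree⟩ := h v
  have : w.asIdeal.LiesOver v.asIdeal := ⟨rfl⟩
  have := isGaloisGroup_integers (A := 𝓞 K) (K := K) (B := 𝓞 L) (L := L)
  obtain ⟨τ, hτ⟩ := Ideal.exists_smul_eq_of_isGaloisGroup v.asIdeal w₀.asIdeal w.asIdeal Gal(L/K)
  obtain rfl : smulPrime τ w₀ = w := HeightOneSpectrum.ext hτ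
  exact inertia_smulPrime_eq_bot τ (inertia_eq_bot_of_isLocallyFreeAt hfree)

theorem isProjectiveGaloisModule_of_isWeaklyRamified {I : FractionalIdeal (𝓞 L)⁰ L}
    (hI : IsSqrtInverseDifferent (𝓞 K) I) (h : IsWeaklyRamified K L) :
    IsProjectiveGaloisModule (𝓞 K) K I := by
  have hst : ∀ (g : Gal(L/K)), ∀ x ∈ I, g • x ∈ I := fun g x hx => hI.smul_mem g hx
  refine isProjectiveGaloisModule_of_generator_mod hst (RingOfIntegers.not_isField K)
    (hI.ne_zero K) fun v => ?_
  obtain ⟨w, hw⟩ := exists_liesOver (B := 𝓞 L) v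
  exact exists_generator_mod_smul v w (h w) (hI.ne_zero K) hst (hI.exists_count_eq v w (h w))

end Comparison

end SqrtInverseDifferent

end

theorem mainTheorem10 (K L : Type*) [Field K] [NumberField K] [Field L] [NumberField L]
    [Algebra K L] [IsGalois K L] (I : FractionalIdeal (𝓞 L)⁰ L)
    (hI : SqrtInverseDifferent.IsSqrtInverseDifferent (𝓞 K) I) :
    List.TFAE [
      SqrtInverseDifferent.IsProjectiveGaloisModule (𝓞 K) K I,
      ∀ (v : HeightOneSpectrum (𝓞 K)) (w : HeightOneSpectrum (𝓞 L))
        [w.asIdeal.LiesOver v.asIdeal], SqrtInverseDifferent.IsLocallyFreeAt v w,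
      ∀ v : HeightOneSpectrum (𝓞 K), ∃ (w : HeightOneSpectrum (𝓞 L))
        (_ : w.asIdeal.LiesOver v.asIdeal), SqrtInverseDifferent.IsLocallyFreeAt v w,
      SqrtInverseDifferent.IsWeaklyRamified K L] := by
  tfae_have 1 → 4 := fun h w =>
    SqrtInverseDifferent.inertia_eq_bot_of_isProjectiveGaloisModule w (hI.ne_zero K) h
  tfae_have 4 → 1 := SqrtInverseDifferent.isProjectiveGaloisModule_of_isWeaklyRamified hI
  tfae_have 4 → 2 := fun h v w _ =>
    SqrtInverseDifferent.isLocallyFreeAt_of_inertia_eq_bot v hI (h w)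
  tfae_have 2 → 3 := fun h v =>
    let ⟨w, hw⟩ := SqrtInverseDifferent.exists_liesOver v
    ⟨w, hw, h v w⟩
  tfae_have 3 → 4 := SqrtInverseDifferent.isWeaklyRamified_of_isLocallyFreeAt
  tfae_finish
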